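/- Let $X=\{(a,b,c)\in\mathbb C^3: a+b+c=0\}$, so $\mathbb P(X)\cong\mathbb P^1(\mathbb C)$. For $z\in\mathbb C\setminus\{0\}$ let $\xi_z=\operatorname{Arg}(z)\bmod\pi\in\mathbb R/\pi$; this identifies $\mathbb P^1(\mathbb R)$ with $\mathbb R/\pi$ by $[x,y]\mapsto\xi_{x+iy}$. Let $\mathsf T=\{(\alpha,\beta,\gamma)\in(\mathbb R/\pi)^3:\alpha+\beta+\gamma=0\}$, and let $\mathbb P((\mathbb R/\pi)^3)$ be the set of triples $[\xi_1,\xi_2,\xi_3]$ in $(\mathbb R/\pi)^3$ modulo simultaneous translation $[\xi_1,\xi_2,\xi_3]=[\xi_1+\xi,\xi_2+\xi,\xi_3+\xi]$. *Triangles.* The set $\mathfrak T$ of labeled, oriented, possibly degenerate triangles consists of all $(B_0;(\mathbf a,\mathbf b,\mathbf c);[a_1,a_2,b_1,b_2,c_1,c_2];(\xi_a,\xi_b,\xi_c))\in\mathbb C\times X\times\mathbb P^5(\mathbb R)\times(\mathbb R/\pi)^3$ such that: if $(\mathbf a,\mathbf b,\mathbf c)\ne 0$, then $[a_1,\dots,c_2]$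 is the class of the real and imaginary parts of $(\mathbf a,\mathbf b,\mathbf c)$; if $(\mathbf a,\mathbf b,\mathbf c)=0$, then $a_1+b_1+c_1=a_2+b_2+c_2=0$; and $\xi_a=\xi_{a_1+a_2i}$ if $a_1+a_2i\neq0$, while $\xi_a$ is arbitrary otherwise, and similarly for $b$ and $c$. The similarity class of a triangle is $$\pi_{\mathfrak D}(T)=([a_1+a_2i,\,b_1+b_2i,\,c_1+c_2i];(\xi_b-\xi_c,\ \xi_c-\xi_a,\ \xi_a-\xi_b))\in\mathbb P(X)\times\mathsf T,$$ and $\mathfrak D=\pi_{\mathfrak D}(\mathfrak T)$ is the set of similarity classes. *Blowups.* Let $[H]=\{[0,1,-1],[1,0,-1],[1,-1,0]\}\subset\mathbb P(X)$ be the three double points. The real blowup $\mathrm{Bl}_{[H]}(\mathbb P(X))\subset\mathbb P(X)\times\mathbb P((\mathbb R/\pi)^3)$ (each double point is replaced by the $\mathbb P^1(\mathbb R)$ of real tangent lines) is glued from the charts $\mathrm{Bl}_{[H]}(\mathbb P(X)_L)$, where $L$ runs over the linear forms that do not vanish on $[H]$, $\mathbb P(X)_L=\{L\ne0\}$, and the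 chart is the closure in $\mathbb P(X)_L\times(\mathbb R/\pi)^3$ of the graph of $[a,b,c]\mapsto(\xi_{a/L},\xi_{b/L},\xi_{c/L})$ on $\mathbb P(X)_L\setminus[H]$. Let $\mathrm{Bl}_{\tilde H}(\mathrm{Bl}_0(\mathbb C\times X))\subset\mathbb C\times X\times\mathbb P^5(\mathbb R)\times(\mathbb R/\pi)^3$ be the iterated real blowup of $\mathbb C\times X$, first at $0\in X$ and then at the strict transform $\tilde H$ of $H=\{\mathbf a\mathbf b\mathbf c=0\}\subset X$. **Theorem.** The map $$\phi([a,b,c];(\alpha,\beta,\gamma))=([a,b,c];[0,-\gamma,\beta])$$ is a bijection of $\mathfrak D$ onto $\mathrm{Bl}_{[H]}(\mathbb P(X))$, and an isomorphism of real algebraic varieties. The set $\mathfrak D\subset\mathbb P(X)\times\mathsf T$ is a smooth real algebraic variety of dimension $2$, and it is diffeomorphic to Dyck's surface $\#_3\mathbb P^2(\mathbb R)$. Moreover $\mathfrak T=\mathrm{Bl}_{\tilde H}(\mathrm{Bl}_0(\mathbb C\times X))$, the map $$\tau(B_0;(\mathbf a,\mathbf b,\mathbf c);[a_1,\dots,c_2];(\xi_a,\xi_b,\xi_c))=([a_1+a_2i,\,b_1+b_2i,\,c_1+c_2i];[\xi_a,\xi_b,\xi_c])$$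 takes $\mathfrak T$ into $\mathrm{Bl}_{[H]}(\mathbb P(X))$, and $\phi\circ\pi_{\mathfrak D}=\tau$. Here $\mathbb P(X)$, $\mathsf T$ and $\mathbb P((\mathbb R/\pi)^3)$ have their standard structures of real algebraic varieties: a line in $\mathbb P(X)\subset\mathbb P^2(\mathbb C)$ is given by the matrix of the orthogonal projection onto it, an angle $\theta\in\mathbb R/\pi$ by $e^{2i\theta}$, and $[\xi_1,\xi_2,\xi_3]$ by the numbers $e^{2i(\xi_j-\xi_k)}$. -/

import Mathlib

open Set
open scoped ContDiff LinearAlgebra.Projectivization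

noncomputable section

/-- Projective spaces over `ℝ` and `ℂ` carry the quotient topology. -/
instance projTopology {K V : Type*} [DivisionRing K] [AddCommGroup V] [Module K V]
    [TopologicalSpace V] : TopologicalSpace (ℙ K V) :=
  inferInstanceAs (TopologicalSpace (Quotient (projectivizationSetoid K V)))

namespace TriangleSpace

/-! ### Triangles -/

/-- The plane `X = V(X + Y + Z) ⊆ ℂ³` of side-vectors `(a, b, c)`. -/
def X : Submodule ℂ (Fin 3 → ℂ) where
  carrier := {v | ∑ i, v i = 0}
  add_mem' := by
    intro v w hv hw
    simp only [mem_ofPred_eq, Pi.add_apply, Finset.sum_add_distrib] at *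
    rw [hv, hw, add_zero]
  zero_mem' := by simp
  smul_mem' := by
    intro c v hv
    simp only [mem_ofPred_eq, Pi.smul_apply, smul_eq_mul, ← Finset.mul_sum] at *
    rw [hv, mul_zero]

/-- The group `ℝ/π`, which is also `P¹(ℝ)` through `[x, y] ↦ Arg (x + iy) mod π`. -/
abbrev Ang : Type := AddCircle Real.pi

/-- `ξ_z = Arg z mod π`, for a nonzero complex number `z`. -/
def xi (z : ℂ) : Ang := ((Complex.arg z : ℝ) : Ang)

/-- `P⁵(ℝ)`, with the homogeneous coordinates `[a₁, a₂, b₁, b₂, c₁, c₂]` grouped in pairs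
`a₁ + a₂ i`, `b₁ + b₂ i`, `c₁ + c₂ i`: it is the space of real lines in `ℂ³ = ℝ⁶`. -/
abbrev P5 : Type := ℙ ℝ (Fin 3 → ℂ)

/-- The space `ℂ₀ × X × P⁵(ℝ) × (ℝ/π)³` of the geometric variables
`(B₀; (a, b, c); [a₁, a₂, b₁, b₂, c₁, c₂]; (ξ_a, ξ_b, ξ_c))`. -/
abbrev TriangleVar : Type := ℂ × X × P5 × (Fin 3 → Ang)

/-- The set `𝔗` of labeled, oriented, possibly degenerate triangles. An argument `ξ i` whose
pair of coordinates in `P⁵(ℝ)` vanishes is unrestricted. (The last condition does not depend on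
the representative of the point of `P⁵(ℝ)`, since `ξ_{tz} = ξ_z` for `t ∈ ℝ^×`.) -/
def triangles : Set TriangleVar :=
  {T | (∀ h : (T.2.1 : Fin 3 → ℂ) ≠ 0, T.2.2.1 = Projectivization.mk ℝ (T.2.1 : Fin 3 → ℂ) h) ∧
    ((T.2.1 : Fin 3 → ℂ) = 0 → ∑ i, T.2.2.1.rep i = 0) ∧
    ∀ i, T.2.2.1.rep i ≠ 0 → T.2.2.2 i = xi (T.2.2.1.rep i)}

theorem rep_mem_X (T : triangles) : T.1.2.2.1.rep ∈ X := by
  obtain ⟨⟨B, v, l, ξ⟩, h1, h2, -⟩ := T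
  dsimp only at h1 h2 ⊢
  by_cases hv : (v : Fin 3 → ℂ) = 0
  · exact h2 hv
  · rw [h1 hv]
    obtain ⟨a, ha⟩ := Projectivization.exists_smul_eq_mk_rep ℝ (v : Fin 3 → ℂ) hv
    rw [← ha]
    have : (a • (v : Fin 3 → ℂ)) = ((a : ℝ) : ℂ) • (v : Fin 3 → ℂ) := by
      ext i
      simp [Units.smul_def]
    rw [this]
    exact X.smul_mem _ v.2

/-! ### Similarity classes -/

/-- The point `[a₁ + a₂ i, b₁ + b₂ i, c₁ + c₂ i]` of `P(X)` defined by a triangle. -/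
def shape (T : triangles) : ℙ ℂ X :=
  Projectivization.mk ℂ ⟨T.1.2.2.1.rep, rep_mem_X T⟩
    (fun h => T.1.2.2.1.rep_nonzero (congrArg Subtype.val h))

/-- The torus `V(P + Q + R) ⊆ (ℝ/π)³` of triples of angles. -/
def torus : AddSubgroup (Fin 3 → Ang) where
  carrier := {θ | ∑ i, θ i = 0}
  add_mem' := by
    intro v w hv hw
    simp only [mem_ofPred_eq, Pi.add_apply, Finset.sum_add_distrib] at *
    rw [hv, hw, add_zero]
  zero_mem' := by simp
  neg_mem' := by
    intro v hv
    simp only [mem_ofPred_eq, Pi.neg_apply, Finset.sum_neg_distrib] at *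
    rw [hv, neg_zero]

/-- The interior angles `(α, β, γ) = (ξ_b - ξ_c, ξ_c - ξ_a, ξ_a - ξ_b)`. -/
def angles (ξ : Fin 3 → Ang) : torus :=
  ⟨![ξ 1 - ξ 2, ξ 2 - ξ 0, ξ 0 - ξ 1], by
    change ∑ i, (![ξ 1 - ξ 2, ξ 2 - ξ 0, ξ 0 - ξ 1] : Fin 3 → Ang) i = 0
    simp [Fin.sum_univ_three]⟩

/-- The projection `π_𝔇`, which takes a triangle to its similarity class: two triangles are
similar when they have the same image in `P(X) × torus`. -/
def classOf (T : triangles) : ℙ ℂ X × torus := (shape T, angles T.1.2.2.2)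

/-- The set `𝔇 ⊆ P(X) × torus` of similarity classes. -/
def classes : Set (ℙ ℂ X × torus) := range classOf

/-! ### The real blowup of `P(X)` at the three double points -/

/-- The diagonal of `(ℝ/π)³`. -/
def diag : AddSubgroup (Fin 3 → Ang) where
  carrier := {θ | ∃ x : Ang, θ = fun _ => x}
  add_mem' := by
    rintro _ _ ⟨x, rfl⟩ ⟨y, rfl⟩
    exact ⟨x + y, rfl⟩
  zero_mem' := ⟨0, rfl⟩
  neg_mem' := by
    rintro _ ⟨x, rfl⟩
    exact ⟨-x, rfl⟩

/-- `P((ℝ/π)³)`: triples `[ξ_a, ξ_b, ξ_c]` modulo simultaneous translation. -/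
abbrev PAng : Type := (Fin 3 → Ang) ⧸ diag

/-- The vectors `(0, 1, -1)`, `(1, 0, -1)`, `(1, -1, 0)` of `X`. -/
def hVec : Fin 3 → X :=
  ![⟨![0, 1, -1], by change ∑ i, (![0, 1, -1] : Fin 3 → ℂ) i = 0; simp [Fin.sum_univ_three]⟩,
    ⟨![1, 0, -1], by change ∑ i, (![1, 0, -1] : Fin 3 → ℂ) i = 0; simp [Fin.sum_univ_three]⟩,
    ⟨![1, -1, 0], by change ∑ i, (![1, -1, 0] : Fin 3 → ℂ) i = 0; simp [Fin.sum_univ_three]⟩]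

/-- The three double points `[H] = {[0, 1, -1], [1, 0, -1], [1, -1, 0]}` of `P(X)`. -/
def doublePoints : Set (ℙ ℂ X) :=
  {p | ∃ i, ∃ h : hVec i ≠ 0, p = Projectivization.mk ℂ (hVec i) h}

/-- The affine part `P(X)_L` of `P(X)` where the linear form `L` does not vanish. -/
def affinePart (L : (Fin 3 → ℂ) →ₗ[ℂ] ℂ) : Set (ℙ ℂ X) := {p | L (p.rep : X) ≠ 0}

/-- The blowup of `P(X)_L` at the double points, for a linear form `L` that does not vanish
there: the closure in `P(X)_L × P¹(ℝ)³` (with `P¹(ℝ) = ℝ/π`) of the graph of the map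
`p ↦ ([X/L (p)], [Y/L (p)], [Z/L (p)])`, which is defined away from the double points. -/
def blowupChart (L : (Fin 3 → ℂ) →ₗ[ℂ] ℂ) : Set (ℙ ℂ X × (Fin 3 → Ang)) :=
  closure {q | q.1 ∈ affinePart L ∧ q.1 ∉ doublePoints ∧
      ∀ i, q.2 i = xi ((q.1.rep : Fin 3 → ℂ) i / L (q.1.rep : X))} ∩
    {q | q.1 ∈ affinePart L}

/-- The real blowup `Bl_[H](P(X)) ⊆ P(X) × P((ℝ/π)³)`: a change of `L` translates the three
arguments by the same angle, and the charts are glued accordingly. -/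
def blowup : Set (ℙ ℂ X × PAng) :=
  {q | ∃ L : (Fin 3 → ℂ) →ₗ[ℂ] ℂ, (∀ i, L (hVec i) ≠ 0) ∧
    ∃ ξ : Fin 3 → Ang, (q.1, ξ) ∈ blowupChart L ∧ q.2 = QuotientAddGroup.mk ξ}

/-- The map `φ ([a, b, c]; (α, β, γ)) = ([a, b, c]; [0, -γ, β])`. -/
def phi (d : ℙ ℂ X × torus) : ℙ ℂ X × PAng :=
  (d.1, QuotientAddGroup.mk ![0, -(d.2 : Fin 3 → Ang) 2, (d.2 : Fin 3 → Ang) 1])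

/-- The map `τ` from triangles to `P(X) × P((ℝ/π)³)`, with value `([a, b, c]; [ξ_a, ξ_b, ξ_c])`. -/
def tau (T : triangles) : ℙ ℂ X × PAng := (shape T, QuotientAddGroup.mk T.1.2.2.2)

/-! ### The iterated real blowup of `ℂ₀ × X` -/

/-- The real blowup of `ℂ₀ × X` at the origin of `X`: the closure of the graph of
`[X₁, X₂, Y₁, Y₂, Z₁, Z₂]` in `ℂ₀ × X × P⁵(ℝ)`. -/
def blowupOrigin : Set (ℂ × X × P5) :=
  closure {q | ∃ h : (q.2.1 : Fin 3 → ℂ) ≠ 0,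
    q.2.2 = Projectivization.mk ℝ (q.2.1 : Fin 3 → ℂ) h}

/-- The strict transform of `H = {abc = 0} ⊆ X`. -/
def strictTransform : Set (ℂ × X × P5) :=
  closure {q | q ∈ blowupOrigin ∧ (q.2.1 : Fin 3 → ℂ) ≠ 0 ∧ ∃ i, (q.2.1 : Fin 3 → ℂ) i = 0}

/-- The real blowup of `blowupOrigin` at the strict transform of `H`: the closure of the graph
of `([X₁, X₂], [Y₁, Y₂], [Z₁, Z₂])`, with values in `P¹(ℝ)³ = (ℝ/π)³`. -/
def iteratedBlowup : Set TriangleVar :=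
  closure {T | (T.1, T.2.1, T.2.2.1) ∈ blowupOrigin ∧ (T.1, T.2.1, T.2.2.1) ∉ strictTransform ∧
    ∀ i, T.2.2.2 i = xi (T.2.2.1.rep i)}

/-! ### Real algebraic varieties -/

/-- The real polynomial functions on a real vector space. -/
def polyFun (E : Type*) [AddCommGroup E] [Module ℝ E] : Subalgebra ℝ (E → ℝ) :=
  Algebra.adjoin ℝ {f | ∃ l : E →ₗ[ℝ] ℝ, f = fun x => l x}

/-- The Zariski tangent space at `x` of a subset `V` of a real vector space: the common kernel of
the differentials at `x` of all real polynomials that vanish on `V`. -/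
def zariskiTangent {E : Type*} [NormedAddCommGroup E] [NormedSpace ℝ E] (V : Set E) (x : E) :
    Submodule ℝ E :=
  ⨅ f ∈ {f | f ∈ polyFun E ∧ ∀ y ∈ V, f y = 0}, LinearMap.ker (fderiv ℝ f x : E →ₗ[ℝ] ℝ)

/-- A nonsingular real algebraic set of (pure) dimension `d`: a zero set of real polynomials
all of whose Zariski tangent spaces have dimension `d`. -/
structure IsSmoothVariety {E : Type*} [NormedAddCommGroup E] [NormedSpace ℝ E]
    (V : Set E) (d : ℕ) : Prop where
  algebraic : ∃ S : Set (E → ℝ), (∀ f ∈ S, f ∈ polyFun E) ∧ V = {x | ∀ f ∈ S, f x = 0}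
  nonsingular : ∀ x ∈ V, Module.finrank ℝ (zariskiTangent V x) = d

/-- `f` is a regular map on `V`: its coordinates are quotients of real polynomials whose
denominators have no zeros on `V`. -/
def IsRegularOn {E F : Type*} [AddCommGroup E] [Module ℝ E] [AddCommGroup F] [Module ℝ F]
    (f : E → F) (V : Set E) : Prop :=
  ∀ l : F →ₗ[ℝ] ℝ, ∃ p ∈ polyFun E, ∃ q ∈ polyFun E, ∀ x ∈ V, q x ≠ 0 ∧ l (f x) = p x / q x

/-- `f` and `g` are mutually inverse isomorphisms of the real algebraic sets `V` and `W`. -/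
structure IsRegularIso {E F : Type*} [AddCommGroup E] [Module ℝ E] [AddCommGroup F] [Module ℝ F]
    (f : E → F) (g : F → E) (V : Set E) (W : Set F) : Prop where
  regular : IsRegularOn f V
  regular_inv : IsRegularOn g W
  mapsTo : MapsTo f V W
  mapsTo_inv : MapsTo g W V
  left_inv : LeftInvOn g f V
  right_inv : RightInvOn g f W

/-- The matrix `(v_i * conj v_j) / |v|²` of the orthogonal projection onto the line of `v`. It
realizes projective space over `ℝ` or `ℂ` as a real algebraic set. -/
def projMatrix {𝕜 : Type*} [RCLike 𝕜] (v : Fin 3 → 𝕜) : Fin 3 → Fin 3 → 𝕜 :=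
  fun i j => v i * star (v j) / ∑ k, v k * star (v k)

/-- The standard realization of the real algebraic variety `P(X) × torus` as an algebraic set:
`P(X) ⊆ P²(ℂ)` by projection matrices, and `ℝ/π = P¹(ℝ)` as the circle by `θ ↦ exp (2iθ)`. -/
def classEmb (d : ℙ ℂ X × torus) : (Fin 3 → Fin 3 → ℂ) × (Fin 3 → ℂ) :=
  (projMatrix (d.1.rep : Fin 3 → ℂ), fun i => (AddCircle.toCircle ((d.2 : Fin 3 → Ang) i) : ℂ))

/-- The corresponding realization of `P(X) × P((ℝ/π)³)`, with `[ξ_a, ξ_b, ξ_c]` given by its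
translation invariant coordinates `exp (2i(ξ_j - ξ_k))`. -/
def blowupEmb (q : ℙ ℂ X × PAng) : (Fin 3 → Fin 3 → ℂ) × (Fin 3 → Fin 3 → ℂ) :=
  (projMatrix (q.1.rep : Fin 3 → ℂ),
    fun j k => (AddCircle.toCircle (Quotient.out q.2 j - Quotient.out q.2 k) : ℂ))

/-! ### Connected sums and Dyck's surface

Smooth manifolds are taken here as subsets of finite-dimensional real vector spaces, with the
smooth structure induced by the ambient space. On such a submanifold, `ContDiffOn ℝ ∞ f s` says
that `f` is smooth in local parametrizations, equivalently that it extends locally to a smooth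
map of the ambient spaces. -/

/-- `f` maps `s` diffeomorphically onto an open subset of `t`. -/
structure IsOpenSmoothEmbedding {E F : Type*} [NormedAddCommGroup E] [NormedSpace ℝ E]
    [NormedAddCommGroup F] [NormedSpace ℝ F] (f : E → F) (s : Set E) (t : Set F) : Prop where
  smooth : ContDiffOn ℝ ∞ f s
  isOpen_image : ∃ O : Set F, IsOpen O ∧ f '' s = t ∩ O
  smooth_inv : ∃ g : F → E, ContDiffOn ℝ ∞ g (f '' s) ∧ LeftInvOn g f s

/-- The surface `M` is a connected sum `M₁ # M₂`: there are discs `h₁` in `M₁` and `h₂` in `M₂`,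
given by embeddings of the open unit disc, such that `M` is obtained from the disjoint union of
`M₁ - h₁(0)` and `M₂ - h₂(0)` by identifying `h₁(tu)` with `h₂((1-t)u)` for `0 < t < 1` and unit
vectors `u`. (Cutting along the circle `t = 1/2` shows `M` as the union of the complements of the
two discs of radius `1/2`, glued along their boundary circles.) -/
def IsConnectedSum {E E₁ E₂ : Type*} [NormedAddCommGroup E] [NormedSpace ℝ E]
    [NormedAddCommGroup E₁] [NormedSpace ℝ E₁] [NormedAddCommGroup E₂] [NormedSpace ℝ E₂]
    (M : Set E) (M₁ : Set E₁) (M₂ : Set E₂) : Prop :=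
  ∃ (h₁ : EuclideanSpace ℝ (Fin 2) → E₁) (h₂ : EuclideanSpace ℝ (Fin 2) → E₂)
    (j₁ : E₁ → E) (j₂ : E₂ → E),
    IsOpenSmoothEmbedding h₁ (Metric.ball 0 1) M₁ ∧
    IsOpenSmoothEmbedding h₂ (Metric.ball 0 1) M₂ ∧
    IsOpenSmoothEmbedding j₁ (M₁ \ {h₁ 0}) M ∧
    IsOpenSmoothEmbedding j₂ (M₂ \ {h₂ 0}) M ∧
    j₁ '' (M₁ \ {h₁ 0}) ∪ j₂ '' (M₂ \ {h₂ 0}) = M ∧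
    ∀ x ∈ M₁ \ {h₁ 0}, ∀ y ∈ M₂ \ {h₂ 0},
      j₁ x = j₂ y ↔ ∃ t : ℝ, 0 < t ∧ t < 1 ∧ ∃ u : EuclideanSpace ℝ (Fin 2), ‖u‖ = 1 ∧
        x = h₁ (t • u) ∧ y = h₂ ((1 - t) • u)

/-- The real projective plane, realized by projection matrices. -/
def realProjectivePlane : Set (Fin 3 → Fin 3 → ℝ) :=
  range fun p : ℙ ℝ (Fin 3 → ℝ) => projMatrix p.rep

/-- `M` is (diffeomorphic to) Dyck's surface `#₃ P²(ℝ) = (P²(ℝ) # P²(ℝ)) # P²(ℝ)`. -/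
def IsDyckSurface {E : Type*} [NormedAddCommGroup E] [NormedSpace ℝ E] (M : Set E) : Prop :=
  ∃ (F : Type) (_ : NormedAddCommGroup F) (_ : NormedSpace ℝ F) (_ : FiniteDimensional ℝ F)
    (N : Set F), IsConnectedSum N realProjectivePlane realProjectivePlane ∧
      IsConnectedSum M N realProjectivePlane

end TriangleSpace

end

open Filter Topology
open scoped ComplexConjugate

noncomputable section

namespace TriangleSpace

/-! ### Angles modulo `π` -/

/-! An angle θ in ℝ/π is the argument of z ≠ 0 exactly when exp(2iθ) z̄ = z. Hence the statement
that the differences of the ξ_i are those of the arguments of the coordinates of r becomes the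
system `Aligned`. It is polynomial in r, r̄ and the numbers exp(2i(ξ_i - ξ_j)), holds trivially
where a coordinate vanishes, is invariant under complex scaling of r and translation of ξ, and is
closed. Membership in 𝔇 and membership in the blowup are both equivalent to it
(`mk_mem_classes_iff`, `mk_mem_blowup_iff`). As φ recovers [ξ] from the interior angles, the
bijection follows at once.

The blowups are closures, so aligned points must be shown to be limits of generic ones. A nonzero
vector of X has at most one zero coordinate; moving that coordinate off zero along a ray of
prescribed argument produces any aligned point in the limit (`exists_direction`). The same curve,
with the side vectors scaled separately, shows that 𝔗 is the iterated blowup.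

In the standard embedding 𝔇 is cut out by explicit equations (`classVariety`): a rank-one Hermitian
matrix M of trace 1 with zero column sums, and three unit numbers u with product 1 that are the
squared directions of the ratios of the sides. There φ is real-affine with a linear inverse. After a
cyclic relabelling, each point lies in a blowup chart (t, m) ↦ z = ct(1 + im), where z is the ratio
of two sides. Chart and inverse are rational, and such a pair identifies the Zariski tangent space
with the image of the differential of the chart (`finrank_zariskiTangent`).

For the topology, let a, b, c be the sides, |a|² + |b|² = 1, p = |a|² and ω = a b̄. Then P(X) is the
sphere |ω|² = p(1 - p), with the double points a = 0 and b = 0 as its poles. Adjoining the squared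
direction u of ω blows up both poles and gives `kleinBottle`; blowing up the point c = 0 as well
gives 𝔇. That blowing up a point is a connected sum with P²(ℝ) is `isConnectedSum_of_blowup`. The
disc is stretched onto the plane by tan(πt/2), so that the gluing t ↦ 1 - t becomes the inversion w
↦ 1/w̄. This is used twice: from P²(ℝ) to the Klein bottle, and from there to 𝔇. -/

/-- The embedding `θ ↦ exp (2iθ)` of `ℝ/π` into `ℂ`. -/
def ex (θ : Ang) : ℂ := (AddCircle.toCircle θ : ℂ)

theorem ex_add (a b : Ang) : ex (a + b) = ex a * ex b := by
  simp [ex, AddCircle.toCircle_add]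

theorem ex_neg (a : Ang) : ex (-a) = conj (ex a) := by
  simp [ex, AddCircle.toCircle_neg, ← Circle.coe_inv_eq_conj]

theorem ex_sub (a b : Ang) : ex (a - b) = ex a * conj (ex b) := by
  rw [sub_eq_add_neg, ex_add, ex_neg]

@[simp] theorem ex_zero : ex 0 = 1 := by simp [ex]

theorem ex_mul_conj (a : Ang) : ex a * conj (ex a) = 1 := by
  rw [← ex_sub, sub_self, ex_zero]

theorem ex_ne_zero (a : Ang) : ex a ≠ 0 := Circle.coe_ne_zero _

theorem ex_injective : Function.Injective ex :=
  Circle.coe_injective.comp (AddCircle.injective_toCircle Real.pi_ne_zero)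

theorem ex_surj {u : ℂ} (hu : u * conj u = 1) : ∃ θ, ex θ = u := by
  have h1 : ‖u‖ = 1 := by
    rw [Complex.mul_conj] at hu
    have : Complex.normSq u = 1 := by exact_mod_cast hu
    rw [Complex.normSq_eq_norm_sq] at this
    nlinarith [norm_nonneg u]
  obtain ⟨θ, hθ⟩ := (AddCircle.homeomorphCircle Real.pi_ne_zero).surjective
    (⟨u, mem_sphere_zero_iff_norm.2 h1⟩ : Circle)
  refine ⟨θ, ?_⟩
  rw [AddCircle.homeomorphCircle_apply] at hθ
  rw [ex, hθ]

theorem isInducing_ex : IsInducing ex := by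
  have h : IsInducing (AddCircle.toCircle : Ang → Circle) := by
    convert (AddCircle.homeomorphCircle Real.pi_ne_zero).isInducing using 1
    funext x
    exact (AddCircle.homeomorphCircle_apply _ x).symm
  have h' : IsInducing ((↑) : Circle → ℂ) := ⟨rfl⟩
  exact h'.comp h

theorem continuous_ex : Continuous ex := isInducing_ex.continuous

/-- The squared direction of z is z / z̄. The denominator is cleared, so that z = 0 needs no
separate case. -/
theorem ex_xi (z : ℂ) : ex (xi z) * conj z = z := by
  have h1 : ex (xi z) = Complex.exp (2 * (Complex.arg z * Complex.I)) := by
    rw [ex, xi, AddCircle.toCircle_apply_mk, Circle.coe_exp]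
    congr 1
    push_cast
    have : (Real.pi : ℂ) ≠ 0 := by exact_mod_cast Real.pi_ne_zero
    field_simp
  have h2 := Complex.norm_mul_exp_arg_mul_I z
  have h3 : conj z = ‖z‖ * Complex.exp (-(Complex.arg z * Complex.I)) := by
    conv_lhs => rw [← h2]
    rw [map_mul, Complex.conj_ofReal, ← Complex.exp_conj]
    simp
  rw [h1, h3, mul_left_comm, ← Complex.exp_add]
  convert h2 using 3
  ring

theorem eq_xi_iff {θ : Ang} {z : ℂ} (hz : z ≠ 0) : θ = xi z ↔ ex θ * conj z = z := by
  constructor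
  · rintro rfl
    exact ex_xi z
  · intro h
    apply ex_injective
    have hz' : conj z ≠ 0 := by simpa using hz
    exact mul_right_cancel₀ hz' (h.trans (ex_xi z).symm)

theorem continuousAt_xi {z : ℂ} (hz : z ≠ 0) : ContinuousAt xi z := by
  rw [isInducing_ex.continuousAt_iff]
  have h : ContinuousAt (fun w : ℂ => w / conj w) z :=
    continuousAt_id.div Complex.continuous_conj.continuousAt (by simpa using hz)
  refine h.congr ?_
  filter_upwards [isOpen_ne.mem_nhds hz] with w hw
  rw [Function.comp, div_eq_iff (by simpa using hw), ex_xi]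

theorem xi_ofReal_mul {t : ℝ} (ht : t ≠ 0) (z : ℂ) (hz : z ≠ 0) : xi (t * z) = xi z := by
  rw [eq_comm, eq_xi_iff (mul_ne_zero (by exact_mod_cast ht) hz), map_mul, Complex.conj_ofReal,
    mul_left_comm, ex_xi]

theorem ne_zero_of_mul_conj_eq_one {u : ℂ} (hu : u * conj u = 1) : u ≠ 0 := by
  rintro rfl
  simp at hu

/-! ### Quotient topology of projective spaces -/

section Proj

variable {K V : Type*} [DivisionRing K] [AddCommGroup V] [Module K V] [TopologicalSpace V]

theorem continuous_projMk :
    Continuous (fun v : {v : V // v ≠ 0} => Projectivization.mk K (v : V) v.2) :=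
  continuous_quotient_mk'

/-- The topology is coinduced from the nonzero vectors, so a scale-invariant function of the
discontinuous choice `rep` can be tested upstairs. -/
theorem continuous_proj_lift {Y : Type*} [TopologicalSpace Y] {g : V → Y}
    (hg : ∀ v, v ≠ 0 → ContinuousAt g v)
    (hinv : ∀ (a : K) (v : V), a ≠ 0 → v ≠ 0 → g (a • v) = g v) :
    Continuous (fun p : ℙ K V => g p.rep) := by
  refine continuous_coinduced_dom.2 ?_
  have : ((fun p : ℙ K V => g p.rep) ∘ fun v : {v : V // v ≠ 0} =>
      Projectivization.mk K (v : V) v.2) = fun v : {v : V // v ≠ 0} => g v := by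
    funext v
    obtain ⟨a, ha⟩ := Projectivization.exists_smul_eq_mk_rep K (v : V) v.2
    simp only [Function.comp]
    rw [← ha]
    exact hinv a v a.ne_zero v.2
  change Continuous ((fun p : ℙ K V => g p.rep) ∘ fun v : {v : V // v ≠ 0} =>
      Projectivization.mk K (v : V) v.2)
  rw [this]
  exact continuous_iff_continuousAt.2 fun v => (hg v v.2).comp continuous_subtype_val.continuousAt

end Proj

theorem mk_rep_eq {K V : Type*} [DivisionRing K] [AddCommGroup V] [Module K V] (v : V) (hv : v ≠ 0) :
    ∃ a : K, a ≠ 0 ∧ (Projectivization.mk K v hv).rep = a • v := by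
  obtain ⟨a, ha⟩ := Projectivization.exists_smul_eq_mk_rep K v hv
  exact ⟨a, a.ne_zero, ha.symm⟩

/-! ### Arguments of the coordinates of a vector -/

/-- The squared Hermitian norm. -/
def nsq (r : Fin 3 → ℂ) : ℂ := ∑ k, r k * conj (r k)

theorem nsq_eq (r : Fin 3 → ℂ) : nsq r = ((∑ k, Complex.normSq (r k) : ℝ) : ℂ) := by
  simp [nsq, Complex.mul_conj]

theorem nsq_ne_zero {r : Fin 3 → ℂ} (hr : r ≠ 0) : nsq r ≠ 0 := by
  rw [nsq_eq]
  have : 0 < ∑ k, Complex.normSq (r k) := by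
    obtain ⟨i, hi⟩ := Function.ne_iff.1 hr
    exact Finset.sum_pos' (fun k _ => Complex.normSq_nonneg _)
      ⟨i, Finset.mem_univ _, Complex.normSq_pos.2 hi⟩
  exact_mod_cast this.ne'

theorem continuous_nsq : Continuous nsq := by
  unfold nsq
  fun_prop

theorem nsq_smul (a : ℂ) (r : Fin 3 → ℂ) : nsq (a • r) = a * conj a * nsq r := by
  simp only [nsq, Pi.smul_apply, smul_eq_mul, map_mul, Finset.mul_sum]
  exact Finset.sum_congr rfl fun i _ => by ring

/-- The differences of the angles `ξ` are those of the arguments of the coordinates of `r`,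
wherever these are defined. -/
def Aligned (r : Fin 3 → ℂ) (ξ : Fin 3 → Ang) : Prop :=
  ∀ i j, ex (ξ i - ξ j) * (conj (r i) * r j) = r i * conj (r j)

/-- The factor c rotates all arguments equally, and the differences do not see it. It is 1 for
triangles and 1/L for the charts of the blowup. -/
theorem aligned_of_xi {r : Fin 3 → ℂ} {ξ : Fin 3 → Ang} {c : ℂ} (hc : c ≠ 0)
    (h : ∀ i, r i ≠ 0 → ξ i = xi (c * r i)) : Aligned r ξ := by
  intro i j
  by_cases hi : r i = 0
  · simp [hi]
  by_cases hj : r j = 0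
  · simp [hj]
  have h1 := (eq_xi_iff (mul_ne_zero hc hi)).1 (h i hi)
  have h2 := congrArg conj ((eq_xi_iff (mul_ne_zero hc hj)).1 (h j hj))
  simp only [map_mul, Complex.conj_conj] at h1 h2
  have hc' : conj c ≠ 0 := by simpa using hc
  rw [ex_sub]
  apply mul_left_cancel₀ (mul_ne_zero hc hc')
  linear_combination (ex (ξ i) * (conj c * conj (r i))) * h2 + conj c * conj (r j) * h1

theorem Aligned.add_const {r : Fin 3 → ℂ} {ξ : Fin 3 → Ang} (h : Aligned r ξ) (a : Ang) :
    Aligned r (fun i => ξ i + a) := by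
  intro i j
  simpa using h i j

theorem Aligned.eq_xi {r : Fin 3 → ℂ} {ξ : Fin 3 → Ang} (h : Aligned r ξ) {c : ℂ} (hc : c ≠ 0)
    {j : Fin 3} (hj : r j ≠ 0) (hξ : ξ j = xi (c * r j)) {i : Fin 3} (hi : r i ≠ 0) :
    ξ i = xi (c * r i) := by
  rw [eq_xi_iff (mul_ne_zero hc hi)]
  have h1 := (eq_xi_iff (mul_ne_zero hc hj)).1 hξ
  have h2 := h i j
  rw [ex_sub] at h2
  have h3 := ex_mul_conj (ξ j)
  simp only [map_mul] at h1 ⊢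
  apply mul_left_cancel₀ (mul_ne_zero (mul_ne_zero hj (ex_ne_zero (ξ j)))
    (show conj (ex (ξ j)) ≠ 0 by simpa using ex_ne_zero (ξ j)))
  linear_combination (ex (ξ j) * conj c) * h2 + r i * h1 - c * r j * r i * h3

theorem Aligned.smul_iff {r : Fin 3 → ℂ} {ξ : Fin 3 → Ang} {c : ℂ} (hc : c ≠ 0) :
    Aligned (c • r) ξ ↔ Aligned r ξ := by
  have hc' : conj c ≠ 0 := by simpa using hc
  refine forall_congr' fun i => forall_congr' fun j => ?_
  simp only [Pi.smul_apply, smul_eq_mul, map_mul]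
  constructor
  · intro h
    apply mul_left_cancel₀ (mul_ne_zero hc hc')
    linear_combination h
  · intro h
    linear_combination c * conj c * h

/-- An aligned triple of angles agrees with the arguments after a translation. -/
theorem Aligned.exists_shift {r : Fin 3 → ℂ} {ξ : Fin 3 → Ang} (h : Aligned r ξ) (hr : r ≠ 0)
    {c : ℂ} (hc : c ≠ 0) : ∃ a : Ang, ∀ i, r i ≠ 0 → ξ i + a = xi (c * r i) := by
  obtain ⟨j, hj⟩ := Function.ne_iff.1 hr
  refine ⟨xi (c * r j) - ξ j, fun i hi => ?_⟩
  exact (h.add_const (xi (c * r j) - ξ j)).eq_xi hc hj (by simp) hi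

/-! ### The set of similarity classes -/

theorem angles_add_const (ξ : Fin 3 → Ang) (a : Ang) : angles (fun i => ξ i + a) = angles ξ := by
  simp [angles]

theorem angles_surj (θ : torus) :
    angles ![0, -(θ : Fin 3 → Ang) 2, (θ : Fin 3 → Ang) 1] = θ := by
  have h : ∑ i, (θ : Fin 3 → Ang) i = 0 := θ.2
  rw [Fin.sum_univ_three] at h
  ext i
  fin_cases i
  · simp only [angles, Fin.zero_eta, Matrix.cons_val_zero, Matrix.cons_val_one, Matrix.cons_val]
    rw [eq_comm, ← sub_eq_zero, ← h]
    abel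
  · simp [angles]
  · simp [angles]

theorem phi_angles (p : ℙ ℂ X) (ξ : Fin 3 → Ang) :
    phi (p, angles ξ) = (p, QuotientAddGroup.mk ξ) := by
  refine Prod.ext rfl ?_
  refine QuotientAddGroup.eq.2 ⟨ξ 0, ?_⟩
  funext i
  fin_cases i <;> simp [angles]

/-- A triangle is aligned with its own arguments; its shape changes the vector by a complex factor
only, and its interior angles determine ξ up to translation. Conversely, an aligned ξ can be
translated onto the actual arguments, and the representative of p then serves as the side vector of
a triangle. -/
theorem mk_mem_classes_iff (p : ℙ ℂ X) (ξ : Fin 3 → Ang) :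
    (p, angles ξ) ∈ classes ↔ Aligned (p.rep : X) ξ := by
  constructor
  · rintro ⟨T, hT⟩
    have h1 : shape T = p := congrArg Prod.fst hT
    have h2 : angles T.1.2.2.2 = angles ξ := congrArg Prod.snd hT
    have h3 : Aligned T.1.2.2.1.rep T.1.2.2.2 :=
      aligned_of_xi one_ne_zero fun i hi => by rw [one_mul]; exact T.2.2.2 i hi
    obtain ⟨a, ha, ha'⟩ := mk_rep_eq (K := ℂ) (⟨T.1.2.2.1.rep, rep_mem_X T⟩ : X)
      (fun h => T.1.2.2.1.rep_nonzero (congrArg Subtype.val h))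
    have h4 : ((p.rep : X) : Fin 3 → ℂ) = a • T.1.2.2.1.rep := by
      rw [← h1]
      exact congrArg Subtype.val ha'
    rw [h4, Aligned.smul_iff ha]
    have h5 : (QuotientAddGroup.mk T.1.2.2.2 : PAng) = QuotientAddGroup.mk ξ := by
      have := phi_angles p T.1.2.2.2
      rw [h2, phi_angles] at this
      exact (congrArg Prod.snd this).symm
    obtain ⟨x, hx⟩ := QuotientAddGroup.eq.1 h5
    have h6 : ξ = fun i => T.1.2.2.2 i + x := by
      funext i
      have := congrFun hx i
      simp only [Pi.add_apply, Pi.neg_apply] at this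
      rw [← this]
      abel
    rw [h6]
    exact h3.add_const x
  · intro h
    have hr : ((p.rep : X) : Fin 3 → ℂ) ≠ 0 := fun h => p.rep_nonzero (Subtype.ext h)
    obtain ⟨b, hb, hb'⟩ := mk_rep_eq (K := ℝ) ((p.rep : X) : Fin 3 → ℂ) hr
    obtain ⟨a, ha⟩ := h.exists_shift hr one_ne_zero
    have hT : ((0, p.rep, Projectivization.mk ℝ ((p.rep : X) : Fin 3 → ℂ) hr,
        fun i => ξ i + a) : TriangleVar) ∈ triangles := by
      refine ⟨fun _ => rfl, fun h0 => absurd h0 hr, fun i hi => ?_⟩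
      dsimp only at hi ⊢
      rw [hb'] at hi ⊢
      have hri : ((p.rep : X) : Fin 3 → ℂ) i ≠ 0 := by
        intro h0
        exact hi (by simp [h0])
      rw [ha i hri, one_mul, Pi.smul_apply, Complex.real_smul, xi_ofReal_mul hb _ hri]
    refine ⟨⟨_, hT⟩, Prod.ext ?_ (angles_add_const ξ a)⟩
    have h7 : shape ⟨_, hT⟩ = Projectivization.mk ℂ p.rep p.rep_nonzero := by
      refine (Projectivization.mk_eq_mk_iff' ℂ _ _ _ _).2 ⟨(b : ℂ), ?_⟩
      apply Subtype.ext
      funext i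
      simp [hb']
    exact h7.trans p.mk_rep

/-! ### Approximation of degenerate triangles -/

theorem mem_X {v : Fin 3 → ℂ} : v ∈ X ↔ v 0 + v 1 + v 2 = 0 := by
  rw [← Fin.sum_univ_three]
  rfl

theorem exists_xi_eq (θ : Ang) : ∃ e : ℂ, e ≠ 0 ∧ xi e = θ := by
  obtain ⟨x, rfl⟩ := QuotientAddGroup.mk_surjective θ
  refine ⟨Complex.exp (x * Complex.I), Complex.exp_ne_zero _, ?_⟩
  rw [eq_comm, eq_xi_iff (Complex.exp_ne_zero _)]
  have h1 : ex (x : Ang) = Complex.exp (2 * (x * Complex.I)) := by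
    rw [ex, AddCircle.toCircle_apply_mk, Circle.coe_exp]
    congr 1
    push_cast
    have : (Real.pi : ℂ) ≠ 0 := by exact_mod_cast Real.pi_ne_zero
    field_simp
  have h2 : conj (Complex.exp (x * Complex.I)) = Complex.exp (-(x * Complex.I)) := by
    rw [← Complex.exp_conj]
    simp
  refine (congrArg₂ (· * ·) h1 h2).trans ?_
  rw [← Complex.exp_add]
  congr 1
  ring

theorem ne_zero_of_mem_X {r : Fin 3 → ℂ} (hr : r ∈ X) (h0 : r ≠ 0) {i j : Fin 3} (hij : j ≠ i)
    (hi : r i = 0) : r j ≠ 0 := by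
  intro hj
  apply h0
  rw [mem_X] at hr
  funext k
  fin_cases i <;> fin_cases j <;> fin_cases k <;> simp_all

theorem exists_mem_X (i : Fin 3) (e : ℂ) : ∃ w ∈ X, w i = e := by
  fin_cases i
  · exact ⟨![e, -e, 0], by simp [mem_X], rfl⟩
  · exact ⟨![-e, e, 0], by simp [mem_X], rfl⟩
  · exact ⟨![-e, 0, e], by simp [mem_X], rfl⟩

theorem hVec_self (i : Fin 3) : (hVec i : Fin 3 → ℂ) i = 0 := by
  fin_cases i <;> simp [hVec]

/-- A vector of `X` is a limit of vectors without vanishing coordinates, whose arguments converge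
to prescribed angles at the vanishing coordinates. -/
theorem exists_direction {r : Fin 3 → ℂ} (hr : r ∈ X) (h0 : r ≠ 0) {ξ : Fin 3 → Ang}
    (hξ : ∀ i, r i ≠ 0 → ξ i = xi (r i)) {L : (Fin 3 → ℂ) →ₗ[ℂ] ℂ} (hL : ∀ i, L (hVec i) ≠ 0) :
    ∃ w ∈ X, L w = 0 ∧ (∀ ε : ℝ, r + (ε : ℂ) • w ≠ 0) ∧
      (∀ᶠ ε : ℝ in 𝓝[≠] 0, ∀ i, (r + (ε : ℂ) • w) i ≠ 0) ∧
      ∀ i, Tendsto (fun ε : ℝ => xi ((r + (ε : ℂ) • w) i)) (𝓝[≠] 0) (𝓝 (ξ i)) := by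
  have hcont : ∀ w : Fin 3 → ℂ, ∀ i,
      Tendsto (fun ε : ℝ => (r + (ε : ℂ) • w) i) (𝓝[≠] 0) (𝓝 (r i)) := by
    intro w i
    have : Continuous fun ε : ℝ => (r + (ε : ℂ) • w) i := by
      simp only [Pi.add_apply, Pi.smul_apply, smul_eq_mul]
      fun_prop
    have h := this.tendsto 0
    simp only [Complex.ofReal_zero, zero_smul, add_zero] at h
    exact h.mono_left nhdsWithin_le_nhds
  have hxi : ∀ w : Fin 3 → ℂ, ∀ i, r i ≠ 0 →
      Tendsto (fun ε : ℝ => xi ((r + (ε : ℂ) • w) i)) (𝓝[≠] 0) (𝓝 (ξ i)) := by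
    intro w i hi
    rw [hξ i hi]
    exact (continuousAt_xi hi).tendsto.comp (hcont w i)
  by_cases hz : ∃ i, r i = 0
  · obtain ⟨i, hi⟩ := hz
    -- The vanishing coordinate is to run along the ray of e, whose argument is the prescribed one;
    -- all other coordinates are nonzero, and their arguments are continuous.
    obtain ⟨e, he, heξ⟩ := exists_xi_eq (ξ i)
    obtain ⟨w₁, hw₁, hw₁i⟩ := exists_mem_X i e
    -- The vector `hVec i` has zero coordinate i, so subtracting a multiple of it kills L and keeps
    -- w i = e.
    set w : Fin 3 → ℂ := w₁ - (L w₁ / L (hVec i)) • (hVec i : Fin 3 → ℂ) with hw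
    have hwi : w i = e := by simp [hw, hVec_self, hw₁i]
    have hwX : w ∈ X := X.sub_mem hw₁ (X.smul_mem _ (hVec i).2)
    refine ⟨w, hwX, ?_, ?_, ?_, ?_⟩
    · simp [hw, hL i]
    · intro ε h
      by_cases hε : ε = 0
      · simp [hε, h0] at h
      · have := congrFun h i
        simp [hi, hwi, he, hε] at this
    · rw [eventually_all]
      intro j
      by_cases hj : j = i
      · subst hj
        filter_upwards [self_mem_nhdsWithin] with ε hε
        have : ε ≠ 0 := hε
        simp [hi, hwi, he, this]
      · exact (hcont w j).eventually_ne (ne_zero_of_mem_X hr h0 hj hi)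
    · intro j
      by_cases hj : j = i
      · subst hj
        refine tendsto_const_nhds.congr' ?_
        filter_upwards [self_mem_nhdsWithin] with ε hε
        rw [Pi.add_apply, hi, zero_add, Pi.smul_apply, hwi, smul_eq_mul, xi_ofReal_mul hε _ he, heξ]
      · exact hxi w j (ne_zero_of_mem_X hr h0 hj hi)
  · push Not at hz
    refine ⟨0, X.zero_mem, by simp, by simpa using h0, by simpa using hz, fun i => hxi 0 i (hz i)⟩

/-! ### The blowup of `P(X)` -/

theorem rep_ne (p : ℙ ℂ X) : ((p.rep : X) : Fin 3 → ℂ) ≠ 0 :=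
  fun h => p.rep_nonzero (Subtype.ext h)

theorem projMatrix_smul {a : ℂ} (ha : a ≠ 0) (r : Fin 3 → ℂ) :
    projMatrix (a • r) = projMatrix r := by
  funext i j
  have h : ∀ v : Fin 3 → ℂ, projMatrix v i j = v i * conj (v j) / nsq v := fun v => rfl
  rw [h, h, nsq_smul]
  have ha' : conj a ≠ 0 := by simpa using ha
  rw [← mul_div_mul_left _ (nsq r) (mul_ne_zero ha ha')]
  simp only [Pi.smul_apply, smul_eq_mul, map_mul]
  congr 1
  ring

theorem projMatrix_apply (r : Fin 3 → ℂ) (i j : Fin 3) :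
    projMatrix r i j = r i * conj (r j) / nsq r := rfl

theorem continuous_projMatrix_rep (i j : Fin 3) :
    Continuous fun p : ℙ ℂ X => projMatrix ((p.rep : X) : Fin 3 → ℂ) i j := by
  refine continuous_proj_lift (g := fun v : X => projMatrix (v : Fin 3 → ℂ) i j) ?_ ?_
  · intro v hv
    have : nsq (v : Fin 3 → ℂ) ≠ 0 := nsq_ne_zero fun h => hv (Subtype.ext h)
    simp only [projMatrix_apply]
    have hc : ∀ k, Continuous fun v : X => (v : Fin 3 → ℂ) k :=
      fun k => (continuous_apply k).comp continuous_subtype_val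
    refine ContinuousAt.div ?_ ?_ this
    · exact ((hc i).mul (Complex.continuous_conj.comp (hc j))).continuousAt
    · exact (continuous_nsq.comp continuous_subtype_val).continuousAt
  · intro a v ha _
    exact congrFun (congrFun (projMatrix_smul ha (v : Fin 3 → ℂ)) i) j

/-- Division by the squared norm makes both sides functions on P(X); closedness of alignment is read
off from this form. -/
theorem aligned_iff_projMatrix {r : Fin 3 → ℂ} (hr : r ≠ 0) (ξ : Fin 3 → Ang) :
    Aligned r ξ ↔ ∀ i j, ex (ξ i - ξ j) * projMatrix r j i = projMatrix r i j := by
  refine forall_congr' fun i => forall_congr' fun j => ?_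
  rw [projMatrix_apply, projMatrix_apply, ← mul_div_assoc, div_left_inj' (nsq_ne_zero hr),
    mul_comm (r j)]

theorem isClosed_aligned :
    IsClosed {q : ℙ ℂ X × (Fin 3 → Ang) | Aligned (q.1.rep : X) q.2} := by
  have : {q : ℙ ℂ X × (Fin 3 → Ang) | Aligned (q.1.rep : X) q.2} =
      ⋂ i, ⋂ j, {q | ex (q.2 i - q.2 j) * projMatrix ((q.1.rep : X) : Fin 3 → ℂ) j i =
        projMatrix ((q.1.rep : X) : Fin 3 → ℂ) i j} := by
    ext q
    simp only [mem_ofPred_eq, mem_iInter]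
    exact aligned_iff_projMatrix (rep_ne q.1) q.2
  rw [this]
  refine isClosed_iInter fun i => isClosed_iInter fun j => isClosed_eq ?_ ?_
  · refine Continuous.mul (continuous_ex.comp ?_) ((continuous_projMatrix_rep j i).comp
      continuous_fst)
    fun_prop
  · exact (continuous_projMatrix_rep i j).comp continuous_fst

/-- The forms (1, t, t²) with t = 2, 3, 4 are independent by Vandermonde, so they do not all vanish
at r. Their values at the three double points are t - t², 1 - t² and 1 - t, all nonzero. The
coefficients used below invert the Vandermonde matrix. -/
theorem exists_linearForm {r : Fin 3 → ℂ} (hr : r ≠ 0) :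
    ∃ L : (Fin 3 → ℂ) →ₗ[ℂ] ℂ, (∀ i, L (hVec i) ≠ 0) ∧ L r ≠ 0 := by
  let L : ℂ → (Fin 3 → ℂ) →ₗ[ℂ] ℂ := fun t =>
    LinearMap.proj 0 + t • LinearMap.proj 1 + t ^ 2 • LinearMap.proj 2
  have hL : ∀ t v, L t v = v 0 + t * v 1 + t ^ 2 * v 2 := fun t v => by simp [L]
  by_contra! h
  have h2 := h (L 2) (by intro i; fin_cases i <;> simp [hL, hVec] <;> norm_num)
  have h3 := h (L 3) (by intro i; fin_cases i <;> simp [hL, hVec] <;> norm_num)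
  have h4 := h (L 4) (by intro i; fin_cases i <;> simp [hL, hVec] <;> norm_num)
  rw [hL] at h2 h3 h4
  apply hr
  funext i
  fin_cases i
  · simp only [Fin.zero_eta, Pi.zero_apply]
    linear_combination 6 * h2 - 8 * h3 + 3 * h4
  · simp only [Fin.mk_one, Pi.zero_apply]
    linear_combination -7 / 2 * h2 + 6 * h3 - 5 / 2 * h4
  · simp only [Fin.reduceFinMk, Pi.zero_apply]
    linear_combination 1 / 2 * h2 - h3 + 1 / 2 * h4

theorem exists_rep_eq_zero {p : ℙ ℂ X} (hp : p ∈ doublePoints) :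
    ∃ i, ((p.rep : X) : Fin 3 → ℂ) i = 0 := by
  obtain ⟨i, h, rfl⟩ := hp
  obtain ⟨a, -, ha⟩ := mk_rep_eq (K := ℂ) (hVec i) h
  exact ⟨i, by rw [ha]; simp [hVec_self]⟩

/-- Alignment is closed and holds on each graph, hence on its closure. Conversely, the curve of
`exists_direction` lies in the graph for small nonzero parameters and tends to the given aligned
point. -/
theorem mk_mem_blowup_iff (p : ℙ ℂ X) (ξ : Fin 3 → Ang) :
    ((p, QuotientAddGroup.mk ξ) : ℙ ℂ X × PAng) ∈ blowup ↔ Aligned (p.rep : X) ξ := by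
  constructor
  · rintro ⟨L, hL, η, ⟨hη, hpL⟩, hξη⟩
    have h1 : Aligned (p.rep : X) η := by
      refine closure_minimal (t := {q : ℙ ℂ X × (Fin 3 → Ang) | Aligned (q.1.rep : X) q.2})
        ?_ isClosed_aligned hη
      rintro q ⟨hq, -, h⟩
      refine aligned_of_xi (inv_ne_zero hq) fun i _ => ?_
      rw [h i, div_eq_inv_mul]
    obtain ⟨x, hx⟩ := QuotientAddGroup.eq.1 hξη.symm
    have h6 : ξ = fun i => η i + x := by
      funext i
      have := congrFun hx i
      simp only [Pi.add_apply, Pi.neg_apply] at this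
      rw [← this]
      abel
    rw [h6]
    exact h1.add_const x
  · intro h
    have hr := rep_ne p
    obtain ⟨L, hL, hLr⟩ := exists_linearForm hr
    obtain ⟨a, ha⟩ := h.exists_shift hr (inv_ne_zero hLr)
    -- With L(r) = 1 and L(w) = 0 the form L is 1 along the whole curve, so the quotients by L are
    -- simply the coordinates of r + εw.
    set r : X := (L (p.rep : X))⁻¹ • p.rep with hrdef
    have hr0 : (r : Fin 3 → ℂ) ≠ 0 := by
      intro h0
      exact hr (by simpa [hrdef, hLr] using h0)
    obtain ⟨w, hwX, hLw, hne, hev, hlim⟩ := exists_direction r.2 hr0 (ξ := fun i => ξ i + a)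
      (fun i hi => ha i fun h0 => hi (by simp [hrdef, h0])) hL
    have hne' : ∀ ε : ℝ, r + (ε : ℂ) • (⟨w, hwX⟩ : X) ≠ 0 :=
      fun ε h0 => hne ε (congrArg Subtype.val h0)
    let path : ℝ → ℙ ℂ X := fun ε => Projectivization.mk ℂ _ (hne' ε)
    have hpath : Continuous path := by
      refine continuous_projMk.comp (f := fun ε : ℝ =>
        (⟨r + (ε : ℂ) • (⟨w, hwX⟩ : X), hne' ε⟩ : {v : X // v ≠ 0})) ?_
      refine Continuous.subtype_mk ?_ _
      refine Continuous.subtype_mk (f := fun ε : ℝ => (r : Fin 3 → ℂ) + (ε : ℂ) • w) ?_ _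
      fun_prop
    have hpath0 : path 0 = p := by
      conv_rhs => rw [← p.mk_rep]
      refine (Projectivization.mk_eq_mk_iff' ℂ _ _ _ _).2 ⟨(L (p.rep : X))⁻¹, ?_⟩
      simp [hrdef]
    refine ⟨L, hL, fun i => ξ i + a, ⟨?_, hLr⟩, ?_⟩
    · refine mem_closure_of_tendsto (b := 𝓝[≠] (0 : ℝ)) (f := fun ε => (path ε,
        fun i => xi ((((r : X) : Fin 3 → ℂ) + (ε : ℂ) • w) i))) ?_ ?_
      · refine Tendsto.prodMk_nhds ?_ (tendsto_pi_nhds.2 hlim)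
        have := hpath.tendsto 0
        rw [hpath0] at this
        exact this.mono_left nhdsWithin_le_nhds
      · filter_upwards [hev] with ε hε
        obtain ⟨b, hb, hb'⟩ := mk_rep_eq (K := ℂ) _ (hne' ε)
        have hb2 : (((path ε).rep : X) : Fin 3 → ℂ) = b • ((r : Fin 3 → ℂ) + (ε : ℂ) • w) :=
          congrArg Subtype.val hb'
        have hL1 : L (((path ε).rep : X) : Fin 3 → ℂ) = b := by
          rw [hb2]
          simp [hLw, hrdef, hLr]
        refine ⟨?_, ?_, ?_⟩
        · change L (((path ε).rep : X) : Fin 3 → ℂ) ≠ 0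
          rwa [hL1]
        · intro hd
          obtain ⟨i, hi⟩ := exists_rep_eq_zero hd
          rw [hb2, Pi.smul_apply, smul_eq_mul] at hi
          exact (mul_ne_zero hb (hε i)) hi
        · intro i
          rw [hL1, hb2, Pi.smul_apply, smul_eq_mul, mul_div_cancel_left₀ _ hb]
    · refine QuotientAddGroup.eq.2 ⟨a, ?_⟩
      funext i
      simp

theorem bijOn_phi : BijOn phi classes blowup := by
  have key : ∀ (p : ℙ ℂ X) (θ : torus), ∃ ξ, θ = angles ξ :=
    fun _ θ => ⟨_, (angles_surj θ).symm⟩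
  refine ⟨?_, ?_, ?_⟩
  · rintro ⟨p, θ⟩ h
    obtain ⟨ξ, rfl⟩ := key p θ
    rw [phi_angles, mk_mem_blowup_iff]
    exact (mk_mem_classes_iff p ξ).1 h
  · rintro ⟨p, θ⟩ - ⟨p', θ'⟩ - h
    obtain ⟨ξ, rfl⟩ := key p θ
    obtain ⟨ξ', rfl⟩ := key p' θ'
    rw [phi_angles, phi_angles, Prod.mk.injEq] at h
    obtain ⟨rfl, h⟩ := h
    obtain ⟨x, hx⟩ := QuotientAddGroup.eq.1 h
    have h6 : ξ' = fun i => ξ i + x := by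
      funext i
      have := congrFun hx i
      simp only [Pi.add_apply, Pi.neg_apply] at this
      rw [← this]
      abel
    rw [h6, angles_add_const]
  · rintro ⟨p, q⟩ h
    obtain ⟨ξ, rfl⟩ := QuotientAddGroup.mk_surjective q
    exact ⟨(p, angles ξ), (mk_mem_classes_iff p ξ).2 ((mk_mem_blowup_iff p ξ).1 h),
      phi_angles p ξ⟩

theorem phi_classOf (T : triangles) : phi (classOf T) = tau T :=
  phi_angles _ _

theorem tau_mem_blowup (T : triangles) : tau T ∈ blowup := by
  rw [← phi_classOf]
  exact bijOn_phi.mapsTo ⟨T, rfl⟩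

theorem X_equiv : Nonempty (X ≃ₗ[ℂ] (Fin 2 → ℂ)) := by
  refine ⟨{ toFun := fun v => ![(v : Fin 3 → ℂ) 0, (v : Fin 3 → ℂ) 1]
            map_add' := fun v w => by funext i; fin_cases i <;> simp
            map_smul' := fun a v => by funext i; fin_cases i <;> simp
            invFun := fun v => ⟨![v 0, v 1, -v 0 - v 1], by simp [mem_X]⟩
            left_inv := fun v => ?_
            right_inv := fun v => ?_ }⟩
  · have hv := mem_X.1 v.2
    refine Subtype.ext (funext fun i => ?_)
    fin_cases i
    · rfl
    · rfl
    · change -(v : Fin 3 → ℂ) 0 - (v : Fin 3 → ℂ) 1 = (v : Fin 3 → ℂ) 2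
      linear_combination -hv
  · funext i
    fin_cases i <;> rfl

/-! ### The iterated blowup of `ℂ₀ × X` -/

theorem nsq_real_smul (t : ℝ) (v : Fin 3 → ℂ) : nsq (t • v) = (t : ℂ) ^ 2 * nsq v := by
  have : t • v = (t : ℂ) • v := by
    ext i
    simp
  rw [this, nsq_smul, Complex.conj_ofReal, sq]

/-- Quadratic functions of a vector descend to continuous functions on `P⁵(ℝ)`. -/
theorem continuous_quadratic_rep {f : (Fin 3 → ℂ) → ℂ} (hf : Continuous f)
    (hinv : ∀ (t : ℝ) v, f (t • v) = (t : ℂ) ^ 2 * f v) :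
    Continuous fun p : P5 => f p.rep / nsq p.rep := by
  refine continuous_proj_lift (g := fun v => f v / nsq v) ?_ ?_
  · exact fun v hv => hf.continuousAt.div continuous_nsq.continuousAt (nsq_ne_zero hv)
  · intro t v ht _
    have ht' : (t : ℂ) ^ 2 ≠ 0 := pow_ne_zero 2 (by exact_mod_cast ht)
    rw [hinv, nsq_real_smul, mul_div_mul_left _ _ ht']

theorem continuous_herm (i j : Fin 3) :
    Continuous fun p : P5 => p.rep i * conj (p.rep j) / nsq p.rep := by
  refine continuous_quadratic_rep (f := fun v => v i * conj (v j)) (by fun_prop) ?_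
  intro t v
  simp only [Pi.smul_apply, Complex.real_smul, map_mul, Complex.conj_ofReal]
  ring

theorem continuous_symm (i j : Fin 3) :
    Continuous fun p : P5 => p.rep i * p.rep j / nsq p.rep := by
  refine continuous_quadratic_rep (f := fun v => v i * v j) (by fun_prop) ?_
  intro t v
  simp only [Pi.smul_apply, Complex.real_smul]
  ring

/-- The sum of the coordinates is not a function on P⁵(ℝ), but its products with conj r_j / |r|²
are, and some r_j is nonzero. -/
theorem sum_eq_zero_iff (p : P5) :
    ∑ i, p.rep i = 0 ↔ ∀ j, ∑ i, p.rep i * conj (p.rep j) / nsq p.rep = 0 := by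
  have hn := nsq_ne_zero p.rep_nonzero
  simp only [← Finset.sum_div, ← Finset.sum_mul, div_eq_zero_iff, hn, or_false, mul_eq_zero,
    map_eq_zero]
  constructor
  · intro h j
    exact Or.inl h
  · intro h
    by_contra h0
    exact p.rep_nonzero (funext fun j => (h j).resolve_left h0)

/-- The equation exp(2iθ) r̄_i = r_i is multiplied by r_i / |r|²: the result is invariant under real
scaling and empty when r_i = 0. -/
theorem eq_xi_rep_iff (p : P5) (θ : Ang) (i : Fin 3) :
    (p.rep i ≠ 0 → θ = xi (p.rep i)) ↔
      ex θ * (p.rep i * conj (p.rep i) / nsq p.rep) = p.rep i * p.rep i / nsq p.rep := by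
  have hn := nsq_ne_zero p.rep_nonzero
  rw [← mul_div_assoc, div_left_inj' hn]
  by_cases hi : p.rep i = 0
  · simp [hi]
  · rw [eq_xi_iff hi]
    constructor
    · intro h
      linear_combination p.rep i * h hi
    · intro h _
      apply mul_left_cancel₀ hi
      linear_combination h

/-- The right side says that v equals its real orthogonal projection Re⟨v, r⟩ r / |r|² onto the line
of r. The coefficients r_i r̄_k / |r|² and r_i r_k / |r|² are continuous on P⁵(ℝ), which makes the
condition closed. -/
theorem real_smul_rep_iff (p : P5) (v : Fin 3 → ℂ) :
    (∃ t : ℝ, v = t • p.rep) ↔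
      ∀ i, 2 * v i = ∑ k, (p.rep i * conj (p.rep k) / nsq p.rep * v k +
        p.rep i * p.rep k / nsq p.rep * conj (v k)) := by
  have hn := nsq_ne_zero p.rep_nonzero
  constructor
  · rintro ⟨t, rfl⟩ i
    have : ∀ k, (p.rep i * conj (p.rep k) / nsq p.rep * (t • p.rep) k +
        p.rep i * p.rep k / nsq p.rep * conj ((t • p.rep) k)) =
        2 * t * p.rep i / nsq p.rep * (p.rep k * conj (p.rep k)) := by
      intro k
      simp only [Pi.smul_apply, Complex.real_smul, map_mul, Complex.conj_ofReal]
      ring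
    simp only [this, ← Finset.mul_sum]
    change _ = _ * nsq p.rep
    rw [div_mul_cancel₀ _ hn]
    simp only [Pi.smul_apply, Complex.real_smul]
    ring
  · intro h
    have hN : nsq p.rep = ((∑ k, Complex.normSq (p.rep k) : ℝ) : ℂ) := nsq_eq _
    refine ⟨(∑ k, (p.rep k * conj (v k)).re) / ∑ k, Complex.normSq (p.rep k), ?_⟩
    funext i
    rw [Pi.smul_apply, Complex.real_smul, Complex.ofReal_div, ← hN]
    push_cast
    have hre : ∀ k, (((p.rep k * conj (v k)).re : ℝ) : ℂ) =
        (p.rep k * conj (v k) + conj (p.rep k) * v k) / 2 := by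
      intro k
      rw [Complex.re_eq_add_conj]
      simp
    simp only [hre]
    have h2 : (2 : ℂ) ≠ 0 := two_ne_zero
    apply mul_left_cancel₀ h2
    rw [h i, Finset.sum_div, Finset.sum_mul, Finset.mul_sum]
    refine Finset.sum_congr rfl fun k _ => ?_
    field_simp
    ring

/-- The two cases of zero and nonzero side vectors merge into a single condition: the side vector is
some real multiple t of the representative, with t = 0 allowed. -/
theorem mem_triangles_iff (T : TriangleVar) :
    T ∈ triangles ↔ (∃ t : ℝ, (T.2.1 : Fin 3 → ℂ) = t • T.2.2.1.rep) ∧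
      ∑ i, T.2.2.1.rep i = 0 ∧ ∀ i, T.2.2.1.rep i ≠ 0 → T.2.2.2 i = xi (T.2.2.1.rep i) := by
  constructor
  · intro h
    refine ⟨?_, rep_mem_X ⟨T, h⟩, h.2.2⟩
    by_cases hv : (T.2.1 : Fin 3 → ℂ) = 0
    · exact ⟨0, by rw [hv, zero_smul]⟩
    · obtain ⟨a, ha, ha'⟩ := mk_rep_eq (K := ℝ) (T.2.1 : Fin 3 → ℂ) hv
      refine ⟨a⁻¹, ?_⟩
      rw [h.1 hv, ha', smul_smul, inv_mul_cancel₀ ha, one_smul]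
  · rintro ⟨⟨t, ht⟩, h2, h3⟩
    refine ⟨fun hv => ?_, fun _ => h2, h3⟩
    rw [← T.2.2.1.mk_rep]
    refine (Projectivization.mk_eq_mk_iff' ℝ _ _ _ _).2 ⟨t⁻¹, ?_⟩
    have ht0 : t ≠ 0 := by
      rintro rfl
      exact hv (by rw [ht, zero_smul])
    rw [ht, smul_smul, inv_mul_cancel₀ ht0, one_smul]

theorem continuous_vec (i : Fin 3) :
    Continuous fun q : ℂ × X × P5 => (q.2.1 : Fin 3 → ℂ) i :=
  (continuous_apply i).comp (continuous_subtype_val.comp (continuous_fst.comp continuous_snd))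

theorem isClosed_smul_rep :
    IsClosed {q : ℂ × X × P5 | (∃ t : ℝ, (q.2.1 : Fin 3 → ℂ) = t • q.2.2.rep) ∧
      ∑ i, q.2.2.rep i = 0} := by
  have hp : Continuous fun q : ℂ × X × P5 => q.2.2 := by fun_prop
  simp only [real_smul_rep_iff, sum_eq_zero_iff]
  refine IsClosed.and ?_ ?_
  · simp only [ofPred_forall]
    refine isClosed_iInter fun i => isClosed_eq ?_ ?_
    · exact continuous_const.mul (continuous_vec i)
    · refine continuous_finsetSum _ fun k _ => Continuous.add ?_ ?_
      · exact ((continuous_herm i k).comp hp).mul (continuous_vec k)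
      · exact ((continuous_symm i k).comp hp).mul
          (Complex.continuous_conj.comp (continuous_vec k))
  · simp only [ofPred_forall]
    refine isClosed_iInter fun j => isClosed_eq ?_ continuous_const
    exact continuous_finsetSum _ fun k _ => (continuous_herm k j).comp hp

theorem blowupOrigin_subset :
    blowupOrigin ⊆ {q | (∃ t : ℝ, (q.2.1 : Fin 3 → ℂ) = t • q.2.2.rep) ∧
      ∑ i, q.2.2.rep i = 0} := by
  refine closure_minimal ?_ isClosed_smul_rep
  rintro q ⟨h, hq⟩
  obtain ⟨a, ha, ha'⟩ := mk_rep_eq (K := ℝ) (q.2.1 : Fin 3 → ℂ) h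
  constructor
  · refine ⟨a⁻¹, ?_⟩
    rw [hq, ha', smul_smul, inv_mul_cancel₀ ha, one_smul]
  · rw [hq, ha']
    have := mem_X.1 q.2.1.2
    simp only [Fin.sum_univ_three, Pi.smul_apply, Complex.real_smul]
    linear_combination (a : ℂ) * this

/-- Away from the origin v = t r with t ≠ 0, so a zero coordinate of v is one of r, and this
persists in the closure. Only this inclusion is needed: it shows that generic points avoid the
strict transform. -/
theorem strictTransform_subset :
    strictTransform ⊆ {q | ∃ i, q.2.2.rep i = 0} := by
  have hp : Continuous fun q : ℂ × X × P5 => q.2.2 := by fun_prop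
  refine closure_minimal ?_ ?_
  · rintro q ⟨hq, hv, i, hi⟩
    obtain ⟨t, ht⟩ := (blowupOrigin_subset hq).1
    refine ⟨i, ?_⟩
    have ht0 : t ≠ 0 := by
      rintro rfl
      exact hv (by rw [ht, zero_smul])
    rw [ht, Pi.smul_apply] at hi
    exact (smul_eq_zero.1 hi).resolve_left ht0
  · simp only [ofPred_exists]
    refine isClosed_iUnion_of_finite fun i => ?_
    have : {q : ℂ × X × P5 | q.2.2.rep i = 0} =
        {q | q.2.2.rep i * conj (q.2.2.rep i) / nsq q.2.2.rep = 0} := by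
      ext q
      simp [nsq_ne_zero q.2.2.rep_nonzero]
    rw [this]
    exact isClosed_eq ((continuous_herm i i).comp hp) continuous_const

theorem isClosed_triangles : IsClosed triangles := by
  have h1 : Continuous fun T : TriangleVar => ((T.1, T.2.1, T.2.2.1) : ℂ × X × P5) := by fun_prop
  have hp : Continuous fun T : TriangleVar => T.2.2.1 := by fun_prop
  have : triangles = {T : TriangleVar | ((∃ t : ℝ, (T.2.1 : Fin 3 → ℂ) = t • T.2.2.1.rep) ∧
      ∑ i, T.2.2.1.rep i = 0) ∧ ∀ i, T.2.2.1.rep i ≠ 0 → T.2.2.2 i = xi (T.2.2.1.rep i)} := by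
    ext T
    rw [mem_triangles_iff, mem_ofPred_eq, and_assoc]
  rw [this]
  refine IsClosed.and (isClosed_smul_rep.preimage h1) ?_
  simp only [eq_xi_rep_iff, ofPred_forall]
  refine isClosed_iInter fun i => isClosed_eq ?_ ((continuous_symm i i).comp hp)
  refine Continuous.mul (continuous_ex.comp ?_) ((continuous_herm i i).comp hp)
  fun_prop

theorem triangles_eq_iteratedBlowup : triangles = iteratedBlowup := by
  apply subset_antisymm
  · intro T hT
    obtain ⟨⟨s, hs⟩, hX, hξ⟩ := (mem_triangles_iff T).1 hT
    have h0 := T.2.2.1.rep_nonzero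
    obtain ⟨L, hL, -⟩ := exists_linearForm h0
    set r := T.2.2.1.rep with hr
    have hrX : r ∈ X := hX
    obtain ⟨w, hwX, -, hne, hev, hlim⟩ := exists_direction hrX h0 hξ hL
    have hmem : ∀ ε : ℝ, r + (ε : ℂ) • w ∈ X := fun ε => X.add_mem hrX (X.smul_mem _ hwX)
    let path : ℝ → P5 := fun ε => Projectivization.mk ℝ _ (hne ε)
    have hcont : Continuous fun ε : ℝ => r + (ε : ℂ) • w := by fun_prop
    have hpath : Continuous path := continuous_projMk.comp (f := fun ε : ℝ =>
      (⟨_, hne ε⟩ : {v : Fin 3 → ℂ // v ≠ 0})) (hcont.subtype_mk _)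
    have hpath0 : path 0 = T.2.2.1 := by
      rw [← T.2.2.1.mk_rep]
      exact (Projectivization.mk_eq_mk_iff' ℝ _ _ _ _).2 ⟨1, by simp [hr]⟩
    -- The scale s + ε is nonzero for small ε ≠ 0 even when s = 0. Thus one curve resolves the
    -- collapse of the triangle to a point and the vanishing of one side simultaneously.
    let vec : ℝ → X := fun ε => ((s + ε : ℝ) : ℂ) • ⟨_, hmem ε⟩
    have hvec : Continuous vec := by
      refine Continuous.subtype_mk
        (f := fun ε : ℝ => ((s + ε : ℝ) : ℂ) • (r + (ε : ℂ) • w)) ?_ _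
      fun_prop
    have hvec0 : vec 0 = T.2.1 := by
      apply Subtype.ext
      rw [hs]
      funext i
      simp [vec]
    refine mem_closure_of_tendsto (b := 𝓝[≠] (0 : ℝ)) (f := fun ε => ((T.1, vec ε, path ε,
      fun i => xi ((r + (ε : ℂ) • w) i)) : TriangleVar)) ?_ ?_
    · refine Tendsto.prodMk_nhds tendsto_const_nhds (Tendsto.prodMk_nhds ?_
        (Tendsto.prodMk_nhds ?_ (tendsto_pi_nhds.2 hlim)))
      · rw [← hvec0]
        exact (hvec.tendsto 0).mono_left nhdsWithin_le_nhds
      · rw [← hpath0]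
        exact (hpath.tendsto 0).mono_left nhdsWithin_le_nhds
    · have hs' : ∀ᶠ ε : ℝ in 𝓝[≠] 0, s + ε ≠ 0 := by
        by_cases hs0 : s = 0
        · filter_upwards [self_mem_nhdsWithin] with ε hε
          simpa [hs0] using hε
        · have : Tendsto (fun ε : ℝ => s + ε) (𝓝[≠] 0) (𝓝 s) := by
            have h : ContinuousAt (fun ε : ℝ => s + ε) 0 := by fun_prop
            rw [ContinuousAt, add_zero] at h
            exact h.mono_left nhdsWithin_le_nhds
          exact this.eventually_ne hs0
      filter_upwards [hev, hs'] with ε hε hsε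
      obtain ⟨a, ha, ha'⟩ := mk_rep_eq (K := ℝ) _ (hne ε)
      have hrep : ∀ i, (path ε).rep i = a * (r + (ε : ℂ) • w) i := by
        intro i
        change (Projectivization.mk ℝ _ (hne ε)).rep i = _
        rw [ha', Pi.smul_apply, Complex.real_smul]
      have hcoe : (vec ε : Fin 3 → ℂ) = (s + ε) • (r + (ε : ℂ) • w) := by
        funext i
        simp [vec]
      refine ⟨subset_closure ?_, fun hst => ?_, fun i => ?_⟩
      · have hv0 : (vec ε : Fin 3 → ℂ) ≠ 0 := by
          rw [hcoe]
          exact smul_ne_zero hsε (hne ε)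
        refine ⟨hv0, (Projectivization.mk_eq_mk_iff' ℝ _ _ _ _).2 ⟨(s + ε)⁻¹, ?_⟩⟩
        dsimp only
        rw [hcoe, smul_smul, inv_mul_cancel₀ hsε, one_smul]
      · obtain ⟨i, hi⟩ := strictTransform_subset hst
        rw [hrep] at hi
        exact mul_ne_zero (by exact_mod_cast ha) (hε i) hi
      · rw [hrep, xi_ofReal_mul ha _ (hε i)]
  · refine closure_minimal ?_ isClosed_triangles
    rintro T ⟨hT, -, hξ⟩
    obtain ⟨h1, h2⟩ := blowupOrigin_subset hT
    exact (mem_triangles_iff T).2 ⟨h1, h2, fun i _ => hξ i⟩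

/-! ### Equations of the variety of similarity classes -/

/-- The ambient vector space of the variety of similarity classes. -/
abbrev ClassSpace : Type := (Fin 3 → Fin 3 → ℂ) × (Fin 3 → ℂ)

/-- The triple `u` of points of the unit circle, with product `1`, gives the squared directions
of `r i / r (i + 1)`, wherever these are defined. -/
structure Directions (r u : Fin 3 → ℂ) : Prop where
  unit : ∀ i, u i * conj (u i) = 1
  prod : u 0 * u 1 * u 2 = 1
  zero : u 0 * (conj (r 1) * r 2) = r 1 * conj (r 2)
  one : u 1 * (conj (r 2) * r 0) = r 2 * conj (r 0)
  two : u 2 * (conj (r 0) * r 1) = r 0 * conj (r 1)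

/-- The variety of similarity classes, given by equations. -/
def classVariety : Set ClassSpace :=
  {y | (∀ i j, conj (y.1 i j) = y.1 j i) ∧ (∀ i j k, y.1 i k * y.1 k j = y.1 i j * y.1 k k) ∧
    (∑ i, y.1 i i = 1) ∧ (∀ j, ∑ i, y.1 i j = 0) ∧ (∀ i, y.2 i * conj (y.2 i) = 1) ∧
    y.2 0 * y.2 1 * y.2 2 = 1 ∧ y.2 0 * y.1 2 1 = y.1 1 2 ∧ y.2 1 * y.1 0 2 = y.1 2 0 ∧
    y.2 2 * y.1 1 0 = y.1 0 1}

theorem conj_nsq (r : Fin 3 → ℂ) : conj (nsq r) = nsq r := by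
  rw [nsq_eq, Complex.conj_ofReal]

theorem mk_mem_classVariety {r u : Fin 3 → ℂ} (hr : r ∈ X) (h0 : r ≠ 0) (h : Directions r u) :
    ((projMatrix r, u) : ClassSpace) ∈ classVariety := by
  have hn := nsq_ne_zero h0
  have hX := mem_X.1 hr
  refine ⟨?_, ?_, ?_, ?_, h.unit, h.prod, ?_, ?_, ?_⟩ <;> simp only [projMatrix_apply]
  · intro i j
    rw [map_div₀, conj_nsq, map_mul, Complex.conj_conj, mul_comm]
  · intro i j k
    field_simp
  · rw [← Finset.sum_div]
    exact div_self hn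
  · intro j
    rw [Fin.sum_univ_three]
    field_simp
    linear_combination conj (r j) * hX
  · rw [← h.zero]
    ring
  · rw [← h.one]
    ring
  · rw [← h.two]
    ring

/-- A column k of M with M_kk ≠ 0 serves as r: the rank-one relations and trace 1 give |r|² = M_kk,
and then M_ij = r_i r̄_j / |r|². -/
theorem exists_vector {y : ClassSpace} (hy : y ∈ classVariety) :
    ∃ r ∈ X, r ≠ 0 ∧ y.1 = projMatrix r ∧ Directions r y.2 := by
  obtain ⟨hconj, hrank, htr, hcol, hunit, hprod, h0, h1, h2⟩ := hy
  obtain ⟨k, hk⟩ : ∃ k, y.1 k k ≠ 0 := by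
    by_contra! h
    simp [h] at htr
  have hne : (fun i => y.1 i k) ≠ 0 := fun h => hk (congrFun h k)
  have hnsq : nsq (fun i => y.1 i k) = y.1 k k := by
    have : ∀ i, y.1 i k * conj (y.1 i k) = y.1 i i * y.1 k k := by
      intro i
      rw [hconj, hrank]
    simp only [nsq, this, ← Finset.sum_mul, htr, one_mul]
  have hM : y.1 = projMatrix fun i => y.1 i k := by
    funext i j
    rw [projMatrix_apply, hnsq, hconj, hrank, mul_div_cancel_right₀ _ hk]
  have hcoord : ∀ i j, y.1 i j * nsq (fun i => y.1 i k) = y.1 i k * conj (y.1 j k) := by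
    intro i j
    rw [hnsq, hconj, hrank]
  refine ⟨fun i => y.1 i k, ?_, hne, hM, hunit, hprod, ?_, ?_, ?_⟩
  · rw [mem_X, ← hcol k, Fin.sum_univ_three]
  · rw [← hcoord, ← h0, mul_comm (conj _), ← hcoord]
    ring
  · rw [← hcoord, ← h1, mul_comm (conj _), ← hcoord]
    ring
  · rw [← hcoord, ← h2, mul_comm (conj _), ← hcoord]
    ring

theorem classEmb_mk (p : ℙ ℂ X) (θ : torus) :
    classEmb (p, θ) = (projMatrix (p.rep : X), fun i => ex ((θ : Fin 3 → Ang) i)) := rfl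

theorem directions_of_aligned {r : Fin 3 → ℂ} {ξ : Fin 3 → Ang} (h : Aligned r ξ) :
    Directions r fun i => ex ((angles ξ : Fin 3 → Ang) i) := by
  refine ⟨fun i => ex_mul_conj _, ?_, h 1 2, h 2 0, h 0 1⟩
  rw [← ex_add, ← ex_add, ← ex_zero]
  congr 1
  have : ∑ i, (angles ξ : Fin 3 → Ang) i = 0 := (angles ξ).2
  rwa [Fin.sum_univ_three] at this

/-- The three cyclic pairs suffice: conjugation exchanges i and j, and the equations with i = j are
trivial. -/
theorem aligned_of_directions {r : Fin 3 → ℂ} {ξ : Fin 3 → Ang}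
    (h : Directions r fun i => ex ((angles ξ : Fin 3 → Ang) i)) : Aligned r ξ := by
  have h0 : ex (ξ 1 - ξ 2) * (conj (r 1) * r 2) = r 1 * conj (r 2) := h.zero
  have h1 : ex (ξ 2 - ξ 0) * (conj (r 2) * r 0) = r 2 * conj (r 0) := h.one
  have h2 : ex (ξ 0 - ξ 1) * (conj (r 0) * r 1) = r 0 * conj (r 1) := h.two
  have swap : ∀ i j, ex (ξ i - ξ j) * (conj (r i) * r j) = r i * conj (r j) →
      ex (ξ j - ξ i) * (conj (r j) * r i) = r j * conj (r i) := by
    intro i j h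
    have h' := congrArg conj h
    rw [map_mul, ← ex_neg, neg_sub] at h'
    simp only [map_mul, Complex.conj_conj] at h'
    linear_combination h'
  intro i j
  fin_cases i <;> fin_cases j
  · simp [mul_comm]
  · exact h2
  · exact swap _ _ h1
  · exact swap _ _ h2
  · simp [mul_comm]
  · exact h0
  · exact h1
  · exact swap _ _ h0
  · simp [mul_comm]

theorem directions_smul {r u : Fin 3 → ℂ} (h : Directions r u) (a : ℂ) :
    Directions (a • r) u := by
  refine ⟨h.unit, h.prod, ?_, ?_, ?_⟩ <;>
    simp only [Pi.smul_apply, smul_eq_mul, map_mul]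
  · linear_combination a * conj a * h.zero
  · linear_combination a * conj a * h.one
  · linear_combination a * conj a * h.two

theorem classEmb_image : classEmb '' classes = classVariety := by
  apply subset_antisymm
  · rintro _ ⟨⟨p, θ⟩, h, rfl⟩
    obtain ⟨ξ, rfl⟩ : ∃ ξ, θ = angles ξ := ⟨_, (angles_surj θ).symm⟩
    exact mk_mem_classVariety p.rep.2 (rep_ne p)
      (directions_of_aligned ((mk_mem_classes_iff p ξ).1 h))
  · intro y hy
    obtain ⟨r, hr, h0, hM, hd⟩ := exists_vector hy
    choose θ hθ using fun i => ex_surj (hd.unit i)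
    have hθ0 : θ ∈ torus := by
      change ∑ i, θ i = 0
      apply ex_injective
      rw [Fin.sum_univ_three, ex_add, ex_add, hθ, hθ, hθ, ex_zero, hd.prod]
    have hX0 : (⟨r, hr⟩ : X) ≠ 0 := fun h => h0 (congrArg Subtype.val h)
    obtain ⟨a, ha, ha'⟩ := mk_rep_eq (K := ℂ) (⟨r, hr⟩ : X) hX0
    have ha2 : (((Projectivization.mk ℂ (⟨r, hr⟩ : X) hX0).rep : X) : Fin 3 → ℂ) = a • r :=
      congrArg Subtype.val ha'
    refine ⟨(Projectivization.mk ℂ ⟨r, hr⟩ hX0, ⟨θ, hθ0⟩), ?_, ?_⟩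
    · rw [← angles_surj ⟨θ, hθ0⟩, mk_mem_classes_iff, ha2, Aligned.smul_iff ha]
      apply aligned_of_directions
      rw [angles_surj]
      simpa only [hθ] using hd
    · rw [classEmb_mk, ha2, projMatrix_smul ha, ← hM]
      exact Prod.ext rfl (funext hθ)

/-! ### The isomorphism of varieties -/

theorem linear_mem_polyFun {E : Type*} [AddCommGroup E] [Module ℝ E] (l : E →ₗ[ℝ] ℝ) :
    (fun x => l x) ∈ polyFun E :=
  Algebra.subset_adjoin ⟨l, rfl⟩

theorem const_mem_polyFun {E : Type*} [AddCommGroup E] [Module ℝ E] (c : ℝ) :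
    (fun _ => c) ∈ polyFun E :=
  (polyFun E).algebraMap_mem c

theorem isRegularOn_affine {E F : Type*} [AddCommGroup E] [Module ℝ E] [AddCommGroup F]
    [Module ℝ F] (A : E →ₗ[ℝ] F) (c : F) (V : Set E) : IsRegularOn (fun x => A x + c) V := by
  intro l
  refine ⟨fun x => l (A x) + l c,
    (polyFun E).add_mem (linear_mem_polyFun (l.comp A)) (const_mem_polyFun (l c)),
    fun _ => 1, const_mem_polyFun 1, fun x _ => ⟨one_ne_zero, ?_⟩⟩
  simp

/-- The matrix of the numbers `exp (2i(ξ_j - ξ_k))` as a function of the interior angles. -/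
def angleMatrix (u : Fin 3 → ℂ) : Fin 3 → Fin 3 → ℂ :=
  ![![1, u 2, conj (u 1)], ![conj (u 2), 1, u 0], ![u 1, conj (u 0), 1]]

theorem angleMatrix_ex (ξ : Fin 3 → Ang) :
    angleMatrix (fun i => ex ((angles ξ : Fin 3 → Ang) i)) = fun j k => ex (ξ j - ξ k) := by
  funext j k
  fin_cases j <;> fin_cases k <;> simp [angleMatrix, angles, ← ex_neg]

/-- The representative chosen by `Quotient.out` differs from ξ by a translation, which cancels in
the differences. -/
theorem blowupEmb_mk (p : ℙ ℂ X) (ξ : Fin 3 → Ang) :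
    blowupEmb (p, QuotientAddGroup.mk ξ) =
      (projMatrix (p.rep : X), fun j k => ex (ξ j - ξ k)) := by
  refine Prod.ext rfl ?_
  funext j k
  have h : (QuotientAddGroup.mk (Quotient.out (QuotientAddGroup.mk ξ : PAng)) : PAng) =
      QuotientAddGroup.mk ξ := Quotient.out_eq' _
  obtain ⟨x, hx⟩ := QuotientAddGroup.eq.1 h
  change ex _ = ex _
  congr 1
  have hj := congrFun hx j
  have hk := congrFun hx k
  simp only [Pi.add_apply, Pi.neg_apply] at hj hk
  have hjk := hj.trans hk.symm
  rw [neg_add_eq_sub, neg_add_eq_sub, sub_eq_sub_iff_sub_eq_sub] at hjk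
  exact hjk.symm

/-- In the coordinates exp(2iθ) negation of an angle is conjugation, so φ sends u to a matrix with
entries u_i, ū_i and 1, and the inverse picks three of these entries. No genuine denominators occur.
-/
theorem exists_regularIso :
    ∃ f g, IsRegularIso f g (classEmb '' classes) (blowupEmb '' blowup) ∧
      ∀ d ∈ classes, f (classEmb d) = blowupEmb (phi d) := by
  let f : ClassSpace → (Fin 3 → Fin 3 → ℂ) × (Fin 3 → Fin 3 → ℂ) :=
    fun y => (y.1, angleMatrix y.2)
  let g : (Fin 3 → Fin 3 → ℂ) × (Fin 3 → Fin 3 → ℂ) → ClassSpace :=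
    fun y => (y.1, ![y.2 1 2, y.2 2 0, y.2 0 1])
  have hf : ∀ p ξ, f (classEmb (p, angles ξ)) = blowupEmb (phi (p, angles ξ)) := by
    intro p ξ
    rw [phi_angles, blowupEmb_mk, ← angleMatrix_ex]
    rfl
  have hf' : ∀ d ∈ classes, f (classEmb d) = blowupEmb (phi d) := by
    rintro ⟨p, θ⟩ -
    obtain ⟨ξ, rfl⟩ : ∃ ξ, θ = angles ξ := ⟨_, (angles_surj θ).symm⟩
    exact hf p ξ
  have hgf : ∀ y, g (f y) = y := by
    intro y
    refine Prod.ext rfl ?_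
    funext i
    fin_cases i <;> rfl
  have hW : blowupEmb '' blowup = f '' (classEmb '' classes) := by
    rw [← bijOn_phi.image_eq, image_image, image_image]
    exact image_congr fun d hd => (hf' d hd).symm
  refine ⟨f, g, ⟨?_, ?_, ?_, ?_, fun y _ => hgf y, ?_⟩, hf'⟩
  -- Here `angleMatrix 0` is the constant part, the ones on the diagonal.
  · have hlin : IsLinearMap ℝ (fun y : ClassSpace => ((y.1, angleMatrix y.2 - 1 • angleMatrix 0) :
        (Fin 3 → Fin 3 → ℂ) × (Fin 3 → Fin 3 → ℂ))) := by
      constructor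
      · intro x y
        refine Prod.ext rfl ?_
        funext j k
        fin_cases j <;> fin_cases k <;> simp [angleMatrix]
      · intro c x
        refine Prod.ext rfl ?_
        funext j k
        fin_cases j <;> fin_cases k <;> simp [angleMatrix]
    have := isRegularOn_affine hlin.mk' (0, angleMatrix 0) (classEmb '' classes)
    convert this using 1
    funext y
    simp [f]
  · have hlin : IsLinearMap ℝ g := by
      constructor
      · intro x y
        refine Prod.ext rfl ?_
        funext k
        fin_cases k <;> simp [g]
      · intro c x
        refine Prod.ext rfl ?_
        funext k
        fin_cases k <;> simp [g]
    have := isRegularOn_affine hlin.mk' 0 (blowupEmb '' blowup)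
    convert this using 1
    funext y
    simp
  · rw [hW]
    exact mapsTo_image _ _
  · rw [hW]
    rintro _ ⟨y, hy, rfl⟩
    rwa [hgf]
  · rw [hW]
    rintro _ ⟨y, hy, rfl⟩
    rw [hgf]

/-! ### Regular functions at a point -/

section Regular

variable {E : Type*} [NormedAddCommGroup E] [NormedSpace ℝ E]

/-- `f` is a quotient of real polynomials, wherever the denominator does not vanish, and the
denominator does not vanish at `x`. -/
def RatAt (f : E → ℝ) (x : E) : Prop :=
  ∃ p ∈ polyFun E, ∃ q ∈ polyFun E, q x ≠ 0 ∧ ∀ y, q y ≠ 0 → f y = p y / q y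

theorem RatAt.of_poly {p : E → ℝ} (hp : p ∈ polyFun E) (x : E) : RatAt p x :=
  ⟨p, hp, fun _ => 1, const_mem_polyFun 1, one_ne_zero, fun _ _ => (div_one _).symm⟩

theorem RatAt.const (c : ℝ) (x : E) : RatAt (fun _ => c) x := .of_poly (const_mem_polyFun c) x

theorem RatAt.linear (l : E →ₗ[ℝ] ℝ) (x : E) : RatAt (fun y => l y) x :=
  .of_poly (linear_mem_polyFun l) x

theorem RatAt.add {f g : E → ℝ} {x : E} (hf : RatAt f x) (hg : RatAt g x) :
    RatAt (fun y => f y + g y) x := by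
  obtain ⟨p, hp, q, hq, hx, h⟩ := hf
  obtain ⟨p', hp', q', hq', hx', h'⟩ := hg
  refine ⟨p * q' + q * p', (polyFun E).add_mem ((polyFun E).mul_mem hp hq')
    ((polyFun E).mul_mem hq hp'), q * q', (polyFun E).mul_mem hq hq', mul_ne_zero hx hx', ?_⟩
  intro y hy
  have h1 : q y ≠ 0 := left_ne_zero_of_mul hy
  have h2 : q' y ≠ 0 := right_ne_zero_of_mul hy
  simp only [Pi.add_apply, Pi.mul_apply]
  rw [h y h1, h' y h2, div_add_div _ _ h1 h2]

theorem RatAt.mul {f g : E → ℝ} {x : E} (hf : RatAt f x) (hg : RatAt g x) :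
    RatAt (fun y => f y * g y) x := by
  obtain ⟨p, hp, q, hq, hx, h⟩ := hf
  obtain ⟨p', hp', q', hq', hx', h'⟩ := hg
  refine ⟨p * p', (polyFun E).mul_mem hp hp', q * q', (polyFun E).mul_mem hq hq',
    mul_ne_zero hx hx', ?_⟩
  intro y hy
  have h1 : q y ≠ 0 := left_ne_zero_of_mul hy
  have h2 : q' y ≠ 0 := right_ne_zero_of_mul hy
  simp only [Pi.mul_apply]
  rw [h y h1, h' y h2, div_mul_div_comm]

theorem RatAt.neg {f : E → ℝ} {x : E} (hf : RatAt f x) : RatAt (fun y => -f y) x := by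
  simpa using (RatAt.const (-1) x).mul hf

theorem RatAt.sub {f g : E → ℝ} {x : E} (hf : RatAt f x) (hg : RatAt g x) :
    RatAt (fun y => f y - g y) x := by
  simpa [sub_eq_add_neg] using hf.add hg.neg

theorem RatAt.inv {f : E → ℝ} {x : E} (hf : RatAt f x) (h0 : f x ≠ 0) :
    RatAt (fun y => (f y)⁻¹) x := by
  obtain ⟨p, hp, q, hq, hx, h⟩ := hf
  have hpx : p x ≠ 0 := by
    intro h1
    exact h0 (by rw [h x hx, h1, zero_div])
  -- The common factor q is kept on purpose: the formula for f is known only where q ≠ 0, so the new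
  -- denominator has to vanish with q.
  refine ⟨q * q, (polyFun E).mul_mem hq hq, p * q, (polyFun E).mul_mem hp hq,
    mul_ne_zero hpx hx, ?_⟩
  intro y hy
  have h1 : q y ≠ 0 := right_ne_zero_of_mul hy
  simp only [Pi.mul_apply]
  rw [h y h1, inv_div]
  exact (mul_div_mul_right _ _ h1).symm

theorem RatAt.div {f g : E → ℝ} {x : E} (hf : RatAt f x) (hg : RatAt g x) (h0 : g x ≠ 0) :
    RatAt (fun y => f y / g y) x := by
  simpa [div_eq_mul_inv] using hf.mul (hg.inv h0)

variable [FiniteDimensional ℝ E]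

theorem differentiable_of_polyFun {p : E → ℝ} (hp : p ∈ polyFun E) : Differentiable ℝ p := by
  refine Algebra.adjoin_induction (p := fun f _ => Differentiable ℝ f) ?_ ?_ ?_ ?_ hp
  · rintro _ ⟨l, rfl⟩
    exact (LinearMap.toContinuousLinearMap l).differentiable
  · intro c
    exact differentiable_const c
  · intro f g _ _ hf hg
    exact hf.add hg
  · intro f g _ _ hf hg
    exact hf.mul hg

theorem RatAt.differentiableAt {f : E → ℝ} {x : E} (hf : RatAt f x) : DifferentiableAt ℝ f x := by
  obtain ⟨p, hp, q, hq, hx, h⟩ := hf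
  have hdq := differentiable_of_polyFun hq
  have hd : DifferentiableAt ℝ (fun y => p y / q y) x := by
    simp only [div_eq_mul_inv]
    exact (differentiable_of_polyFun hp x).mul ((hdq x).inv hx)
  refine hd.congr_of_eventuallyEq ?_
  filter_upwards [hdq.continuous.continuousAt.eventually_ne hx] with y hy using h y hy

/-- With f = p/q, the polynomial p q q₀ vanishes on all of V, so its differential kills v. Near x it
equals f q² q₀, and as f(x) = 0 its differential there is q² q₀ df with q² q₀ ≠ 0 at x. -/
theorem RatAt.fderiv_eq_zero {f : E → ℝ} {x : E} (hf : RatAt f x) {V : Set E} (hx : x ∈ V)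
    {q₀ : E → ℝ} (hq₀ : q₀ ∈ polyFun E) (hx₀ : q₀ x ≠ 0) (h0 : ∀ y ∈ V, q₀ y ≠ 0 → f y = 0)
    {v : E} (hv : v ∈ zariskiTangent V x) : fderiv ℝ f x v = 0 := by
  have hfd := hf.differentiableAt
  obtain ⟨p, hp, q, hq, hqx, h⟩ := hf
  have hdq := differentiable_of_polyFun hq
  have hdq₀ := differentiable_of_polyFun hq₀
  have hdp := differentiable_of_polyFun hp
  have hvan : ∀ y ∈ V, (p * (q * q₀)) y = 0 := by
    intro y hy
    by_cases h1 : q y = 0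
    · simp [h1]
    by_cases h2 : q₀ y = 0
    · simp [h2]
    have := h y h1
    rw [h0 y hy h2, eq_comm, div_eq_zero_iff] at this
    simp [this.resolve_right h1]
  have hd : fderiv ℝ (p * (q * q₀)) x v = 0 := by
    have h1 := (Submodule.mem_iInf _).1 hv (p * (q * q₀))
    exact (Submodule.mem_iInf _).1 h1
      ⟨(polyFun E).mul_mem hp ((polyFun E).mul_mem hq hq₀), hvan⟩
  have hfx : f x = 0 := h0 x hx hx₀
  have heq : p * (q * q₀) =ᶠ[𝓝 x] fun y => f y * (q y * (q y * q₀ y)) := by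
    filter_upwards [hdq.continuous.continuousAt.eventually_ne hqx] with y hy
    rw [h y hy]
    simp only [Pi.mul_apply]
    field_simp
  have hg : DifferentiableAt ℝ (fun y => q y * (q y * q₀ y)) x :=
    (hdq x).mul ((hdq x).mul (hdq₀ x))
  rw [heq.fderiv_eq, fderiv_fun_mul hfd hg, hfx] at hd
  simp only [zero_smul, zero_add, _root_.smul_apply, smul_eq_mul] at hd
  exact (mul_eq_zero.1 hd).resolve_left (mul_ne_zero hqx (mul_ne_zero hqx hx₀))

/-- The Zariski tangent space at a point with a rational parametrization, which has a rational
retraction. -/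
theorem finrank_zariskiTangent {W : Type*} [NormedAddCommGroup W] [NormedSpace ℝ W]
    {V : Set E} {x : E} (hx : x ∈ V) {s : W → E} {ρ : E → W}
    (hs : DifferentiableAt ℝ s (ρ x)) (hρ : DifferentiableAt ℝ ρ x)
    (hsV : ∀ᶠ w in 𝓝 (ρ x), s w ∈ V) (hρs : ∀ᶠ w in 𝓝 (ρ x), ρ (s w) = w)
    {q₀ : E → ℝ} (hq₀ : q₀ ∈ polyFun E) (hx₀ : q₀ x ≠ 0) (hsρ : ∀ y ∈ V, q₀ y ≠ 0 → s (ρ y) = y)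
    (Ls : Set (E →ₗ[ℝ] ℝ)) (hLs : ∀ v, (∀ l ∈ Ls, l v = 0) → v = 0)
    (hrat : ∀ l ∈ Ls, RatAt (fun y => l (s (ρ y))) x) :
    Module.finrank ℝ (zariskiTangent V x) = Module.finrank ℝ W := by
  have hsx : s (ρ x) = x := hsρ x hx hx₀
  have hρ' : DifferentiableAt ℝ ρ (s (ρ x)) := by rwa [hsx]
  have hcomp : ∀ w, fderiv ℝ ρ x (fderiv ℝ s (ρ x) w) = w := by
    intro w
    have h1 : fderiv ℝ (fun w => ρ (s w)) (ρ x) = ContinuousLinearMap.id ℝ W := by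
      rw [Filter.EventuallyEq.fderiv_eq (f := fun w => w) hρs]
      exact fderiv_fun_id
    have h2 := fderiv_fun_comp (ρ x) hρ' hs
    rw [h1, hsx] at h2
    exact (congrArg (fun A : W →L[ℝ] W => A w) h2).symm
  -- On V near x the map s ∘ ρ is the identity, so its differential fixes every Zariski tangent
  -- vector, which therefore lies in the range of ds; the test functionals in `Ls` reduce this to
  -- scalar rational functions. Conversely, a polynomial vanishing on V has zero pullback under s
  -- near ρ(x). Injectivity of ds comes from ρ ∘ s = id.
  have hT : zariskiTangent V x = LinearMap.range (fderiv ℝ s (ρ x) : W →ₗ[ℝ] E) := by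
    apply le_antisymm
    · intro v hv
      refine ⟨fderiv ℝ ρ x v, ?_⟩
      rw [← sub_eq_zero]
      refine hLs _ fun l hl => ?_
      have h1 : RatAt (fun y => l (s (ρ y)) - l y) x := (hrat l hl).sub (RatAt.linear l x)
      have h2 := h1.fderiv_eq_zero hx hq₀ hx₀ (fun y hy hy0 => by rw [hsρ y hy hy0, sub_self]) hv
      have h3 : HasFDerivAt (fun y => l (s (ρ y)) - l y)
          ((LinearMap.toContinuousLinearMap l).comp
            ((fderiv ℝ s (ρ x)).comp (fderiv ℝ ρ x)) - LinearMap.toContinuousLinearMap l) x := by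
        refine HasFDerivAt.sub ?_ (LinearMap.toContinuousLinearMap l).hasFDerivAt
        exact (LinearMap.toContinuousLinearMap l).hasFDerivAt.comp x
          (hs.hasFDerivAt.comp x hρ.hasFDerivAt)
      rw [h3.fderiv] at h2
      simpa using h2
    · rintro _ ⟨w, rfl⟩
      refine (Submodule.mem_iInf _).2 fun f => (Submodule.mem_iInf _).2 fun hf => ?_
      have hfd : DifferentiableAt ℝ f (s (ρ x)) := differentiable_of_polyFun hf.1 _
      have h1 : fderiv ℝ (fun w => f (s w)) (ρ x) = 0 := by
        have : (fun w => f (s w)) =ᶠ[𝓝 (ρ x)] fun _ => (0 : ℝ) := by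
          filter_upwards [hsV] with w hw using hf.2 _ hw
        rw [this.fderiv_eq]
        exact fderiv_const_apply 0
      have h2 := fderiv_fun_comp (ρ x) hfd hs
      rw [h1, hsx] at h2
      exact (congrArg (fun A : W →L[ℝ] ℝ => A w) h2).symm
  rw [hT]
  exact LinearMap.finrank_range_of_inj (Function.LeftInverse.injective hcomp)

end Regular

/-! ### Complex-valued regular functions -/

section RegularComplex

variable {E : Type*} [NormedAddCommGroup E] [NormedSpace ℝ E]

/-- The real and imaginary parts of `f` are regular at `x`. -/
structure RatC (f : E → ℂ) (x : E) : Prop where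
  re : RatAt (fun y => (f y).re) x
  im : RatAt (fun y => (f y).im) x

theorem RatC.linear (A : E →ₗ[ℝ] ℂ) (x : E) : RatC (fun y => A y) x :=
  ⟨.linear (Complex.reLm.comp A) x, .linear (Complex.imLm.comp A) x⟩

theorem RatC.const (c : ℂ) (x : E) : RatC (fun _ => c) x := ⟨.const _ x, .const _ x⟩

theorem RatC.ofReal {f : E → ℝ} {x : E} (hf : RatAt f x) : RatC (fun y => (f y : ℂ)) x :=
  ⟨by simpa using hf, by simpa using RatAt.const 0 x⟩

theorem RatC.add {f g : E → ℂ} {x : E} (hf : RatC f x) (hg : RatC g x) :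
    RatC (fun y => f y + g y) x :=
  ⟨by simpa using hf.re.add hg.re, by simpa using hf.im.add hg.im⟩

theorem RatC.sub {f g : E → ℂ} {x : E} (hf : RatC f x) (hg : RatC g x) :
    RatC (fun y => f y - g y) x :=
  ⟨by simpa using hf.re.sub hg.re, by simpa using hf.im.sub hg.im⟩

theorem RatC.mul {f g : E → ℂ} {x : E} (hf : RatC f x) (hg : RatC g x) :
    RatC (fun y => f y * g y) x :=
  ⟨by simpa using (hf.re.mul hg.re).sub (hf.im.mul hg.im),
    by simpa using (hf.re.mul hg.im).add (hf.im.mul hg.re)⟩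

theorem RatC.conj {f : E → ℂ} {x : E} (hf : RatC f x) : RatC (fun y => conj (f y)) x :=
  ⟨by simpa using hf.re, by simpa using hf.im.neg⟩

theorem RatC.inv {f : E → ℂ} {x : E} (hf : RatC f x) (h0 : f x ≠ 0) :
    RatC (fun y => (f y)⁻¹) x := by
  have hn : RatAt (fun y => Complex.normSq (f y)) x := by
    simpa [Complex.normSq_apply] using (hf.re.mul hf.re).add (hf.im.mul hf.im)
  have h0' : Complex.normSq (f x) ≠ 0 := by simpa using h0
  exact ⟨by simpa [Complex.inv_re] using hf.re.div hn h0',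
    by simpa [Complex.inv_im] using hf.im.neg.div hn h0'⟩

theorem RatC.div {f g : E → ℂ} {x : E} (hf : RatC f x) (hg : RatC g x) (h0 : g x ≠ 0) :
    RatC (fun y => f y / g y) x := by
  simpa [div_eq_mul_inv] using hf.mul (hg.inv h0)

theorem RatC.differentiableAt [FiniteDimensional ℝ E] {f : E → ℂ} {x : E} (hf : RatC f x) :
    DifferentiableAt ℝ f x := by
  have h1 := hf.re.differentiableAt
  have h2 := hf.im.differentiableAt
  have : f = fun y => Complex.equivRealProdCLM.symm ((f y).re, (f y).im) := by
    funext y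
    exact Complex.ext (by simp) (by simp)
  rw [this]
  exact Complex.equivRealProdCLM.symm.differentiableAt.comp x (h1.prodMk h2)

end RegularComplex

/-! ### Rational charts -/

/-- The vector `(z, 1, -1 - z)`. -/
def affVec (z : ℂ) : Fin 3 → ℂ := ![z, 1, -1 - z]

/-- The directions of `affVec z`, where `u` is the squared direction of `z`. -/
def affDir (z u : ℂ) : Fin 3 → ℂ :=
  ![(1 + conj z) / (1 + z), (1 + z) / (1 + conj z) * conj u, u]

theorem affVec_ne (z : ℂ) : affVec z ≠ 0 := fun h => by
  simpa [affVec] using congrFun h 1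

theorem affVec_mem (z : ℂ) : affVec z ∈ X := by
  simp only [mem_X, affVec, Matrix.cons_val]
  ring

theorem one_add_conj_ne {z : ℂ} (h : 1 + z ≠ 0) : 1 + conj z ≠ 0 := by
  intro h'
  apply h
  simpa using congrArg conj h'

theorem directions_affVec {z u : ℂ} (hu : u * conj u = 1) (huz : u * conj z = z)
    (h : 1 + z ≠ 0) : Directions (affVec z) (affDir z u) := by
  have h' := one_add_conj_ne h
  have huz' : conj u * z = conj z := by simpa using congrArg conj huz
  refine ⟨fun i => ?_, ?_, ?_, ?_, ?_⟩
  · fin_cases i <;>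
      simp only [affDir, Fin.zero_eta, Fin.mk_one, Fin.reduceFinMk, Matrix.cons_val, map_div₀,
        map_add, map_one, map_mul, Complex.conj_conj]
    · rw [div_mul_div_comm, mul_comm (1 + conj z), div_self (mul_ne_zero h h')]
    · rw [mul_mul_mul_comm, div_mul_div_comm, mul_comm (1 + z), div_self (mul_ne_zero h' h),
        one_mul, mul_comm, hu]
    · exact hu
  · simp only [affDir, Matrix.cons_val]
    rw [← mul_assoc, div_mul_div_comm, mul_comm (1 + z), div_self (mul_ne_zero h' h), one_mul,
      mul_comm, hu]
  · simp only [affDir, affVec, Matrix.cons_val, map_sub, map_neg, map_one]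
    rw [div_mul_eq_mul_div, div_eq_iff h]
    ring
  · simp only [affDir, affVec, Matrix.cons_val, map_sub, map_neg, map_one]
    rw [div_mul_eq_mul_div, div_mul_eq_mul_div, div_eq_iff h']
    linear_combination -(1 + z) * (1 + conj z) * huz'
  · simp only [affDir, affVec, Matrix.cons_val, map_one]
    linear_combination huz

/-- While 1 + z ≠ 0 only z itself can vanish, so only its squared direction is free: the first entry
follows from the ratio of the nonzero sides, the second from the product being 1. -/
theorem eq_affDir {z : ℂ} {u : Fin 3 → ℂ} (hd : Directions (affVec z) u) (h : 1 + z ≠ 0) :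
    u = affDir z (u 2) := by
  have h0 := hd.zero
  simp only [affVec, Matrix.cons_val, map_sub, map_neg, map_one] at h0
  have hu0 : u 0 = (1 + conj z) / (1 + z) := by
    rw [eq_div_iff h]
    linear_combination -h0
  have h' := one_add_conj_ne h
  funext i
  fin_cases i
  · exact hu0
  · have hp := hd.prod
    have h2 := hd.unit 2
    rw [hu0] at hp
    simp only [Fin.mk_one, affDir, Matrix.cons_val]
    rw [div_mul_eq_mul_div, eq_div_iff h']
    rw [div_mul_eq_mul_div, div_mul_eq_mul_div, div_eq_iff h] at hp
    linear_combination conj (u 2) * hp - u 1 * (1 + conj z) * h2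
  · rfl

theorem one_sub_ne (m : ℝ) : (1 - Complex.I * m : ℂ) ≠ 0 := by
  intro h
  simpa using congrArg Complex.re h

/-- The squared direction `c ^ 2 (1 + i m) / (1 - i m)` of `c (1 + i m)`. -/
def slopeDir (c : ℂ) (m : ℝ) : ℂ := c ^ 2 * ((1 + Complex.I * m) / (1 - Complex.I * m))

theorem slopeDir_unit {c : ℂ} (hc : c * conj c = 1) (m : ℝ) :
    slopeDir c m * conj (slopeDir c m) = 1 := by
  have h1 := one_sub_ne m
  have h2 := one_sub_ne (-m)
  simp only [Complex.ofReal_neg, mul_neg, sub_neg_eq_add] at h2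
  simp only [slopeDir, map_mul, map_pow, map_div₀, map_add, map_sub, map_one, Complex.conj_I,
    Complex.conj_ofReal, neg_mul, sub_neg_eq_add, ← sub_eq_add_neg]
  rw [mul_mul_mul_comm, div_mul_div_comm, mul_comm (1 - _), div_self (mul_ne_zero h2 h1), ← mul_pow,
    hc, one_pow, one_mul]

theorem slopeDir_mul_conj {c : ℂ} (hc : c * conj c = 1) (t m : ℝ) :
    slopeDir c m * conj (c * t * (1 + Complex.I * m)) = c * t * (1 + Complex.I * m) := by
  have h1 := one_sub_ne m
  simp only [slopeDir, map_mul, map_add, map_one, Complex.conj_I,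
    Complex.conj_ofReal, neg_mul, ← sub_eq_add_neg]
  field_simp
  linear_combination c * t * (1 + Complex.I * m) * hc

section RatChart

variable {E : Type*} [NormedAddCommGroup E] [NormedSpace ℝ E] {x : E}

theorem ratC_affVec {z : E → ℂ} (hz : RatC z x) (i : Fin 3) :
    RatC (fun y => affVec (z y) i) x := by
  fin_cases i
  · exact hz
  · exact .const 1 x
  · exact (RatC.const (-1) x).sub hz

theorem ratC_projMatrix {r : E → Fin 3 → ℂ} (hr : ∀ i, RatC (fun y => r y i) x) (h0 : r x ≠ 0)
    (i j : Fin 3) : RatC (fun y => projMatrix (r y) i j) x := by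
  have hn : RatC (fun y => nsq (r y)) x := by
    simp only [nsq, Fin.sum_univ_three]
    exact (((hr 0).mul (hr 0).conj).add ((hr 1).mul (hr 1).conj)).add ((hr 2).mul (hr 2).conj)
  exact ((hr i).mul (hr j).conj).div hn (nsq_ne_zero h0)

theorem ratC_affDir {z u : E → ℂ} (hz : RatC z x) (hu : RatC u x) (h : 1 + z x ≠ 0)
    (i : Fin 3) : RatC (fun y => affDir (z y) (u y) i) x := by
  have h1 := (RatC.const 1 x).add hz
  have h2 := (RatC.const 1 x).add hz.conj
  fin_cases i
  · exact h2.div h1 h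
  · exact (h1.div h2 (one_add_conj_ne h)).mul hu.conj
  · exact hu

theorem ratC_slope {t m : E → ℝ} (c : ℂ) (ht : RatAt t x) (hm : RatAt m x) :
    RatC (fun y => c * t y * (1 + Complex.I * m y)) x :=
  ((RatC.const c x).mul (.ofReal ht)).mul
    ((RatC.const 1 x).add ((RatC.const Complex.I x).mul (.ofReal hm)))

theorem ratC_slopeDir {m : E → ℝ} (c : ℂ) (hm : RatAt m x) :
    RatC (fun y => slopeDir c (m y)) x := by
  have hm' : RatC (fun y => Complex.I * m y) x := (RatC.const Complex.I x).mul (.ofReal hm)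
  exact (RatC.const (c ^ 2) x).mul (((RatC.const 1 x).add hm').div ((RatC.const 1 x).sub hm')
    (one_sub_ne _))

end RatChart

/-! ### Real algebraic sets -/

section Algebraic

variable {E : Type*} [NormedAddCommGroup E] [NormedSpace ℝ E]

/-- The real and imaginary parts of `f` are real polynomials. -/
structure PolyC (f : E → ℂ) : Prop where
  re : (fun y => (f y).re) ∈ polyFun E
  im : (fun y => (f y).im) ∈ polyFun E

theorem PolyC.linear (A : E →ₗ[ℝ] ℂ) : PolyC fun y => A y :=
  ⟨linear_mem_polyFun (Complex.reLm.comp A), linear_mem_polyFun (Complex.imLm.comp A)⟩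

theorem PolyC.const (c : ℂ) : PolyC fun _ : E => c := ⟨const_mem_polyFun _, const_mem_polyFun _⟩

theorem PolyC.add {f g : E → ℂ} (hf : PolyC f) (hg : PolyC g) : PolyC fun y => f y + g y :=
  ⟨(polyFun E).add_mem hf.re hg.re, (polyFun E).add_mem hf.im hg.im⟩

theorem PolyC.mul {f g : E → ℂ} (hf : PolyC f) (hg : PolyC g) : PolyC fun y => f y * g y :=
  ⟨(polyFun E).sub_mem ((polyFun E).mul_mem hf.re hg.re) ((polyFun E).mul_mem hf.im hg.im),
    (polyFun E).add_mem ((polyFun E).mul_mem hf.re hg.im) ((polyFun E).mul_mem hf.im hg.re)⟩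

theorem PolyC.conj {f : E → ℂ} (hf : PolyC f) : PolyC fun y => conj (f y) :=
  ⟨hf.re, (polyFun E).neg_mem hf.im⟩

/-- `V` is the zero set of a set of real polynomials. -/
def IsAlg (V : Set E) : Prop :=
  ∃ S : Set (E → ℝ), (∀ f ∈ S, f ∈ polyFun E) ∧ V = {x | ∀ f ∈ S, f x = 0}

theorem IsAlg.eq {f g : E → ℂ} (hf : PolyC f) (hg : PolyC g) : IsAlg {x | f x = g x} := by
  refine ⟨{fun y => (f y).re - (g y).re, fun y => (f y).im - (g y).im}, ?_, ?_⟩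
  · rintro _ (rfl | rfl)
    · exact (polyFun E).sub_mem hf.re hg.re
    · exact (polyFun E).sub_mem hf.im hg.im
  · ext x
    simp [Complex.ext_iff, sub_eq_zero]

theorem IsAlg.all {ι : Type*} {P : ι → E → Prop} (h : ∀ i, IsAlg {x | P i x}) :
    IsAlg {x | ∀ i, P i x} := by
  choose S hS hS' using h
  refine ⟨⋃ i, S i, ?_, ?_⟩
  · intro f hf
    obtain ⟨i, hi⟩ := mem_iUnion.1 hf
    exact hS i f hi
  · ext x
    have h : ∀ i, P i x ↔ ∀ f ∈ S i, f x = 0 := fun i => (Set.ext_iff.1 (hS' i) x)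
    simp only [mem_ofPred_eq, mem_iUnion, h]
    exact ⟨fun hx f ⟨i, hi⟩ => hx i f hi, fun hx i f hi => hx f ⟨i, hi⟩⟩

theorem IsAlg.and {P Q : E → Prop} (h : IsAlg {x | P x}) (h' : IsAlg {x | Q x}) :
    IsAlg {x | P x ∧ Q x} := by
  have := IsAlg.all (P := fun b : Bool => if b then P else Q)
    (fun b => by cases b; exacts [h', h])
  convert this using 1
  ext x
  simp [and_comm]

end Algebraic

/-- The coordinate `M i j`. -/
def coordM (i j : Fin 3) : ClassSpace →ₗ[ℝ] ℂ where
  toFun y := y.1 i j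
  map_add' _ _ := rfl
  map_smul' _ _ := rfl

/-- The coordinate `u i`. -/
def coordU (i : Fin 3) : ClassSpace →ₗ[ℝ] ℂ where
  toFun y := y.2 i
  map_add' _ _ := rfl
  map_smul' _ _ := rfl

theorem isAlg_classVariety : IsAlg classVariety := by
  have hM : ∀ i j, PolyC fun y : ClassSpace => y.1 i j := fun i j => .linear (coordM i j)
  have hU : ∀ i, PolyC fun y : ClassSpace => y.2 i := fun i => .linear (coordU i)
  have h1 : PolyC fun _ : ClassSpace => (1 : ℂ) := .const 1
  have h0 : PolyC fun _ : ClassSpace => (0 : ℂ) := .const 0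
  simp only [classVariety, Fin.sum_univ_three]
  refine .and (.all fun i => .all fun j => .eq (hM i j).conj (hM j i)) (.and
    (.all fun i => .all fun j => .all fun k => .eq ((hM i k).mul (hM k j)) ((hM i j).mul (hM k k)))
    (.and (.eq (((hM 0 0).add (hM 1 1)).add (hM 2 2)) h1)
    (.and (.all fun j => .eq (((hM 0 j).add (hM 1 j)).add (hM 2 j)) h0)
    (.and (.all fun i => .eq ((hU i).mul (hU i).conj) h1)
    (.and (.eq (((hU 0).mul (hU 1)).mul (hU 2)) h1)
    (.and (.eq ((hU 0).mul (hM 2 1)) (hM 1 2))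
    (.and (.eq ((hU 1).mul (hM 0 2)) (hM 2 0)) (.eq ((hU 2).mul (hM 1 0)) (hM 0 1)))))))))

/-! ### Rational charts of the variety of similarity classes -/

/-- The cyclic permutation of the labels. -/
def cycle (k : Fin 3) (y : ClassSpace) : ClassSpace :=
  (fun i j => y.1 (i + k) (j + k), fun i => y.2 (i + k))

theorem cycle_mem {y : ClassSpace} (hy : y ∈ classVariety) (k : Fin 3) :
    cycle k y ∈ classVariety := by
  obtain ⟨hconj, hrank, htr, hcol, hunit, hprod, h0, h1, h2⟩ := hy
  refine ⟨fun i j => hconj _ _, fun i j l => hrank _ _ _, ?_, fun j => ?_, fun i => hunit _, ?_⟩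
  · rw [← htr]
    exact Equiv.sum_comp (Equiv.addRight k) fun i => y.1 i i
  · rw [← hcol (j + k)]
    exact Equiv.sum_comp (Equiv.addRight k) fun i => y.1 i (j + k)
  · fin_cases k
    · exact ⟨hprod, h0, h1, h2⟩
    · refine ⟨?_, h1, h2, h0⟩
      rw [← hprod]
      change y.2 1 * y.2 2 * y.2 0 = _
      ring
    · refine ⟨?_, h2, h0, h1⟩
      rw [← hprod]
      change y.2 2 * y.2 0 * y.2 1 = _
      ring

theorem cycle_neg_cycle (k : Fin 3) (y : ClassSpace) : cycle (-k) (cycle k y) = y := by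
  simp [cycle]

theorem cycle_cycle_neg (k : Fin 3) (y : ClassSpace) : cycle k (cycle (-k) y) = y := by
  simp [cycle]

theorem projMatrix_affVec (z : ℂ) :
    projMatrix (affVec z) 0 1 = z / nsq (affVec z) ∧
    projMatrix (affVec z) 1 1 = 1 / nsq (affVec z) ∧
    projMatrix (affVec z) 2 2 = (1 + z) * (1 + conj z) / nsq (affVec z) := by
  refine ⟨?_, ?_, ?_⟩ <;> rw [projMatrix_apply] <;> congr 1 <;>
    simp only [affVec, Matrix.cons_val, map_one, map_sub, map_neg]
  · ring
  · ring
  · ring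

theorem projMatrix_affVec_div (z : ℂ) :
    projMatrix (affVec z) 0 1 / projMatrix (affVec z) 1 1 = z := by
  obtain ⟨h1, h2, -⟩ := projMatrix_affVec z
  have hn := nsq_ne_zero (affVec_ne z)
  rw [h1, h2]
  field_simp

theorem exists_affVec {y : ClassSpace} (hy : y ∈ classVariety) (h : y.1 1 1 ≠ 0) :
    y.1 = projMatrix (affVec (y.1 0 1 / y.1 1 1)) ∧
      Directions (affVec (y.1 0 1 / y.1 1 1)) y.2 := by
  obtain ⟨r, hr, h0, hM, hd⟩ := exists_vector hy
  have hr1 : r 1 ≠ 0 := by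
    intro h1
    apply h
    rw [hM, projMatrix_apply, h1]
    simp
  have haff : (r 1)⁻¹ • r = affVec (r 0 / r 1) := by
    funext i
    fin_cases i
    · simp [affVec, div_eq_inv_mul]
    · simp [affVec, hr1]
    · simp only [affVec, Fin.reduceFinMk, Pi.smul_apply, smul_eq_mul, Matrix.cons_val]
      field_simp
      linear_combination mem_X.1 hr
  have hM' : y.1 = projMatrix (affVec (r 0 / r 1)) := by
    rw [← haff, projMatrix_smul (inv_ne_zero hr1), hM]
  have hz : y.1 0 1 / y.1 1 1 = r 0 / r 1 := by
    rw [hM', projMatrix_affVec_div]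
  rw [hz]
  exact ⟨hM', haff ▸ directions_smul hd _⟩

theorem affVec_one_add_ne {z : ℂ} (h : projMatrix (affVec z) 2 2 ≠ 0) : 1 + z ≠ 0 := by
  intro h1
  apply h
  rw [(projMatrix_affVec z).2.2, h1]
  simp

/-- The slope of a squared direction `u`, relative to the direction `c`. -/
def slope (c u : ℂ) : ℝ := (u * conj c ^ 2).im / (1 + (u * conj c ^ 2).re)

/-- Rotation by c̄ replaces u by v = u c̄², and the slope is the tangent of half the angle of v. It
is finite since 1 + Re v ≠ 0. The rotated z̄-relation v ζ̄ = ζ then says Im ζ = m Re ζ, so z is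
recovered even when it is zero. -/
theorem slopeDir_slope {c u z : ℂ} (hc : c * conj c = 1) (hu : u * conj u = 1)
    (huz : u * conj z = z) (h : 1 + (u * conj c ^ 2).re ≠ 0) :
    slopeDir c (slope c u) = u ∧ c * (z * conj c).re * (1 + Complex.I * slope c u) = z := by
  obtain ⟨v, hv⟩ : ∃ v, v = u * conj c ^ 2 := ⟨_, rfl⟩
  have huv : u = c ^ 2 * v := by
    rw [hv]
    linear_combination -u * (c * conj c + 1) * hc
  have hvv : v * conj v = 1 := by
    rw [hv, map_mul, map_pow, Complex.conj_conj]
    linear_combination hu + u * conj u * (c * conj c + 1) * hc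
  have hn : v.re * v.re + v.im * v.im = 1 := by
    rw [Complex.mul_conj] at hvv
    have : Complex.normSq v = 1 := by exact_mod_cast hvv
    rwa [Complex.normSq_apply] at this
  rw [slope, ← hv]
  rw [← hv] at h
  have hm : (1 + v.re) * (v.im / (1 + v.re)) = v.im := mul_div_cancel₀ _ h
  obtain ⟨m, hmdef⟩ : ∃ m, m = v.im / (1 + v.re) := ⟨_, rfl⟩
  rw [← hmdef] at hm ⊢
  constructor
  · rw [slopeDir, huv]
    congr 1
    rw [div_eq_iff (one_sub_ne m)]
    apply Complex.ext
    · simp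
      have : (1 + v.re) * (v.re + v.im * m - 1) = 0 := by linear_combination v.im * hm + hn
      have := (mul_eq_zero.1 this).resolve_left h
      linarith
    · simp
      have : (1 + v.re) * (m + v.re * m - v.im) = 0 := by
        linear_combination (1 + v.re) * hm
      have := (mul_eq_zero.1 this).resolve_left h
      linarith
  · obtain ⟨ζ, hζ⟩ : ∃ ζ, ζ = z * conj c := ⟨_, rfl⟩
    have hz : z = c * ζ := by
      rw [hζ]
      linear_combination -z * hc
    have hvζ : v * conj ζ = ζ := by
      rw [hζ, hv, map_mul, Complex.conj_conj]
      linear_combination conj c * huz + u * conj z * conj c * hc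
    have him := congrArg Complex.im hvζ
    simp only [Complex.mul_im, Complex.conj_re, Complex.conj_im] at him
    rw [← hζ, hz, mul_assoc]
    congr 1
    apply Complex.ext
    · simp
    · simp
      have : (1 + v.re) * (ζ.re * m - ζ.im) = 0 := by
        linear_combination ζ.re * hm + him
      have := (mul_eq_zero.1 this).resolve_left h
      linarith

theorem slope_slopeDir {c : ℂ} (hc : c * conj c = 1) (m : ℝ) : slope c (slopeDir c m) = m := by
  have h1 := one_sub_ne m
  have hv : slopeDir c m * conj c ^ 2 = (1 + Complex.I * m) / (1 - Complex.I * m) := by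
    rw [slopeDir]
    linear_combination ((1 + Complex.I * m) / (1 - Complex.I * m)) * (c * conj c + 1) * hc
  have hv' : (1 + Complex.I * m) / (1 - Complex.I * m) =
      (((1 - m ^ 2) / (1 + m ^ 2) : ℝ) : ℂ) + ((2 * m / (1 + m ^ 2) : ℝ) : ℂ) * Complex.I := by
    have h3 : (1 + m ^ 2 : ℂ) ≠ 0 := by
      have : (0 : ℝ) < 1 + m ^ 2 := by positivity
      exact_mod_cast this.ne'
    push_cast
    rw [div_eq_iff h1]
    field_simp
    ring_nf
    simp only [Complex.I_sq]
    ring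
  have h2 : (1 + m ^ 2 : ℝ) ≠ 0 := by positivity
  rw [slope, hv, hv']
  simp only [Complex.add_re, Complex.add_im, Complex.ofReal_re, Complex.ofReal_im, Complex.re_ofReal_mul,
    Complex.im_ofReal_mul, Complex.I_re, Complex.I_im]
  field_simp
  ring

/-- A rational parametrization of the variety of similarity classes. -/
def chart (c : ℂ) (w : ℝ × ℝ) : ClassSpace :=
  (projMatrix (affVec (c * w.1 * (1 + Complex.I * w.2))),
    affDir (c * w.1 * (1 + Complex.I * w.2)) (slopeDir c w.2))

/-- The inverse of `chart`. -/
def chartInv (c : ℂ) (y : ClassSpace) : ℝ × ℝ :=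
  ((y.1 0 1 / y.1 1 1 * conj c).re, slope c (y.2 2))

theorem chart_mem {c : ℂ} (hc : c * conj c = 1) {w : ℝ × ℝ}
    (h : 1 + c * w.1 * (1 + Complex.I * w.2) ≠ 0) : chart c w ∈ classVariety :=
  mk_mem_classVariety (affVec_mem _) (affVec_ne _)
    (directions_affVec (slopeDir_unit hc _) (slopeDir_mul_conj hc _ _) h)

theorem chartInv_chart {c : ℂ} (hc : c * conj c = 1) (w : ℝ × ℝ) :
    chartInv c (chart c w) = w := by
  refine Prod.ext ?_ (slope_slopeDir hc w.2)
  change (projMatrix (affVec _) 0 1 / projMatrix (affVec _) 1 1 * conj c).re = w.1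
  rw [projMatrix_affVec_div]
  have : c * w.1 * (1 + Complex.I * w.2) * conj c = w.1 * (1 + Complex.I * w.2) := by
    linear_combination w.1 * (1 + Complex.I * w.2) * hc
  rw [this]
  simp

/-- The conditions on M_11 and M_22 say that the second and third sides are nonzero: the ratio z is
then defined, and 1 + z ≠ 0. The last condition keeps the slope finite. -/
theorem chart_chartInv {c : ℂ} (hc : c * conj c = 1) {y : ClassSpace} (hy : y ∈ classVariety)
    (h1 : y.1 1 1 ≠ 0) (h2 : y.1 2 2 ≠ 0) (h : 1 + (y.2 2 * conj c ^ 2).re ≠ 0) :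
    chart c (chartInv c y) = y ∧ 1 + y.1 0 1 / y.1 1 1 ≠ 0 ∧
      c * (chartInv c y).1 * (1 + Complex.I * (chartInv c y).2) = y.1 0 1 / y.1 1 1 := by
  obtain ⟨hM, hd⟩ := exists_affVec hy h1
  have h2' : 1 + y.1 0 1 / y.1 1 1 ≠ 0 := affVec_one_add_ne (by rwa [← hM])
  have huz : y.2 2 * conj (y.1 0 1 / y.1 1 1) = y.1 0 1 / y.1 1 1 := by
    have := hd.two
    simpa [affVec] using this
  obtain ⟨hs1, hs2⟩ := slopeDir_slope hc (hd.unit 2) huz h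
  refine ⟨Prod.ext ?_ ?_, h2', hs2⟩
  · simp only [chart, chartInv, hs2]
    exact hM.symm
  · simp only [chart, chartInv, hs2, hs1]
    exact (eq_affDir hd h2').symm

/-- At most one side vanishes, and a cyclic relabelling moves it to index 0, the only position where
the chart allows a zero. -/
theorem exists_cycle {y : ClassSpace} (hy : y ∈ classVariety) :
    ∃ k, (cycle k y).1 1 1 ≠ 0 ∧ (cycle k y).1 2 2 ≠ 0 := by
  obtain ⟨r, hr, h0, hM, -⟩ := exists_vector hy
  have hne : ∀ i, r i ≠ 0 → y.1 i i ≠ 0 := by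
    intro i hi
    rw [hM, projMatrix_apply]
    exact div_ne_zero (mul_ne_zero hi (by simpa using hi)) (nsq_ne_zero h0)
  by_cases h : r 0 = 0
  · exact ⟨0, hne 1 (ne_zero_of_mem_X hr h0 (by decide) h),
      hne 2 (ne_zero_of_mem_X hr h0 (by decide) h)⟩
  by_cases h' : r 1 = 0
  · exact ⟨1, hne 2 (ne_zero_of_mem_X hr h0 (by decide) h'), hne 0 h⟩
  · exact ⟨2, hne 0 h, hne 1 h'⟩

theorem exists_sqrt_unit {u : ℂ} (hu : u * conj u = 1) : ∃ c, c ^ 2 = u ∧ c * conj c = 1 := by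
  obtain ⟨c, hc⟩ := IsAlgClosed.exists_pow_nat_eq u (n := 2) (by norm_num)
  refine ⟨c, hc, ?_⟩
  rw [← hc, map_pow, ← mul_pow, Complex.mul_conj] at hu
  have h1 : Complex.normSq c ^ 2 = 1 := by exact_mod_cast hu
  have h2 := Complex.normSq_nonneg c
  have h3 : Complex.normSq c = 1 := by nlinarith
  rw [Complex.mul_conj, h3, Complex.ofReal_one]

theorem ratAt_one_add_re {E : Type*} [NormedAddCommGroup E] [NormedSpace ℝ E] {f : E → ℂ} {x : E}
    (hf : RatC f x) : RatAt (fun y => 1 + (f y).re) x := (RatAt.const 1 x).add hf.re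

theorem finrank_zariskiTangent_classVariety {x : ClassSpace} (hx : x ∈ classVariety) :
    Module.finrank ℝ (zariskiTangent classVariety x) = 2 := by
  obtain ⟨k, h1, h2⟩ := exists_cycle hx
  have hx' := cycle_mem hx k
  -- Taking c as a square root of the squared direction at x puts x at slope 0, so that 1 + Re v = 2
  -- there.
  obtain ⟨c, hcu, hc⟩ := exists_sqrt_unit (hx'.2.2.2.2.1 2)
  have hv : (cycle k x).2 2 * conj c ^ 2 = 1 := by
    rw [← hcu]
    linear_combination (c * conj c + 1) * hc
  have hv' : 1 + ((cycle k x).2 2 * conj c ^ 2).re ≠ 0 := by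
    rw [hv]
    norm_num
  have hM : ∀ i j, PolyC fun y : ClassSpace => (cycle k y).1 i j :=
    fun i j => .linear (coordM (i + k) (j + k))
  have hU : ∀ i, PolyC fun y : ClassSpace => (cycle k y).2 i := fun i => .linear (coordU (i + k))
  have hMr : ∀ i j, RatC (fun y : ClassSpace => (cycle k y).1 i j) x :=
    fun i j => .linear (coordM (i + k) (j + k)) x
  have hUr : ∀ i, RatC (fun y : ClassSpace => (cycle k y).2 i * conj c ^ 2) x :=
    fun i => (RatC.linear (coordU (i + k)) x).mul (.const _ x)
  have ht : RatAt (fun y => (chartInv c (cycle k y)).1) x :=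
    (((hMr 0 1).div (hMr 1 1) h1).mul (.const (conj c) x)).re
  have hm : RatAt (fun y => (chartInv c (cycle k y)).2) x :=
    (hUr 2).im.div (ratAt_one_add_re (hUr 2)) hv'
  have hreal : ∀ i, (cycle k x).1 i i ≠ 0 → ((cycle k x).1 i i).re ≠ 0 := by
    intro i hi h
    apply hi
    have := Complex.conj_eq_iff_im.1 (hx'.1 i i)
    exact Complex.ext h this
  obtain ⟨hcc, hz, hzx⟩ := chart_chartInv hc hx' h1 h2 hv'
  have hz1 : RatC (fun w : ℝ × ℝ => c * w.1 * (1 + Complex.I * w.2)) (chartInv c (cycle k x)) :=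
    ratC_slope c (.linear (LinearMap.fst ℝ ℝ ℝ) _) (.linear (LinearMap.snd ℝ ℝ ℝ) _)
  have hu1 : RatC (fun w : ℝ × ℝ => slopeDir c w.2) (chartInv c (cycle k x)) :=
    ratC_slopeDir c (.linear (LinearMap.snd ℝ ℝ ℝ) _)
  have hz2 : RatC (fun y => c * (chartInv c (cycle k y)).1 *
      (1 + Complex.I * (chartInv c (cycle k y)).2)) x := ratC_slope c ht hm
  have hu2 : RatC (fun y => slopeDir c (chartInv c (cycle k y)).2) x := ratC_slopeDir c hm
  rw [← hzx] at hz
  rw [finrank_zariskiTangent hx (W := ℝ × ℝ) (s := fun w => cycle (-k) (chart c w))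
    (ρ := fun y => chartInv c (cycle k y))
    -- The diagonal entries are real on the variety, so their real parts detect vanishing and give a
    -- real polynomial localizing to the chart.
    (q₀ := fun y => ((cycle k y).1 1 1).re * ((cycle k y).1 2 2).re *
      (1 + ((cycle k y).2 2 * conj c ^ 2).re))
    (Ls := {l | ∃ A : ClassSpace →ₗ[ℝ] ℂ, ((∃ i j, A = coordM i j) ∨ ∃ i, A = coordU i) ∧
      (l = Complex.reLm.comp A ∨ l = Complex.imLm.comp A)})]
  · simp
  · refine DifferentiableAt.prodMk ?_ ?_
    · exact differentiableAt_pi.2 fun i => differentiableAt_pi.2 fun j =>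
        (ratC_projMatrix (ratC_affVec hz1) (affVec_ne _) (i + -k) (j + -k)).differentiableAt
    · exact differentiableAt_pi.2 fun i => (ratC_affDir hz1 hu1 hz (i + -k)).differentiableAt
  · exact ht.differentiableAt.prodMk hm.differentiableAt
  · have : Continuous fun w : ℝ × ℝ => 1 + c * w.1 * (1 + Complex.I * w.2) := by fun_prop
    filter_upwards [this.continuousAt.eventually_ne hz] with w hw
    exact cycle_mem (chart_mem hc hw) _
  · refine Eventually.of_forall fun w => ?_
    rw [cycle_cycle_neg, chartInv_chart hc]
  · exact (polyFun _).mul_mem ((polyFun _).mul_mem (hM 1 1).re (hM 2 2).re)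
      ((polyFun _).add_mem (const_mem_polyFun 1) ((hU 2).mul (.const _)).re)
  · exact mul_ne_zero (mul_ne_zero (hreal 1 h1) (hreal 2 h2)) hv'
  · intro y hy hq
    have hq1 := left_ne_zero_of_mul (left_ne_zero_of_mul hq)
    have hq2 := right_ne_zero_of_mul (left_ne_zero_of_mul hq)
    rw [(chart_chartInv hc (cycle_mem hy k) (fun h => hq1 (by rw [h, Complex.zero_re]))
      (fun h => hq2 (by rw [h, Complex.zero_re])) (right_ne_zero_of_mul hq)).1, cycle_neg_cycle]
  · intro v hv
    have hz : ∀ A : ClassSpace →ₗ[ℝ] ℂ, ((∃ i j, A = coordM i j) ∨ ∃ i, A = coordU i) →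
        A v = 0 := fun A hA =>
      Complex.ext (hv (Complex.reLm.comp A) ⟨A, hA, Or.inl rfl⟩)
        (hv (Complex.imLm.comp A) ⟨A, hA, Or.inr rfl⟩)
    refine Prod.ext ?_ ?_
    · funext i j
      exact hz (coordM i j) (Or.inl ⟨i, j, rfl⟩)
    · funext i
      exact hz (coordU i) (Or.inr ⟨i, rfl⟩)
  · rintro l ⟨A, hA, hl⟩
    have hr : RatC (fun y => A (cycle (-k) (chart c (chartInv c (cycle k y))))) x := by
      rcases hA with ⟨i, j, rfl⟩ | ⟨i, rfl⟩
      · exact ratC_projMatrix (ratC_affVec hz2) (affVec_ne _) (i + -k) (j + -k)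
      · exact ratC_affDir hz2 hu2 hz (i + -k)
    rcases hl with rfl | rfl
    · exact hr.re
    · exact hr.im

theorem isSmoothVariety_classes : IsSmoothVariety (classEmb '' classes) 2 := by
  rw [classEmb_image]
  exact ⟨isAlg_classVariety, fun x hx => finrank_zariskiTangent_classVariety hx⟩

/-! ### Radial diffeomorphisms -/

/-- An odd analytic function is `x * H (x ^ 2)` with `H` smooth. -/
theorem exists_smooth_of_odd {f : ℝ → ℝ} (hf : AnalyticAt ℝ f 0) (hodd : ∀ x, f (-x) = -f x) :
    ∃ H : ℝ → ℝ, ContDiffAt ℝ ∞ H 0 ∧ ∀ᶠ x in 𝓝 0, f x = x * H (x ^ 2) := by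
  obtain ⟨p, hp⟩ := hf
  set a : ℕ → ℝ := fun n => p.coeff (2 * n + 1) with ha
  set q : FormalMultilinearSeries ℝ ℝ ℝ := FormalMultilinearSeries.ofScalars ℝ a with hq
  obtain ⟨r, hr0, hr⟩ := ENNReal.lt_iff_exists_nnreal_btwn.1 hp.radius_pos
  have hr0' : (0 : ℝ) < r := by exact_mod_cast hr0
  obtain ⟨C, hC, hpC⟩ := p.norm_mul_pow_le_of_lt_radius hr
  -- The odd coefficients satisfy |a_n| r^(2n+1) ≤ C, so the series in x² with these coefficients
  -- converges at least up to r².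
  have hqr : ((r ^ 2 : NNReal) : ENNReal) ≤ q.radius := by
    refine q.le_radius_of_bound (C / r) fun n => ?_
    have h1 : ‖q n‖ = |a n| := by
      rw [hq, FormalMultilinearSeries.ofScalars_norm, Real.norm_eq_abs]
    have h2 := hpC (2 * n + 1)
    rw [FormalMultilinearSeries.norm_apply_eq_norm_coef, Real.norm_eq_abs] at h2
    rw [h1, le_div_iff₀ hr0']
    calc |a n| * ((r ^ 2 : NNReal) : ℝ) ^ n * r = |a n| * (r : ℝ) ^ (2 * n + 1) := by
          push_cast
          ring
      _ ≤ C := h2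
  have hqpos : 0 < q.radius := lt_of_lt_of_le (by exact_mod_cast pow_pos hr0' 2) hqr
  have hqs := q.hasFPowerSeriesOnBall hqpos
  refine ⟨q.sum, hqs.analyticAt.contDiffAt, ?_⟩
  have hsq : Tendsto (fun x : ℝ => x ^ 2) (𝓝 0) (𝓝 0) := by
    have : ContinuousAt (fun x : ℝ => x ^ 2) 0 := by fun_prop
    simpa [ContinuousAt] using this
  have hneg : Tendsto (fun x : ℝ => -x) (𝓝 0) (𝓝 0) := by
    have : ContinuousAt (fun x : ℝ => -x) 0 := by fun_prop
    simpa [ContinuousAt] using this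
  filter_upwards [hp.eventually_hasSum, hneg.eventually hp.eventually_hasSum,
    hsq.eventually hqs.hasFPowerSeriesAt.eventually_hasSum] with x h1 h2 h3
  simp only [zero_add, FormalMultilinearSeries.apply_eq_pow_smul_coeff, smul_eq_mul] at h1 h2 h3
  -- By oddness f(x) = (f(x) - f(-x))/2; termwise this removes the even powers, so that the sum can
  -- be reindexed by n ↦ 2n + 1.
  have h4 : HasSum (fun n : ℕ => (x ^ n * p.coeff n - (-x) ^ n * p.coeff n) / 2) (f x) := by
    have := (h1.sub h2).div_const 2
    rw [hodd, sub_neg_eq_add, add_self_div_two] at this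
    exact this
  have h5 : HasSum (fun n : ℕ => x * ((x ^ 2) ^ n * q.coeff n)) (x * q.sum (x ^ 2)) :=
    h3.mul_left x
  have hinj : Function.Injective fun n : ℕ => 2 * n + 1 := fun m n h => by
    simp only at h
    omega
  have h6 := (hinj.hasSum_iff (f := fun n : ℕ =>
    (x ^ n * p.coeff n - (-x) ^ n * p.coeff n) / 2) (a := f x) ?_).2 h4
  · refine h6.unique ?_
    convert h5 using 1
    funext n
    have hodd' : (-x) ^ (2 * n + 1) = -x ^ (2 * n + 1) := Odd.neg_pow ⟨n, rfl⟩ x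
    have hqn : q.coeff n = p.coeff (2 * n + 1) := by
      rw [hq, FormalMultilinearSeries.coeff_ofScalars]
    simp only [Function.comp, hodd', hqn]
    ring
  · intro n hn
    have heven : Even n := by
      by_contra h
      obtain ⟨m, hm⟩ := Nat.not_even_iff_odd.1 h
      exact hn ⟨m, hm.symm⟩
    simp [heven.neg_pow]

/-- The radial map with profile `f`. -/
def radial {E : Type*} [NormedAddCommGroup E] [NormedSpace ℝ E] (f : ℝ → ℝ) (v : E) : E :=
  (f ‖v‖ / ‖v‖) • v

/-- Away from 0 the norm is smooth. At 0 the factor f(‖v‖)/‖v‖ is H(‖v‖²) with H smooth, and the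
squared norm is smooth in an inner product space. -/
theorem contDiffAt_radial {E : Type*} [NormedAddCommGroup E] [InnerProductSpace ℝ E] {f : ℝ → ℝ}
    (hf : AnalyticAt ℝ f 0) (hodd : ∀ x, f (-x) = -f x) {v : E} (hv : ContDiffAt ℝ ∞ f ‖v‖) :
    ContDiffAt ℝ ∞ (radial f : E → E) v := by
  by_cases h0 : v = 0
  · subst h0
    obtain ⟨H, hH, hfH⟩ := exists_smooth_of_odd hf hodd
    have hn : ContDiffAt ℝ ∞ (fun v : E => ‖v‖ ^ 2) 0 := (contDiff_norm_sq ℝ).contDiffAt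
    have h1 : ContDiffAt ℝ ∞ (fun v : E => H (‖v‖ ^ 2) • v) 0 := by
      refine ContDiffAt.smul ?_ contDiffAt_id
      refine ContDiffAt.comp (0 : E) (g := H) ?_ hn
      simpa using hH
    refine h1.congr_of_eventuallyEq ?_
    have ht : Tendsto (fun v : E => ‖v‖) (𝓝 0) (𝓝 0) := by
      simpa using (continuous_norm (E := E)).tendsto 0
    filter_upwards [ht.eventually hfH] with v hv
    by_cases hv0 : v = 0
    · simp [radial, hv0]
    · rw [radial, hv, mul_div_cancel_left₀ _ (norm_ne_zero_iff.2 hv0)]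
  · have hn : ContDiffAt ℝ ∞ (fun v : E => ‖v‖) v := contDiffAt_norm ℝ h0
    exact ((hv.comp v hn).div hn (norm_ne_zero_iff.2 h0)).smul contDiffAt_id

theorem radial_smul {E : Type*} [NormedAddCommGroup E] [NormedSpace ℝ E] (f : ℝ → ℝ) {t : ℝ}
    (ht : 0 < t) {u : E} (hu : ‖u‖ = 1) : radial f (t • u) = f t • u := by
  rw [radial, norm_smul, hu, mul_one, Real.norm_eq_abs, abs_of_pos ht, smul_smul,
    div_mul_cancel₀ _ ht.ne']

/-- The profile of a diffeomorphism of the unit disc onto the plane. -/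
def stretch (t : ℝ) : ℝ := Real.tan (Real.pi / 2 * t)

/-- The inverse of `stretch`. -/
def shrink (x : ℝ) : ℝ := 2 / Real.pi * Real.arctan x

theorem cos_ne {t : ℝ} (h1 : -1 < t) (h2 : t < 1) : Real.cos (Real.pi / 2 * t) ≠ 0 := by
  have := Real.pi_pos
  refine (Real.cos_pos_of_mem_Ioo ⟨?_, ?_⟩).ne' <;> nlinarith

theorem analyticAt_stretch {t : ℝ} (h1 : -1 < t) (h2 : t < 1) : AnalyticAt ℝ stretch t := by
  have h : ContDiffAt ℝ ω stretch t :=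
    (Real.contDiffAt_tan.2 (cos_ne h1 h2)).comp t (contDiffAt_const.mul contDiffAt_id)
  exact h.analyticAt

theorem analyticAt_shrink (x : ℝ) : AnalyticAt ℝ shrink x := by
  have h : ContDiffAt ℝ ω shrink x :=
    contDiffAt_const.mul (Real.contDiff_arctan.contDiffAt)
  exact h.analyticAt

theorem shrink_stretch {t : ℝ} (h1 : -1 < t) (h2 : t < 1) : shrink (stretch t) = t := by
  have := Real.pi_pos
  rw [shrink, stretch, Real.arctan_tan (by nlinarith) (by nlinarith)]
  field_simp

theorem stretch_shrink (x : ℝ) : stretch (shrink x) = x := by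
  have h : Real.pi / 2 * (2 / Real.pi * Real.arctan x) = Real.arctan x := by
    field_simp
  rw [shrink, stretch, h, Real.tan_arctan]

theorem shrink_lt_one (x : ℝ) : shrink x < 1 := by
  have := Real.pi_pos
  have h := Real.arctan_lt_pi_div_two x
  rw [shrink, div_mul_eq_mul_div, div_lt_one this]
  linarith

theorem shrink_pos {x : ℝ} (hx : 0 < x) : 0 < shrink x := by
  have h := Real.arctan_pos.2 hx
  have := Real.pi_pos
  unfold shrink
  positivity

theorem stretch_pos {t : ℝ} (h1 : 0 < t) (h2 : t < 1) : 0 < stretch t := by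
  have := Real.pi_pos
  exact Real.tan_pos_of_pos_of_lt_pi_div_two (by positivity) (by nlinarith)

theorem stretch_one_sub (t : ℝ) : stretch (1 - t) = (stretch t)⁻¹ := by
  rw [stretch, mul_sub, mul_one, Real.tan_pi_div_two_sub, stretch]

theorem stretch_odd (x : ℝ) : stretch (-x) = -stretch x := by simp [stretch]

theorem shrink_odd (x : ℝ) : shrink (-x) = -shrink x := by simp [shrink]

/-- The identification of the Euclidean plane with `ℂ`. -/
def toPlane : EuclideanSpace ℝ (Fin 2) ≃ₗᵢ[ℝ] ℂ := Complex.orthonormalBasisOneI.repr.symm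

/-- A diffeomorphism of the unit disc onto the plane. -/
def discMap (v : EuclideanSpace ℝ (Fin 2)) : ℂ := toPlane (radial stretch v)

theorem discMap_smul {t : ℝ} (ht : 0 < t) {u : EuclideanSpace ℝ (Fin 2)} (hu : ‖u‖ = 1) :
    discMap (t • u) = stretch t * toPlane u := by
  rw [discMap, radial_smul _ ht hu, map_smul, Complex.real_smul]

theorem discMap_zero : discMap 0 = 0 := by simp [discMap, radial]

theorem exists_discMap_eq {w : ℂ} (hw : w ≠ 0) :
    ∃ t : ℝ, 0 < t ∧ t < 1 ∧ ∃ u : EuclideanSpace ℝ (Fin 2), ‖u‖ = 1 ∧ discMap (t • u) = w := by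
  have hn : 0 < ‖w‖ := norm_pos_iff.2 hw
  have hu : ‖toPlane.symm ((‖w‖)⁻¹ • w)‖ = 1 := by
    rw [LinearIsometryEquiv.norm_map, norm_smul, norm_inv, norm_norm, inv_mul_cancel₀ hn.ne']
  refine ⟨shrink ‖w‖, shrink_pos hn, shrink_lt_one _, _, hu, ?_⟩
  rw [discMap_smul (shrink_pos hn) hu, stretch_shrink, LinearIsometryEquiv.apply_symm_apply,
    ← Complex.real_smul, smul_smul, mul_inv_cancel₀ hn.ne', one_smul]

/-- Since tan(π/2 - x) = 1/tan x, the gluing of the connected sum becomes the inversion w ↦ 1/w̄,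
which fixes directions. This is the reason for the choice of `stretch`. -/
theorem discMap_one_sub {t : ℝ} (h0 : 0 < t) (h1 : t < 1) {u : EuclideanSpace ℝ (Fin 2)}
    (hu : ‖u‖ = 1) : discMap ((1 - t) • u) = (conj (discMap (t • u)))⁻¹ := by
  rw [discMap_smul h0 hu, discMap_smul (by linarith) hu, stretch_one_sub, map_mul,
    Complex.conj_ofReal, mul_inv, Complex.ofReal_inv]
  congr 1
  have h2 : ‖toPlane u‖ = 1 := by rw [LinearIsometryEquiv.norm_map, hu]
  have h3 : toPlane u * conj (toPlane u) = 1 := by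
    rw [Complex.mul_conj, Complex.normSq_eq_norm_sq, h2]
    norm_num
  exact eq_inv_of_mul_eq_one_left h3

/-! ### Open smooth embeddings and the stretched disc -/

theorem IsOpenSmoothEmbedding.of_inverse {E F : Type*} [NormedAddCommGroup E] [NormedSpace ℝ E]
    [NormedAddCommGroup F] [NormedSpace ℝ F] {f : E → F} {g : F → E} {s : Set E} {t O : Set F}
    (hO : IsOpen O) (hf : ContDiffOn ℝ ∞ f s) (hg : ContDiffOn ℝ ∞ g (t ∩ O))
    (hft : MapsTo f s (t ∩ O)) (hgs : MapsTo g (t ∩ O) s) (hgf : LeftInvOn g f s)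
    (hfg : RightInvOn g f (t ∩ O)) : IsOpenSmoothEmbedding f s t ∧ f '' s = t ∩ O := by
  have him : f '' s = t ∩ O :=
    subset_antisymm (image_subset_iff.2 hft) fun y hy => ⟨g y, hgs hy, hfg hy⟩
  exact ⟨⟨hf, ⟨O, hO, him⟩, g, him ▸ hg, hgf⟩, him⟩

theorem IsOpenSmoothEmbedding.comp {E F H : Type*} [NormedAddCommGroup E] [NormedSpace ℝ E]
    [NormedAddCommGroup F] [NormedSpace ℝ F] [NormedAddCommGroup H] [NormedSpace ℝ H]
    {f : E → F} {g : F → H} {s : Set E} {t t' : Set F} {r : Set H}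
    (hg : IsOpenSmoothEmbedding g t r) (hf : IsOpenSmoothEmbedding f s t') (him : f '' s = t) :
    IsOpenSmoothEmbedding (g ∘ f) s r := by
  obtain ⟨f', hf's, hf'⟩ := hf.smooth_inv
  obtain ⟨g', hg's, hg'⟩ := hg.smooth_inv
  have hmap : MapsTo f s t := him ▸ mapsTo_image f s
  refine ⟨hg.smooth.comp hf.smooth hmap, ?_, f' ∘ g', ?_, ?_⟩
  · rw [image_comp, him]
    exact hg.isOpen_image
  · rw [image_comp, him]
    rw [him] at hf's
    refine hf's.comp hg's ?_
    rintro _ ⟨x, hx, rfl⟩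
    rwa [hg' hx]
  · intro x hx
    simp only [Function.comp]
    rw [hg' (hmap hx), hf' hx]

theorem IsOpenSmoothEmbedding.injOn {E F : Type*} [NormedAddCommGroup E] [NormedSpace ℝ E]
    [NormedAddCommGroup F] [NormedSpace ℝ F] {f : E → F} {s : Set E} {t : Set F}
    (hf : IsOpenSmoothEmbedding f s t) : InjOn f s := by
  obtain ⟨f', -, hf'⟩ := hf.smooth_inv
  exact hf'.injOn

theorem discMap_embedding : IsOpenSmoothEmbedding discMap (Metric.ball 0 1) univ ∧
    discMap '' Metric.ball 0 1 = univ := by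
  have hshrink : ∀ w : ℂ, ‖radial shrink w‖ < 1 := by
    intro w
    by_cases hw : w = 0
    · simp [radial, hw]
    · have hn : 0 < ‖w‖ := norm_pos_iff.2 hw
      rw [radial, norm_smul, norm_div, norm_norm, div_mul_cancel₀ _ hn.ne', Real.norm_eq_abs,
        abs_of_pos (shrink_pos hn)]
      exact shrink_lt_one _
  have key : ∀ {E : Type} [NormedAddCommGroup E] [NormedSpace ℝ E] (v : E), v ≠ 0 →
      ∃ t : ℝ, 0 < t ∧ t = ‖v‖ ∧ ∃ u : E, ‖u‖ = 1 ∧ v = t • u := by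
    intro E _ _ v hv
    have hn : 0 < ‖v‖ := norm_pos_iff.2 hv
    refine ⟨‖v‖, hn, rfl, ‖v‖⁻¹ • v, ?_, ?_⟩
    · rw [norm_smul, norm_inv, norm_norm, inv_mul_cancel₀ hn.ne']
    · rw [smul_smul, mul_inv_cancel₀ hn.ne', one_smul]
  have := IsOpenSmoothEmbedding.of_inverse (f := discMap)
    (g := fun w => toPlane.symm (radial shrink w)) (s := Metric.ball 0 1) (t := univ)
    isOpen_univ ?_ ?_ ?_ ?_ ?_ ?_
  · rwa [univ_inter] at this
  · intro v hv
    rw [mem_ball_zero_iff] at hv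
    refine ContDiffAt.contDiffWithinAt ?_
    exact toPlane.contDiff.contDiffAt.comp v (contDiffAt_radial
      (analyticAt_stretch (by norm_num) (by norm_num)) stretch_odd
      (analyticAt_stretch (by linarith [norm_nonneg v]) hv).contDiffAt)
  · intro w _
    refine ContDiffAt.contDiffWithinAt ?_
    exact toPlane.symm.contDiff.contDiffAt.comp w (contDiffAt_radial
      (analyticAt_shrink 0) shrink_odd (analyticAt_shrink _).contDiffAt)
  · exact fun _ _ => ⟨trivial, trivial⟩
  · intro w _
    rw [mem_ball_zero_iff, LinearIsometryEquiv.norm_map]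
    exact hshrink w
  · intro v hv
    rw [mem_ball_zero_iff] at hv
    by_cases h0 : v = 0
    · simp [h0, discMap, radial]
    · obtain ⟨t, ht, htn, u, hu, rfl⟩ := key v h0
      rw [← htn] at hv
      have hu' : ‖toPlane u‖ = 1 := by rw [LinearIsometryEquiv.norm_map, hu]
      dsimp only
      rw [discMap_smul ht hu, ← Complex.real_smul, radial_smul _ (stretch_pos ht hv) hu',
        shrink_stretch (by linarith) hv, map_smul, LinearIsometryEquiv.symm_apply_apply]
  · intro w _
    by_cases h0 : w = 0
    · simp [h0, discMap, radial]
    · obtain ⟨t, ht, -, u, hu, rfl⟩ := key w h0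
      have hu' : ‖toPlane.symm u‖ = 1 := by rw [LinearIsometryEquiv.norm_map, hu]
      dsimp only
      rw [radial_smul _ ht hu, map_smul, discMap_smul (shrink_pos ht) hu', stretch_shrink,
        LinearIsometryEquiv.apply_symm_apply, Complex.real_smul]

/-! ### The real projective plane -/

/-- The rank one matrix of the vector `(a, w) ∈ ℂ × ℝ = ℝ³`. -/
def line (a : ℂ) (w : ℝ) : Fin 3 → Fin 3 → ℝ :=
  fun i j => (![a.re, a.im, w] : Fin 3 → ℝ) i * (![a.re, a.im, w] : Fin 3 → ℝ) j

theorem line_smul (c : ℝ) (a : ℂ) (w : ℝ) : line (c * a) (c * w) = c ^ 2 • line a w := by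
  funext i j
  simp only [line, Complex.re_ofReal_mul, Complex.im_ofReal_mul, Pi.smul_apply, smul_eq_mul]
  fin_cases i <;> fin_cases j <;> simp <;> ring

theorem projMatrix_real (v : Fin 3 → ℝ) :
    projMatrix v = (Complex.normSq ⟨v 0, v 1⟩ + v 2 ^ 2)⁻¹ • line ⟨v 0, v 1⟩ (v 2) := by
  funext i j
  have hv : v = ![v 0, v 1, v 2] := by
    funext k
    fin_cases k <;> rfl
  have hs : ∑ k, v k * v k = Complex.normSq ⟨v 0, v 1⟩ + v 2 ^ 2 := by
    rw [Fin.sum_univ_three, Complex.normSq_apply]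
    ring
  simp only [projMatrix, star_trivial, hs, Pi.smul_apply, line, smul_eq_mul, ← hv]
  rw [div_eq_inv_mul]

/-- Every line is spanned by a unit vector (a, w), unique up to sign, so projection matrices need no
denominators. -/
theorem mem_realProjectivePlane {P : Fin 3 → Fin 3 → ℝ} :
    P ∈ realProjectivePlane ↔ ∃ a w, Complex.normSq a + w ^ 2 = 1 ∧ P = line a w := by
  constructor
  · rintro ⟨p, rfl⟩
    set v := p.rep with hv
    have hn : 0 < Complex.normSq ⟨v 0, v 1⟩ + v 2 ^ 2 := by
      refine lt_of_le_of_ne (add_nonneg (Complex.normSq_nonneg _) (sq_nonneg _)) fun h => ?_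
      apply p.rep_nonzero
      have h1 := Complex.normSq_nonneg ⟨v 0, v 1⟩
      have h2 := sq_nonneg (v 2)
      have h3 : Complex.normSq ⟨v 0, v 1⟩ = 0 := by linarith
      have h4 : v 2 ^ 2 = 0 := by linarith
      have h5 := Complex.normSq_eq_zero.1 h3
      funext k
      fin_cases k
      · exact congrArg Complex.re h5
      · exact congrArg Complex.im h5
      · exact pow_eq_zero_iff (two_ne_zero) |>.1 h4
    obtain ⟨s, hs⟩ : ∃ s, s = √(Complex.normSq ⟨v 0, v 1⟩ + v 2 ^ 2) := ⟨_, rfl⟩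
    have hs2 : s ^ 2 = Complex.normSq ⟨v 0, v 1⟩ + v 2 ^ 2 := by rw [hs, Real.sq_sqrt hn.le]
    have hs0 : s ≠ 0 := by
      rw [hs]
      exact (Real.sqrt_pos.2 hn).ne'
    refine ⟨(s⁻¹ : ℝ) * ⟨v 0, v 1⟩, s⁻¹ * v 2, ?_, ?_⟩
    · rw [map_mul, Complex.normSq_ofReal, ← sq, mul_pow, ← mul_add, ← hs2, ← mul_pow,
        inv_mul_cancel₀ hs0, one_pow]
    · rw [line_smul, inv_pow, hs2]
      exact projMatrix_real v
  · rintro ⟨a, w, h, rfl⟩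
    have hv : (![a.re, a.im, w] : Fin 3 → ℝ) ≠ 0 := by
      intro h0
      have e0 := congrFun h0 0
      have e1 := congrFun h0 1
      have e2 := congrFun h0 2
      simp only [Matrix.cons_val, Pi.zero_apply] at e0 e1 e2
      rw [Complex.normSq_apply, e0, e1, e2] at h
      norm_num at h
    refine ⟨Projectivization.mk ℝ _ hv, ?_⟩
    obtain ⟨c, hc, hc'⟩ := mk_rep_eq (K := ℝ) _ hv
    dsimp only
    rw [hc', projMatrix_real]
    have e : (⟨(c • (![a.re, a.im, w] : Fin 3 → ℝ)) 0, (c • (![a.re, a.im, w] : Fin 3 → ℝ)) 1⟩ : ℂ) =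
        c * a := Complex.ext (by simp) (by simp)
    have e' : (c • (![a.re, a.im, w] : Fin 3 → ℝ)) 2 = c * w := by simp
    rw [e, e', line_smul, map_mul, Complex.normSq_ofReal, ← sq, mul_pow, ← mul_add, h, mul_one,
      smul_smul, inv_mul_cancel₀ (pow_ne_zero 2 hc), one_smul]

/-- The point `[0, 0, 1]` of the real projective plane. -/
def pole : Fin 3 → Fin 3 → ℝ := line 0 1

theorem line_zero {w : ℝ} (h : Complex.normSq 0 + w ^ 2 = 1) : line 0 w = pole := by
  have h1 := line_smul w 0 1
  rw [mul_zero, mul_one] at h1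
  rw [map_zero, zero_add] at h
  rw [h1, h, one_smul, pole]

theorem mem_diff_pole {P : Fin 3 → Fin 3 → ℝ} :
    P ∈ realProjectivePlane \ {pole} ↔
      ∃ a w, Complex.normSq a + w ^ 2 = 1 ∧ a ≠ 0 ∧ P = line a w := by
  constructor
  · rintro ⟨hP, hne⟩
    obtain ⟨a, w, h, rfl⟩ := mem_realProjectivePlane.1 hP
    refine ⟨a, w, h, ?_, rfl⟩
    rintro rfl
    exact hne (line_zero h)
  · rintro ⟨a, w, h, ha, rfl⟩
    refine ⟨mem_realProjectivePlane.2 ⟨a, w, h, rfl⟩, fun hp => ?_⟩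
    have h1 : w * w = 1 := by
      have := congrFun (congrFun hp 2) 2
      simpa [line, pole] using this
    have h2 := Complex.normSq_pos.2 ha
    nlinarith

/-- The affine chart `y ↦ [y, 1]` of the real projective plane. -/
def planeChart (y : ℂ) : Fin 3 → Fin 3 → ℝ := (1 + Complex.normSq y)⁻¹ • line y 1

theorem one_add_normSq_pos (y : ℂ) : 0 < 1 + Complex.normSq y :=
  add_pos_of_pos_of_nonneg one_pos (Complex.normSq_nonneg y)

theorem planeChart_zero : planeChart 0 = pole := by simp [planeChart, pole]

theorem line_eq_planeChart {a : ℂ} {w : ℝ} (h : Complex.normSq a + w ^ 2 = 1) (hw : w ≠ 0) :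
    line a w = planeChart (a / w) := by
  have h1 : line a w = w ^ 2 • line (a / w) 1 := by
    rw [← line_smul, mul_one, mul_div_cancel₀ _ (by exact_mod_cast hw)]
  rw [h1, planeChart]
  congr 1
  refine eq_inv_of_mul_eq_one_left ?_
  rw [map_div₀, Complex.normSq_ofReal]
  field_simp
  linarith

theorem exists_line_eq_planeChart (y : ℂ) : ∃ c : ℝ, 0 < c ∧ c ^ 2 = (1 + Complex.normSq y)⁻¹ ∧
    Complex.normSq (c * y) + c ^ 2 = 1 ∧ planeChart y = line (c * y) c := by
  have hn := one_add_normSq_pos y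
  have hc : √((1 + Complex.normSq y)⁻¹) ^ 2 = (1 + Complex.normSq y)⁻¹ :=
    Real.sq_sqrt (inv_pos.2 hn).le
  refine ⟨√((1 + Complex.normSq y)⁻¹), Real.sqrt_pos.2 (inv_pos.2 hn), hc, ?_, ?_⟩
  · rw [map_mul, Complex.normSq_ofReal, ← sq, hc]
    field_simp
    ring
  · have := line_smul √((1 + Complex.normSq y)⁻¹) y 1
    rw [mul_one] at this
    rw [this, hc, planeChart]

theorem planeChart_mem (y : ℂ) : planeChart y ∈ realProjectivePlane := by
  obtain ⟨c, -, -, h, h'⟩ := exists_line_eq_planeChart y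
  exact mem_realProjectivePlane.2 ⟨_, _, h, h'⟩

/-! ### Smoothness of elementary complex expressions -/

section Smooth

variable {E : Type*} [NormedAddCommGroup E] [NormedSpace ℝ E] {s : Set E}

theorem smooth_re {f : E → ℂ} (hf : ContDiffOn ℝ ∞ f s) : ContDiffOn ℝ ∞ (fun x => (f x).re) s :=
  Complex.reCLM.contDiff.comp_contDiffOn hf

theorem smooth_im {f : E → ℂ} (hf : ContDiffOn ℝ ∞ f s) : ContDiffOn ℝ ∞ (fun x => (f x).im) s :=
  Complex.imCLM.contDiff.comp_contDiffOn hf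

theorem smooth_conj {f : E → ℂ} (hf : ContDiffOn ℝ ∞ f s) :
    ContDiffOn ℝ ∞ (fun x => conj (f x)) s :=
  (Complex.conjCLE : ℂ →L[ℝ] ℂ).contDiff.comp_contDiffOn hf

theorem smooth_ofReal {f : E → ℝ} (hf : ContDiffOn ℝ ∞ f s) :
    ContDiffOn ℝ ∞ (fun x => (f x : ℂ)) s :=
  Complex.ofRealCLM.contDiff.comp_contDiffOn hf

theorem smooth_div {f g : E → ℂ} (hf : ContDiffOn ℝ ∞ f s) (hg : ContDiffOn ℝ ∞ g s)
    (h0 : ∀ x ∈ s, g x ≠ 0) : ContDiffOn ℝ ∞ (fun x => f x / g x) s := by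
  simp only [div_eq_mul_inv]
  exact hf.mul (hg.inv h0)

theorem smooth_normSq {f : E → ℂ} (hf : ContDiffOn ℝ ∞ f s) :
    ContDiffOn ℝ ∞ (fun x => Complex.normSq (f x)) s := by
  simp only [Complex.normSq_apply]
  exact ((smooth_re hf).mul (smooth_re hf)).add ((smooth_im hf).mul (smooth_im hf))

theorem smooth_vec3 {F : Type*} [NormedAddCommGroup F] [NormedSpace ℝ F] {f g h : E → F}
    (hf : ContDiffOn ℝ ∞ f s) (hg : ContDiffOn ℝ ∞ g s) (hh : ContDiffOn ℝ ∞ h s) :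
    ContDiffOn ℝ ∞ (fun x => (![f x, g x, h x] : Fin 3 → F)) s := by
  refine contDiffOn_pi.2 fun i => ?_
  fin_cases i
  · exact hf
  · exact hg
  · exact hh

theorem smooth_coord (i j : Fin 3) {s : Set (Fin 3 → Fin 3 → ℝ)} :
    ContDiffOn ℝ ∞ (fun P : Fin 3 → Fin 3 → ℝ => P i j) s :=
  (contDiff_apply_apply ℝ ℝ i j).contDiffOn

end Smooth

theorem planeChart_embedding : IsOpenSmoothEmbedding planeChart univ realProjectivePlane := by
  refine (IsOpenSmoothEmbedding.of_inverse (g := fun P => (P 0 2 + P 1 2 * Complex.I) / P 2 2)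
    (O := {P | P 2 2 ≠ 0}) ?_ ?_ ?_ ?_ ?_ ?_ ?_).1
  · have : Continuous fun P : Fin 3 → Fin 3 → ℝ => P 2 2 := by fun_prop
    exact isOpen_ne.preimage this
  · have hid : ContDiffOn ℝ ∞ (fun y : ℂ => y) univ := contDiffOn_id
    have hv := smooth_vec3 (smooth_re hid) (smooth_im hid) (contDiffOn_const (c := (1 : ℝ)))
    have hc : ContDiffOn ℝ ∞ (fun y : ℂ => (1 + Complex.normSq y)⁻¹) univ :=
      (contDiffOn_const.add (smooth_normSq hid)).inv fun y _ => (one_add_normSq_pos y).ne'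
    exact contDiffOn_pi.2 fun i => contDiffOn_pi.2 fun j =>
      hc.mul ((contDiffOn_pi.1 hv i).mul (contDiffOn_pi.1 hv j))
  · refine smooth_div (ContDiffOn.add (smooth_ofReal (smooth_coord 0 2))
      ((smooth_ofReal (smooth_coord 1 2)).mul contDiffOn_const)) (smooth_ofReal (smooth_coord 2 2))
      ?_
    rintro P ⟨-, hP⟩
    exact_mod_cast hP
  · intro y _
    refine ⟨planeChart_mem y, ?_⟩
    simp [planeChart, line, (one_add_normSq_pos y).ne']
  · exact fun _ _ => trivial
  · intro y _
    have h := (one_add_normSq_pos y).ne'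
    have h' : (1 + Complex.normSq y : ℂ) ≠ 0 := by exact_mod_cast h
    simp [planeChart, line]
    field_simp
    exact Complex.re_add_im y
  · rintro P ⟨hP, hP2⟩
    obtain ⟨a, w, h, rfl⟩ := mem_realProjectivePlane.1 hP
    have hw : w ≠ 0 := by
      rintro rfl
      exact hP2 (by simp [line])
    have hw' : (w : ℂ) ≠ 0 := by exact_mod_cast hw
    refine Eq.trans (congrArg planeChart ?_) (line_eq_planeChart h hw).symm
    simp only [line, Matrix.cons_val, Complex.ofReal_mul]
    field_simp
    exact Complex.re_add_im a

/-- Blowing up a point of a surface amounts to the connected sum with a projective plane. -/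
theorem isConnectedSum_of_blowup {E E₁ : Type*} [NormedAddCommGroup E] [NormedSpace ℝ E]
    [NormedAddCommGroup E₁] [NormedSpace ℝ E₁] {M : Set E} {N : Set E₁} {k : ℂ → E₁}
    {j : E₁ → E} {b : (Fin 3 → Fin 3 → ℝ) → E} (hk : IsOpenSmoothEmbedding k univ N)
    (hj : IsOpenSmoothEmbedding j (N \ {k 0}) M)
    (hb : IsOpenSmoothEmbedding b (realProjectivePlane \ {pole}) M)
    (hcover : M ⊆ j '' (N \ {k 0}) ∪ b '' (realProjectivePlane \ {pole}))
    (hkb : ∀ w : ℂ, w ≠ 0 → j (k w) = b (planeChart (conj w)⁻¹))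
    (hinf : ∀ x ∈ N \ {k 0}, ∀ y ∈ realProjectivePlane \ {pole}, j x = b y → y 2 2 ≠ 0) :
    IsConnectedSum M N realProjectivePlane := by
  have him := discMap_embedding.2
  refine ⟨k ∘ discMap, planeChart ∘ discMap, j, b, hk.comp discMap_embedding.1 him,
    planeChart_embedding.comp discMap_embedding.1 him, ?_, ?_, ?_, ?_⟩
  · simpa [discMap_zero] using hj
  · simpa [discMap_zero, planeChart_zero] using hb
  · simp only [Function.comp, discMap_zero, planeChart_zero]
    refine subset_antisymm (union_subset ?_ ?_) hcover
    · obtain ⟨O, -, hO⟩ := hj.isOpen_image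
      exact hO ▸ inter_subset_left
    · obtain ⟨O, -, hO⟩ := hb.isOpen_image
      exact hO ▸ inter_subset_left
  · simp only [Function.comp, discMap_zero, planeChart_zero]
    intro x hx y hy
    constructor
    -- By `hinf` the point y avoids the line at infinity, so it lies in the affine chart with
    -- coordinate a/w. Then 1/conj(a/w) is the parameter of a point of N with the same image, and
    -- this point is x since j is injective.
    · intro hxy
      have hy2 := hinf x hx y hy hxy
      obtain ⟨a, w, h, ha, rfl⟩ := mem_diff_pole.1 hy
      have hw : w ≠ 0 := by
        rintro rfl
        exact hy2 (by simp [line])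
      have hyw := line_eq_planeChart h hw
      have hv : conj (a / (w : ℂ))⁻¹ ≠ 0 := by
        have hw' : (w : ℂ) ≠ 0 := by exact_mod_cast hw
        simpa using ⟨hw, ha⟩
      have hconj : (conj (conj (a / (w : ℂ))⁻¹))⁻¹ = a / w := by rw [Complex.conj_conj, inv_inv]
      have hkx : k (conj (a / (w : ℂ))⁻¹) = x := by
        refine hj.injOn ⟨?_, ?_⟩ hx ?_
        · obtain ⟨O, -, hO⟩ := hk.isOpen_image
          have := mem_image_of_mem k (mem_univ (conj (a / (w : ℂ))⁻¹))
          rw [hO] at this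
          exact this.1
        · intro h0
          exact hv (hk.injOn trivial trivial h0)
        · rw [hkb _ hv, hconj, ← hyw, hxy]
      obtain ⟨t, ht0, ht1, u, hu, hut⟩ := exists_discMap_eq hv
      refine ⟨t, ht0, ht1, u, hu, ?_, ?_⟩
      · rw [hut, hkx]
      · rw [discMap_one_sub ht0 ht1 hu, hut, hconj, hyw]
    · rintro ⟨t, ht0, ht1, u, hu, rfl, rfl⟩
      rw [discMap_one_sub ht0 ht1 hu]
      refine hkb _ fun h0 => ?_
      rw [discMap_smul ht0 hu] at h0
      rcases mul_eq_zero.1 h0 with h | h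
      · exact (stretch_pos ht0 ht1).ne' (by exact_mod_cast h)
      · have : u = 0 := by simpa using h
        rw [this, norm_zero] at hu
        exact zero_ne_one hu

/-! ### The Klein bottle -/

/-- The sphere `|ω|² = p (1 - p)` blown up at its poles `p = 0` and `p = 1`. -/
def kleinBottle : Set (ℂ × ℝ × ℂ) :=
  {n | n.1 * conj n.1 = ((n.2.1 * (1 - n.2.1) : ℝ) : ℂ) ∧ n.2.2 * conj n.2.2 = 1 ∧
    n.2.2 * conj n.1 = n.1}

/-- The projective plane without a point as the sphere blown up at `p = 0`, without `p = 1`. -/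
def toKlein (P : Fin 3 → Fin 3 → ℝ) : ℂ × ℝ × ℂ :=
  (P 0 2 + P 1 2 * Complex.I, P 2 2,
    (P 0 0 - P 1 1 + 2 * P 0 1 * Complex.I) / (P 0 0 + P 1 1 : ℝ))

/-- The inverse of `toKlein`. -/
def ofKlein (n : ℂ × ℝ × ℂ) : Fin 3 → Fin 3 → ℝ :=
  ![![((1 - n.2.1) + (1 - n.2.1) * n.2.2.re) / 2, (1 - n.2.1) * n.2.2.im / 2, n.1.re],
    ![(1 - n.2.1) * n.2.2.im / 2, ((1 - n.2.1) - (1 - n.2.1) * n.2.2.re) / 2, n.1.im],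
    ![n.1.re, n.1.im, n.2.1]]

/-- The exchange of the two poles. -/
def flip (n : ℂ × ℝ × ℂ) : ℂ × ℝ × ℂ := (n.1, 1 - n.2.1, n.2.2)

theorem flip_flip (n : ℂ × ℝ × ℂ) : flip (flip n) = n := by simp [flip]

theorem flip_mem {n : ℂ × ℝ × ℂ} (hn : n ∈ kleinBottle) : flip n ∈ kleinBottle := by
  obtain ⟨h1, h2, h3⟩ := hn
  refine ⟨?_, h2, h3⟩
  simp only [flip]
  rw [h1]
  congr 1
  ring

/-- For a unit vector p = w² and 1 - p = |a|², whence |ω|² = p(1 - p). The sign of (a, w)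
disappears, and on the line w = 0 the third entry still remembers the line of a: this circle is the
exceptional one over p = 0. -/
theorem toKlein_line (a : ℂ) (w : ℝ) :
    toKlein (line a w) = (w * a, w ^ 2, a ^ 2 / (Complex.normSq a : ℝ)) := by
  refine Prod.ext ?_ (Prod.ext ?_ ?_)
  · apply Complex.ext <;> simp [toKlein, line, mul_comm]
  · simp [toKlein, line, sq]
  · simp only [toKlein, line, Matrix.cons_val]
    congr 1
    apply Complex.ext <;> simp [sq]
    ring

theorem div_normSq_unit {a : ℂ} (ha : a ≠ 0) :
    a ^ 2 / (Complex.normSq a : ℝ) * conj (a ^ 2 / (Complex.normSq a : ℝ)) = 1 := by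
  have ha' : conj a ≠ 0 := by simpa using ha
  rw [← Complex.mul_conj, map_div₀, map_pow, map_mul, Complex.conj_conj]
  field_simp

theorem div_normSq_mul_conj (a : ℂ) : a ^ 2 / (Complex.normSq a : ℝ) * conj a = a := by
  by_cases ha : a = 0
  · simp [ha]
  have ha' : conj a ≠ 0 := by simpa using ha
  rw [← Complex.mul_conj]
  field_simp

theorem toKlein_line_mem {a : ℂ} {w : ℝ} (h : Complex.normSq a + w ^ 2 = 1) (ha : a ≠ 0) :
    toKlein (line a w) ∈ kleinBottle := by
  rw [toKlein_line]
  refine ⟨?_, div_normSq_unit ha, ?_⟩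
  · rw [← h, add_sub_cancel_right, map_mul, Complex.conj_ofReal, mul_mul_mul_comm,
      Complex.mul_conj]
    push_cast
    ring
  · simp only [map_mul, Complex.conj_ofReal]
    rw [mul_left_comm, div_normSq_mul_conj]

theorem ofKlein_toKlein_line {a : ℂ} {w : ℝ} (h : Complex.normSq a + w ^ 2 = 1) (ha : a ≠ 0) :
    ofKlein (toKlein (line a w)) = line a w := by
  rw [toKlein_line]
  have hw : 1 - w ^ 2 = Complex.normSq a := by linarith
  have hn : Complex.normSq a ≠ 0 := by simpa using ha
  have hre : Complex.normSq a * (a ^ 2 / (Complex.normSq a : ℝ)).re = a.re ^ 2 - a.im ^ 2 := by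
    rw [Complex.div_ofReal_re, mul_div_cancel₀ _ hn, sq, Complex.mul_re]
    ring
  have him : Complex.normSq a * (a ^ 2 / (Complex.normSq a : ℝ)).im = 2 * a.re * a.im := by
    rw [Complex.div_ofReal_im, mul_div_cancel₀ _ hn, sq, Complex.mul_im]
    ring
  simp only [ofKlein]
  rw [hw, hre, him, Complex.normSq_apply]
  funext i j
  fin_cases i <;> fin_cases j <;> simp [line] <;> ring

/-- With c² = u, the relation u ω̄ = ω makes ω c̄ a real number ρ. The unit vector is a = √(1 - p)
c, w = ρ/√(1 - p); the two choices of c give the same line. -/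
theorem exists_line_of_klein {n : ℂ × ℝ × ℂ} (hn : n ∈ kleinBottle) (h1 : n.2.1 ≠ 1) :
    ∃ a w, Complex.normSq a + w ^ 2 = 1 ∧ a ≠ 0 ∧ n = toKlein (line a w) := by
  obtain ⟨ζ, p, u⟩ := n
  obtain ⟨hζ, hu, huζ⟩ := hn
  dsimp only at *
  have hζ' : Complex.normSq ζ = p * (1 - p) := by
    rw [Complex.mul_conj] at hζ
    exact_mod_cast hζ
  have hq : 0 < 1 - p := by
    have := Complex.normSq_nonneg ζ
    rw [hζ'] at this
    rcases lt_or_gt_of_ne h1 with h | h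
    · linarith
    · nlinarith
  obtain ⟨c, hcu, hc⟩ := exists_sqrt_unit hu
  have hc0 : c ≠ 0 := by
    rintro rfl
    simp at hc
  have hcn : Complex.normSq c = 1 := by
    rw [Complex.mul_conj] at hc
    exact_mod_cast hc
  obtain ⟨s, hs⟩ : ∃ s, s = √(1 - p) := ⟨_, rfl⟩
  have hs0 : s ≠ 0 := by
    rw [hs]
    exact (Real.sqrt_pos.2 hq).ne'
  have hs2 : s ^ 2 = 1 - p := by rw [hs, Real.sq_sqrt hq.le]
  have hreal : conj (ζ * conj c) = ζ * conj c := by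
    rw [map_mul, Complex.conj_conj]
    linear_combination -(conj ζ * c) * hc + conj c * huζ + conj ζ * conj c * hcu
  have hre := Complex.conj_eq_iff_re.1 hreal
  have hζc : ζ = (ζ * conj c).re * c := by
    rw [hre]
    linear_combination -ζ * hc
  obtain ⟨ρ, hρ⟩ : ∃ ρ, ρ = (ζ * conj c).re := ⟨_, rfl⟩
  rw [← hρ] at hζc
  have hρ2 : ρ ^ 2 = p * (1 - p) := by
    rw [← hζ', hζc, map_mul, Complex.normSq_ofReal, hcn]
    ring
  have hsa : Complex.normSq (s * c) = 1 - p := by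
    rw [map_mul, Complex.normSq_ofReal, hcn, ← hs2]
    ring
  have hw2 : (ρ / s) ^ 2 = p := by
    rw [div_pow, hρ2, hs2, mul_div_cancel_right₀ _ hq.ne']
  have hs0' : (s : ℂ) ≠ 0 := by exact_mod_cast hs0
  refine ⟨s * c, ρ / s, ?_, mul_ne_zero hs0' hc0, ?_⟩
  · rw [hsa, hw2]
    ring
  · rw [toKlein_line, hsa, hw2, ← hs2]
    refine Prod.ext ?_ (Prod.ext rfl ?_)
    · simp only [hζc]
      push_cast
      field_simp
    · simp only [← hcu]
      push_cast
      field_simp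

theorem toKlein_snd (P : Fin 3 → Fin 3 → ℝ) : (toKlein P).2.1 = P 2 2 := rfl

theorem toKlein_ne_one {P : Fin 3 → Fin 3 → ℝ} (hP : P ∈ realProjectivePlane \ {pole}) :
    P 2 2 ≠ 1 := by
  obtain ⟨a, w, h, ha, rfl⟩ := mem_diff_pole.1 hP
  have := Complex.normSq_pos.2 ha
  simp only [line, Matrix.cons_val]
  nlinarith

theorem smooth_toKlein : ContDiffOn ℝ ∞ toKlein (realProjectivePlane \ {pole}) := by
  refine ContDiffOn.prodMk ?_ (ContDiffOn.prodMk (smooth_coord 2 2) ?_)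
  · exact ContDiffOn.add (smooth_ofReal (smooth_coord 0 2))
      ((smooth_ofReal (smooth_coord 1 2)).mul contDiffOn_const)
  · refine smooth_div (ContDiffOn.add (ContDiffOn.sub (smooth_ofReal (smooth_coord 0 0))
      (smooth_ofReal (smooth_coord 1 1))) ((contDiffOn_const.mul (smooth_ofReal
      (smooth_coord 0 1))).mul contDiffOn_const)) (smooth_ofReal
      ((smooth_coord 0 0).add (smooth_coord 1 1))) ?_
    intro P hP
    obtain ⟨a, w, h, ha, rfl⟩ := mem_diff_pole.1 hP
    simp only [line, Matrix.cons_val, ← Complex.normSq_apply]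
    simpa using ha

theorem smooth_ofKlein {s : Set (ℂ × ℝ × ℂ)} : ContDiffOn ℝ ∞ ofKlein s := by
  have hω : ContDiffOn ℝ ∞ (fun n : ℂ × ℝ × ℂ => n.1) s := contDiff_fst.contDiffOn
  have hp : ContDiffOn ℝ ∞ (fun n : ℂ × ℝ × ℂ => n.2.1) s :=
    (contDiff_fst.comp contDiff_snd).contDiffOn
  have hu : ContDiffOn ℝ ∞ (fun n : ℂ × ℝ × ℂ => n.2.2) s :=
    (contDiff_snd.comp contDiff_snd).contDiffOn
  have hq : ContDiffOn ℝ ∞ (fun n : ℂ × ℝ × ℂ => 1 - n.2.1) s := contDiffOn_const.sub hp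
  have h1 := hq.mul (smooth_re hu)
  have h2 := (hq.mul (smooth_im hu)).div_const 2
  exact smooth_vec3 (smooth_vec3 ((hq.add h1).div_const 2) h2 (smooth_re hω))
    (smooth_vec3 h2 ((hq.sub h1).div_const 2) (smooth_im hω))
    (smooth_vec3 (smooth_re hω) (smooth_im hω) hp)

theorem smooth_flip {s : Set (ℂ × ℝ × ℂ)} : ContDiffOn ℝ ∞ flip s :=
  contDiff_fst.contDiffOn.prodMk ((contDiffOn_const.sub
    (contDiff_fst.comp contDiff_snd).contDiffOn).prodMk
    (contDiff_snd.comp contDiff_snd).contDiffOn)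

theorem continuous_height : Continuous fun n : ℂ × ℝ × ℂ => n.2.1 := by fun_prop

theorem toKlein_embedding :
    IsOpenSmoothEmbedding toKlein (realProjectivePlane \ {pole}) kleinBottle ∧
      toKlein '' (realProjectivePlane \ {pole}) = kleinBottle ∩ {n | n.2.1 ≠ 1} := by
  refine IsOpenSmoothEmbedding.of_inverse (g := ofKlein) (isOpen_ne.preimage continuous_height)
    smooth_toKlein smooth_ofKlein ?_ ?_ ?_ ?_
  · intro P hP
    refine ⟨?_, toKlein_ne_one hP⟩
    obtain ⟨a, w, h, ha, rfl⟩ := mem_diff_pole.1 hP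
    exact toKlein_line_mem h ha
  · rintro n ⟨hn, hn1⟩
    obtain ⟨a, w, h, ha, rfl⟩ := exists_line_of_klein hn hn1
    rw [ofKlein_toKlein_line h ha]
    exact mem_diff_pole.2 ⟨a, w, h, ha, rfl⟩
  · intro P hP
    obtain ⟨a, w, h, ha, rfl⟩ := mem_diff_pole.1 hP
    exact ofKlein_toKlein_line h ha
  · rintro n ⟨hn, hn1⟩
    obtain ⟨a, w, h, ha, rfl⟩ := exists_line_of_klein hn hn1
    rw [ofKlein_toKlein_line h ha]

theorem flip_embedding : IsOpenSmoothEmbedding flip (kleinBottle ∩ {n | n.2.1 ≠ 1}) kleinBottle ∧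
    flip '' (kleinBottle ∩ {n | n.2.1 ≠ 1}) = kleinBottle ∩ {n | n.2.1 ≠ 0} := by
  refine IsOpenSmoothEmbedding.of_inverse (g := flip) (isOpen_ne.preimage continuous_height)
    smooth_flip smooth_flip ?_ ?_ (fun n _ => flip_flip n) (fun n _ => flip_flip n)
  · rintro n ⟨hn, hn1⟩
    exact ⟨flip_mem hn, fun h => hn1 (sub_eq_zero.1 h).symm⟩
  · rintro n ⟨hn, hn0⟩
    refine ⟨flip_mem hn, fun h => hn0 ?_⟩
    simpa [flip] using h

theorem toKlein_planeChart (y : ℂ) : toKlein (planeChart y) =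
    (y / (1 + Complex.normSq y : ℝ), (1 + Complex.normSq y)⁻¹, y ^ 2 / (Complex.normSq y : ℝ)) := by
  obtain ⟨c, hc, hc2, -, h⟩ := exists_line_eq_planeChart y
  have hc' : (c : ℂ) ≠ 0 := by exact_mod_cast hc.ne'
  rw [h, toKlein_line, hc2]
  refine Prod.ext ?_ (Prod.ext rfl ?_)
  · simp only
    rw [← mul_assoc, ← sq, div_eq_inv_mul, ← Complex.ofReal_inv, ← hc2, Complex.ofReal_pow]
  · simp only
    rw [map_mul, Complex.normSq_ofReal, mul_pow, Complex.ofReal_mul, ← sq, Complex.ofReal_pow,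
      mul_div_mul_left _ _ (pow_ne_zero 2 hc')]

/-- The height of y is 1/(1 + |y|²). Inversion in the unit circle keeps the direction of y and
replaces the height by its complement to 1. -/
theorem toKlein_planeChart_inv {w : ℂ} (hw : w ≠ 0) :
    toKlein (planeChart w) = flip (toKlein (planeChart (conj w)⁻¹)) := by
  have hn : Complex.normSq w ≠ 0 := by simpa using hw
  have hn' : (Complex.normSq w : ℂ) ≠ 0 := by exact_mod_cast hn
  have h1 := (one_add_normSq_pos w).ne'
  have h1' : (1 + Complex.normSq w : ℂ) ≠ 0 := by exact_mod_cast h1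
  have h2 : Complex.normSq w + 1 ≠ 0 := by rwa [add_comm]
  have h2' : (Complex.normSq w + 1 : ℂ) ≠ 0 := by rwa [add_comm]
  have hinv : (conj w)⁻¹ = w / (Complex.normSq w : ℂ) := by
    have hw' : conj w ≠ 0 := by simpa using hw
    rw [← Complex.mul_conj]
    field_simp
  have hnsq : Complex.normSq (conj w)⁻¹ = (Complex.normSq w)⁻¹ := by
    rw [map_inv₀, Complex.normSq_conj]
  simp only [toKlein_planeChart, flip, hnsq]
  rw [hinv]
  refine Prod.ext ?_ (Prod.ext ?_ ?_)
  · simp only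
    push_cast
    field_simp
    ring
  · simp only
    field_simp
    ring
  · simp only
    push_cast
    field_simp

theorem isConnectedSum_kleinBottle :
    IsConnectedSum kleinBottle realProjectivePlane realProjectivePlane := by
  refine isConnectedSum_of_blowup (b := flip ∘ toKlein) planeChart_embedding (j := toKlein)
    ?_ (flip_embedding.1.comp toKlein_embedding.1 toKlein_embedding.2) ?_ ?_ ?_
  · rw [planeChart_zero]
    exact toKlein_embedding.1
  · rw [planeChart_zero, image_comp, toKlein_embedding.2, flip_embedding.2]
    intro n hn
    by_cases h : n.2.1 = 1
    · exact Or.inr ⟨hn, fun h0 => by simp [h] at h0⟩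
    · exact Or.inl ⟨hn, h⟩
  · exact fun w hw => toKlein_planeChart_inv hw
  -- A point of the line at infinity has height 0, hence height 1 after the flip, and height 1 is
  -- missed by `toKlein`.
  · intro x hx y hy hxy h0
    rw [planeChart_zero] at hx
    apply toKlein_ne_one hx
    have := congrArg (fun n : ℂ × ℝ × ℂ => n.2.1) hxy
    simpa [flip, toKlein_snd, h0] using this

/-! ### Dyck's surface -/

theorem klein_normSq {n : ℂ × ℝ × ℂ} (hn : n ∈ kleinBottle) :
    Complex.normSq n.1 = n.2.1 * (1 - n.2.1) := by
  have := hn.1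
  rw [Complex.mul_conj] at this
  exact_mod_cast this

theorem klein_height {n : ℂ × ℝ × ℂ} (hn : n ∈ kleinBottle) (h1 : n.2.1 ≠ 1) : 0 < 1 - n.2.1 := by
  have := Complex.normSq_nonneg n.1
  rw [klein_normSq hn] at this
  rcases lt_or_gt_of_ne h1 with h | h
  · linarith
  · nlinarith

/-- The squared length of the third side, when those of the first two have sum `1`. -/
def thirdSide (n : ℂ × ℝ × ℂ) : ℝ := 1 + 2 * n.1.re

theorem thirdSide_eq (n : ℂ × ℝ × ℂ) : (thirdSide n : ℂ) = 1 + n.1 + conj n.1 := by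
  rw [thirdSide, add_assoc, Complex.add_conj]
  push_cast
  rfl

theorem thirdSide_nonneg {n : ℂ × ℝ × ℂ} (hn : n ∈ kleinBottle) : 0 ≤ thirdSide n := by
  have h := klein_normSq hn
  rw [Complex.normSq_apply] at h
  rw [thirdSide]
  nlinarith [sq_nonneg (n.2.1 - 1 / 2), sq_nonneg n.1.im]

/-- The point of the Klein bottle over the double point `[1, -1, 0]`. -/
def doublePt : ℂ × ℝ × ℂ := (-1 / 2, 1 / 2, 1)

/-- On the sphere Re ω ≥ -1/2, with equality only at ω = -1/2 and p = 1/2. There ω is nonzero and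
real, which forces u = 1. -/
theorem eq_doublePt {n : ℂ × ℝ × ℂ} (hn : n ∈ kleinBottle) (h : thirdSide n = 0) :
    n = doublePt := by
  have h1 := klein_normSq hn
  rw [Complex.normSq_apply] at h1
  rw [thirdSide] at h
  have hre : n.1.re = -1 / 2 := by linarith
  rw [hre] at h1
  have hsum : (n.2.1 - 1 / 2) ^ 2 + n.1.im ^ 2 = 0 := by linarith
  have hp : n.2.1 = 1 / 2 := by
    have : (n.2.1 - 1 / 2) ^ 2 = 0 := by nlinarith [sq_nonneg (n.2.1 - 1 / 2), sq_nonneg n.1.im]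
    have := pow_eq_zero_iff (two_ne_zero) |>.1 this
    linarith
  have him : n.1.im = 0 := by
    have : n.1.im ^ 2 = 0 := by nlinarith [sq_nonneg (n.2.1 - 1 / 2), sq_nonneg n.1.im]
    exact pow_eq_zero_iff (two_ne_zero) |>.1 this
  have hω : n.1 = -1 / 2 := by
    apply Complex.ext
    · rw [hre]
      norm_num
    · rw [him]
      norm_num
  have hu := hn.2.2
  rw [hω] at hu
  refine Prod.ext hω (Prod.ext hp ?_)
  have hc : conj (-1 / 2 : ℂ) = -1 / 2 := by
    rw [map_div₀, map_neg, map_one, map_ofNat]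
  rw [hc] at hu
  simp only [doublePt]
  linear_combination -2 * hu

theorem thirdSide_ne {n : ℂ × ℝ × ℂ} (hn : n ∈ kleinBottle \ {doublePt}) : thirdSide n ≠ 0 :=
  fun h => hn.2 (eq_doublePt hn.1 h)

/-- The Klein bottle without a point as the surface of similarity classes of triangles with nonzero
third side. -/
def kleinToClass (n : ℂ × ℝ × ℂ) : ClassSpace :=
  (fun i j => (![![(n.2.1 : ℂ), n.1, -(n.2.1 + n.1)],
      ![conj n.1, 1 - n.2.1, -(conj n.1 + (1 - n.2.1))],
      ![-(n.2.1 + conj n.1), -(n.1 + (1 - n.2.1)), (thirdSide n : ℂ)]] :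
        Fin 3 → Fin 3 → ℂ) i j / (1 + thirdSide n : ℝ),
    ![(conj n.2.2 * n.2.1 + 2 * conj n.1 + (1 - n.2.1)) / (thirdSide n : ℂ),
      (n.2.1 + 2 * conj n.1 + conj n.2.2 * (1 - n.2.1)) / (thirdSide n : ℂ), n.2.2])

/-- The inverse of `kleinToClass`. -/
def classToKlein (y : ClassSpace) : ℂ × ℝ × ℂ :=
  (y.1 0 1 / (y.1 0 0 + y.1 1 1), (y.1 0 0 / (y.1 0 0 + y.1 1 1)).re, y.2 2)

/-- Here z = ω/(1 - p) = a/b. The polynomial numerators in `kleinToClass` come from multiplying the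
squared directions by conj(a+b)/conj(a+b) or its conjugate, which leaves |a+b|² as the only
denominator. For instance (b/b̄) conj(a+b)² = ū p + 2ω̄ + (1 - p). They therefore remain valid when
a or b vanishes. -/
theorem kleinToClass_eq_affVec {n : ℂ × ℝ × ℂ} (hn : n ∈ kleinBottle) (hD : thirdSide n ≠ 0)
    (h1 : n.2.1 ≠ 1) : 1 + n.1 / (1 - n.2.1 : ℝ) ≠ 0 ∧
      kleinToClass n = (projMatrix (affVec (n.1 / (1 - n.2.1 : ℝ))),
        affDir (n.1 / (1 - n.2.1 : ℝ)) n.2.2) := by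
  have hD0 := thirdSide_nonneg hn
  have hDeq := thirdSide_eq n
  simp only [kleinToClass]
  generalize thirdSide n = D at hD hD0 hDeq ⊢
  have hq := klein_height hn h1
  obtain ⟨ζ, p, u⟩ := n
  obtain ⟨hζ, hu, huζ⟩ := hn
  dsimp only at *
  have hq' : (1 - p : ℂ) ≠ 0 := by exact_mod_cast hq.ne'
  have hDne : (D : ℂ) ≠ 0 := by exact_mod_cast hD
  have hD1 : (1 + D : ℂ) ≠ 0 := by
    have : (0 : ℝ) < 1 + D := by linarith
    exact_mod_cast this.ne'
  push_cast at *
  have hprod : (1 - p + ζ) * (1 - p + conj ζ) = (1 - p) * D := by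
    rw [hDeq]
    linear_combination hζ
  have hqz : (1 - p + ζ : ℂ) ≠ 0 := fun h => by
    rw [h, zero_mul, eq_comm] at hprod
    exact mul_ne_zero hq' hDne hprod
  have hqz' : (1 - p + conj ζ : ℂ) ≠ 0 := fun h => by
    rw [h, mul_zero, eq_comm] at hprod
    exact mul_ne_zero hq' hDne hprod
  have hcz : conj (ζ / (1 - p : ℂ)) = conj ζ / (1 - p) := by
    rw [map_div₀, map_sub, map_one, Complex.conj_ofReal]
  have h1z : 1 + ζ / (1 - p : ℂ) = (1 - p + ζ) / (1 - p) := by field_simp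
  have h1z' : 1 + conj ζ / (1 - p : ℂ) = (1 - p + conj ζ) / (1 - p) := by field_simp
  have hu' : conj u * ζ = conj ζ := by simpa using congrArg conj huζ
  have hnsq : nsq (affVec (ζ / (1 - p : ℂ))) = (1 + D) / (1 - p) := by
    simp only [nsq, Fin.sum_univ_three, affVec, Matrix.cons_val, map_sub, map_neg, map_one, hcz]
    rw [hDeq]
    field_simp
    linear_combination 2 * hζ
  refine ⟨?_, Prod.ext ?_ ?_⟩
  · rw [h1z]
    exact div_ne_zero hqz hq'
  · funext i j
    simp only [projMatrix_apply, hnsq]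
    fin_cases i <;> fin_cases j <;>
      simp only [affVec, Fin.zero_eta, Fin.mk_one, Fin.reduceFinMk, Matrix.cons_val, map_sub,
        map_neg, map_one, hcz] <;> field_simp
    · linear_combination -hζ
    · linear_combination hζ
    · ring
    · linear_combination hζ
    · ring
    · rw [hDeq]
      linear_combination -hζ
  · funext i
    fin_cases i <;>
      simp only [affDir, Fin.zero_eta, Fin.mk_one, Fin.reduceFinMk, Matrix.cons_val, hcz]
    · rw [h1z, h1z', div_div_div_cancel_right₀ hq', div_eq_div_iff hDne hqz, hDeq]
      linear_combination (p + conj ζ) * hu' - conj u * hζ + hζ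
    · rw [h1z, h1z', div_div_div_cancel_right₀ hq', div_mul_eq_mul_div,
        div_eq_div_iff hDne hqz', hDeq]
      linear_combination (-(1 - p) - 1 - ζ - 2 * conj ζ) * hu' - hζ + conj u * hζ

theorem kleinToClass_mem {n : ℂ × ℝ × ℂ} (hn : n ∈ kleinBottle) (hD : thirdSide n ≠ 0) :
    kleinToClass n ∈ classVariety := by
  -- At p = 1 the second side is zero, so the ratio a/b is unavailable; the class [1, 0, -1] is
  -- treated directly.
  by_cases h1 : n.2.1 = 1
  · have hω : n.1 = 0 := by
      have := klein_normSq hn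
      rw [h1, sub_self, mul_zero] at this
      exact Complex.normSq_eq_zero.1 this
    have hu := hn.2.1
    have hr : (![1, 0, -1] : Fin 3 → ℂ) ∈ X := by simp [mem_X]
    have hr0 : (![1, 0, -1] : Fin 3 → ℂ) ≠ 0 := fun h => by simpa using congrFun h 0
    have hT : thirdSide n = 1 := by simp [thirdSide, hω]
    have heq : kleinToClass n = (projMatrix ![1, 0, -1], ![conj n.2.2, 1, n.2.2]) := by
      refine Prod.ext ?_ ?_
      · funext i j
        simp only [projMatrix_apply, nsq, Fin.sum_univ_three, kleinToClass, hT, h1, hω]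
        fin_cases i <;> fin_cases j <;> simp
      · simp only [kleinToClass, hT, h1, hω]
        funext i
        fin_cases i <;> simp
    rw [heq]
    refine mk_mem_classVariety hr hr0 ⟨fun i => ?_, ?_, ?_, ?_, ?_⟩
    · fin_cases i
      · simpa [mul_comm] using hu
      · simp
      · exact hu
    · simpa [mul_comm] using hu
    · simp
    · simp
    · simp
  · obtain ⟨h, heq⟩ := kleinToClass_eq_affVec hn hD h1
    rw [heq]
    refine mk_mem_classVariety (affVec_mem _) (affVec_ne _) (directions_affVec hn.2.1 ?_ h)
    rw [map_div₀, Complex.conj_ofReal, ← mul_div_assoc, hn.2.2]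

theorem one_add_thirdSide_ne {n : ℂ × ℝ × ℂ} (hn : n ∈ kleinBottle) :
    (1 + thirdSide n : ℂ) ≠ 0 := by
  have : 0 < 1 + thirdSide n := by linarith [thirdSide_nonneg hn]
  exact_mod_cast this.ne'

theorem classToKlein_kleinToClass {n : ℂ × ℝ × ℂ} (hn : n ∈ kleinBottle) :
    classToKlein (kleinToClass n) = n := by
  have hD := one_add_thirdSide_ne hn
  have hS : (kleinToClass n).1 0 0 + (kleinToClass n).1 1 1 = 1 / (1 + thirdSide n) := by
    simp [kleinToClass, ← add_div]
  refine Prod.ext ?_ (Prod.ext ?_ ?_)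
  · simp only [classToKlein, hS]
    simp only [kleinToClass, Matrix.cons_val]
    push_cast
    field_simp
  · simp only [classToKlein, hS]
    simp only [kleinToClass, Matrix.cons_val]
    push_cast
    rw [div_div_div_cancel_right₀ hD, div_one, Complex.ofReal_re]
  · simp [classToKlein, kleinToClass]

/-- The first two sides cannot both vanish, so m₀ + m₁ > 0. This sum is the denominator in
`classToKlein`, by which |a|² + |b|² is normalized to 1. -/
theorem exists_diagonal {y : ClassSpace} (hy : y ∈ classVariety) :
    ∃ m₀ m₁ : ℝ, y.1 0 0 = m₀ ∧ y.1 1 1 = m₁ ∧ 0 ≤ m₁ ∧ 0 < m₀ + m₁ := by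
  obtain ⟨r, hr, h0, hM, -⟩ := exists_vector hy
  have hN : 0 < ∑ k, Complex.normSq (r k) := by
    have h1 := nsq_ne_zero h0
    rw [nsq_eq] at h1
    exact lt_of_le_of_ne (Finset.sum_nonneg fun k _ => Complex.normSq_nonneg _)
      fun h => h1 (by rw [← h, Complex.ofReal_zero])
  have hd : ∀ i, y.1 i i = ((Complex.normSq (r i) / ∑ k, Complex.normSq (r k) : ℝ) : ℂ) := by
    intro i
    rw [hM, projMatrix_apply, Complex.mul_conj, nsq_eq, Complex.ofReal_div]
  refine ⟨_, _, hd 0, hd 1, by have := Complex.normSq_nonneg (r 1); positivity, ?_⟩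
  rw [← add_div]
  refine div_pos ?_ hN
  by_cases h : r 0 = 0
  · exact add_pos_of_nonneg_of_pos (Complex.normSq_nonneg _)
      (Complex.normSq_pos.2 (ne_zero_of_mem_X hr h0 (by decide) h))
  · exact add_pos_of_pos_of_nonneg (Complex.normSq_pos.2 h) (Complex.normSq_nonneg _)

theorem classToKlein_mem {y : ClassSpace} (hy : y ∈ classVariety) (h2 : y.1 2 2 ≠ 0) :
    classToKlein y ∈ kleinBottle ∧ (1 + thirdSide (classToKlein y) : ℂ) * (y.1 0 0 + y.1 1 1) = 1 ∧
      ((classToKlein y).2.1 : ℂ) * (y.1 0 0 + y.1 1 1) = y.1 0 0 ∧ thirdSide (classToKlein y) ≠ 0 := by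
  obtain ⟨m₀, m₁, h0, h1, -, hpos⟩ := exists_diagonal hy
  obtain ⟨hconj, hrank, htr, hcol, hunit, -, -, -, hu2⟩ := hy
  have hS : (m₀ + m₁ : ℂ) ≠ 0 := by exact_mod_cast hpos.ne'
  have hp : (classToKlein y).2.1 = m₀ / (m₀ + m₁) := by
    simp only [classToKlein]
    rw [h0, h1]
    norm_cast
  have hcS : conj (m₀ + m₁ : ℂ) = m₀ + m₁ := by
    rw [map_add, Complex.conj_ofReal, Complex.conj_ofReal]
  have hω : (classToKlein y).1 = y.1 0 1 / (m₀ + m₁) := by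
    simp only [classToKlein]
    rw [h0, h1]
  have hω' : conj (classToKlein y).1 = y.1 1 0 / (m₀ + m₁) := by
    rw [hω, map_div₀, hcS, hconj]
  have h3 : (1 + thirdSide (classToKlein y) : ℂ) * (m₀ + m₁) = 1 := by
    rw [thirdSide_eq, hω', hω]
    field_simp
    have e0 := hcol 0
    have e1 := hcol 1
    have e2 := hcol 2
    rw [Fin.sum_univ_three] at htr e0 e1 e2
    have hsw : y.1 0 2 + y.1 1 2 = y.1 2 0 + y.1 2 1 := by
      have t1 := hcol 2
      rw [Fin.sum_univ_three] at t1
      have t2 := congrArg conj t1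
      simp only [map_add, hconj, map_zero] at t2
      linear_combination t1 - t2
    rw [h0, h1] at *
    linear_combination htr - e2 + hsw + e0 + e1
  have h3' : (thirdSide (classToKlein y) : ℂ) * (m₀ + m₁) = y.1 2 2 := by
    rw [Fin.sum_univ_three, h0, h1] at htr
    linear_combination h3 - htr
  refine ⟨⟨?_, hunit 2, ?_⟩, ?_, ?_, ?_⟩
  · rw [hω', hω, hp, div_mul_div_comm, hrank, h0, h1]
    push_cast
    field_simp
    ring
  · rw [hω', hω, ← mul_div_assoc]
    congr 1
  · rw [h0, h1, h3]
  · rw [hp, h0, h1]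
    push_cast
    field_simp
  · intro h
    rw [h, Complex.ofReal_zero, zero_mul] at h3'
    exact h2 h3'.symm

/-- When the third side is nonzero, one of the other two is nonzero as well and fixes one more
squared direction; the product relation fixes the last. -/
theorem classVariety_ext {y y' : ClassSpace} (hy : y ∈ classVariety) (hy' : y' ∈ classVariety)
    (hM : y.1 = y'.1) (hu : y.2 2 = y'.2 2) (h2 : y.1 2 2 ≠ 0) : y = y' := by
  obtain ⟨hconj, -, -, hcol, hunit, hprod, hz, ho, -⟩ := hy
  obtain ⟨-, -, -, -, hunit', hprod', hz', ho', -⟩ := hy'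
  rw [← hM] at hz' ho'
  have hu2 := ne_zero_of_mul_conj_eq_one (hunit 2)
  have key : y.2 0 = y'.2 0 ∧ y.2 1 = y'.2 1 := by
    by_cases h : y.1 2 1 = 0
    · have h02 : y.1 0 2 ≠ 0 := by
        intro h02
        have h12 : y.1 1 2 = 0 := by
          rw [← hconj, h, map_zero]
        have := hcol 2
        rw [Fin.sum_univ_three, h02, h12, zero_add, zero_add] at this
        exact h2 this
      have e1 : y.2 1 = y'.2 1 := mul_right_cancel₀ h02 (ho.trans ho'.symm)
      refine ⟨mul_right_cancel₀ (ne_zero_of_mul_conj_eq_one (hunit 1)) (mul_right_cancel₀ hu2 ?_), e1⟩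
      rw [hprod, e1, hu, hprod']
    · have e0 : y.2 0 = y'.2 0 := mul_right_cancel₀ h (hz.trans hz'.symm)
      refine ⟨e0, mul_left_cancel₀ (ne_zero_of_mul_conj_eq_one (hunit 0)) (mul_right_cancel₀ hu2 ?_)⟩
      rw [hprod, e0, hu, hprod']
  refine Prod.ext hM (funext fun i => ?_)
  fin_cases i
  · exact key.1
  · exact key.2
  · exact hu

theorem kleinToClass_classToKlein {y : ClassSpace} (hy : y ∈ classVariety) (h2 : y.1 2 2 ≠ 0) :
    kleinToClass (classToKlein y) = y := by
  obtain ⟨hn, hS, hp, hD⟩ := classToKlein_mem hy h2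
  refine (classVariety_ext hy (kleinToClass_mem hn hD) ?_ rfl h2).symm
  obtain ⟨m₀, m₁, h0, h1, -, hpos⟩ := exists_diagonal hy
  have hS0 : y.1 0 0 + y.1 1 1 ≠ 0 := by
    rw [h0, h1]
    exact_mod_cast hpos.ne'
  have hω : (classToKlein y).1 * (y.1 0 0 + y.1 1 1) = y.1 0 1 := div_mul_cancel₀ _ hS0
  obtain ⟨hconj, -, htr, hcol, -, -, -, -, -⟩ := hy
  have hω' : conj (classToKlein y).1 * (y.1 0 0 + y.1 1 1) = y.1 1 0 := by
    rw [← hconj 0 1, ← hω, map_mul, map_add, hconj, hconj]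
  have hden : ((1 + thirdSide (classToKlein y) : ℝ) : ℂ) = 1 / (y.1 0 0 + y.1 1 1) := by
    push_cast
    rw [eq_div_iff hS0, hS]
  have hrow : ∀ i, y.1 i 0 + y.1 i 1 + y.1 i 2 = 0 := by
    intro i
    have t1 := hcol i
    rw [Fin.sum_univ_three] at t1
    have t2 := congrArg conj t1
    simpa only [map_add, hconj, map_zero] using t2
  have e0 := hcol 0
  have e1 := hcol 1
  rw [Fin.sum_univ_three] at htr e0 e1
  have hD' : (thirdSide (classToKlein y) : ℂ) * (y.1 0 0 + y.1 1 1) = y.1 2 2 := by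
    linear_combination hS - htr
  funext i j
  simp only [kleinToClass, hden, div_div_eq_mul_div, div_one]
  fin_cases i <;> fin_cases j <;>
    simp only [Fin.zero_eta, Fin.mk_one, Fin.reduceFinMk, Matrix.cons_val]
  · exact hp.symm
  · exact hω.symm
  · linear_combination hrow 0 + hp + hω
  · exact hω'.symm
  · linear_combination hp
  · linear_combination hrow 1 + hω' - hp
  · linear_combination e0 + hp + hω'
  · linear_combination e1 + hω - hp
  · exact hD'.symm

theorem smooth_kleinToClass : ContDiffOn ℝ ∞ kleinToClass (kleinBottle \ {doublePt}) := by
  have hω : ContDiffOn ℝ ∞ (fun n : ℂ × ℝ × ℂ => n.1) (kleinBottle \ {doublePt}) :=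
    contDiff_fst.contDiffOn
  have hω' := smooth_conj hω
  have hp : ContDiffOn ℝ ∞ (fun n : ℂ × ℝ × ℂ => (n.2.1 : ℂ)) (kleinBottle \ {doublePt}) :=
    smooth_ofReal (contDiff_fst.comp contDiff_snd).contDiffOn
  have hu : ContDiffOn ℝ ∞ (fun n : ℂ × ℝ × ℂ => n.2.2) (kleinBottle \ {doublePt}) :=
    (contDiff_snd.comp contDiff_snd).contDiffOn
  have hu' := smooth_conj hu
  have hq : ContDiffOn ℝ ∞ (fun n : ℂ × ℝ × ℂ => (1 - n.2.1 : ℂ)) (kleinBottle \ {doublePt}) :=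
    contDiffOn_const.sub hp
  have hD : ContDiffOn ℝ ∞ thirdSide (kleinBottle \ {doublePt}) :=
    contDiffOn_const.add (contDiffOn_const.mul (smooth_re hω))
  have hD' := smooth_ofReal hD
  have h1 : ContDiffOn ℝ ∞ (fun n => ((1 + thirdSide n : ℝ) : ℂ)) (kleinBottle \ {doublePt}) :=
    smooth_ofReal (contDiffOn_const.add hD)
  have h2ω : ContDiffOn ℝ ∞ (fun n : ℂ × ℝ × ℂ => 2 * conj n.1) (kleinBottle \ {doublePt}) :=
    contDiffOn_const.mul hω'
  have hne : ∀ n ∈ kleinBottle \ {doublePt}, (thirdSide n : ℂ) ≠ 0 := fun n hn => by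
    exact_mod_cast thirdSide_ne hn
  refine ContDiffOn.prodMk ?_ (smooth_vec3 ?_ ?_ hu)
  · have hM := smooth_vec3 (smooth_vec3 hp hω (hp.add hω).neg)
      (smooth_vec3 hω' hq (hω'.add hq).neg)
      (smooth_vec3 (hp.add hω').neg (hω.add hq).neg hD')
    refine contDiffOn_pi.2 fun i => contDiffOn_pi.2 fun j => smooth_div
      (contDiffOn_pi.1 (contDiffOn_pi.1 hM i) j) h1 fun n hn => ?_
    have := one_add_thirdSide_ne hn.1
    exact_mod_cast this
  · exact smooth_div (((hu'.mul hp).add h2ω).add hq) hD' hne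
  · exact smooth_div ((hp.add h2ω).add (hu'.mul hq)) hD' hne

theorem smooth_entry (i j : Fin 3) {s : Set ClassSpace} :
    ContDiffOn ℝ ∞ (fun y : ClassSpace => y.1 i j) s :=
  ((contDiff_apply_apply ℝ ℂ i j).comp contDiff_fst).contDiffOn

theorem smooth_dir (i : Fin 3) {s : Set ClassSpace} :
    ContDiffOn ℝ ∞ (fun y : ClassSpace => y.2 i) s :=
  ((contDiff_apply ℝ ℂ i).comp contDiff_snd).contDiffOn

theorem kleinToClass_embedding :
    IsOpenSmoothEmbedding kleinToClass (kleinBottle \ {doublePt}) classVariety ∧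
      kleinToClass '' (kleinBottle \ {doublePt}) = classVariety ∩ {y | y.1 2 2 ≠ 0} := by
  refine IsOpenSmoothEmbedding.of_inverse (g := classToKlein) ?_ smooth_kleinToClass ?_ ?_ ?_ ?_ ?_
  · have : Continuous fun y : ClassSpace => y.1 2 2 := by fun_prop
    exact isOpen_ne.preimage this
  · have hne : ∀ y ∈ classVariety ∩ {y | y.1 2 2 ≠ 0}, y.1 0 0 + y.1 1 1 ≠ 0 := by
      rintro y ⟨hy, -⟩
      obtain ⟨m₀, m₁, h0, h1, -, hpos⟩ := exists_diagonal hy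
      rw [h0, h1]
      exact_mod_cast hpos.ne'
    have hS := (smooth_entry 0 0 (s := classVariety ∩ {y | y.1 2 2 ≠ 0})).add (smooth_entry 1 1)
    exact (smooth_div (smooth_entry 0 1) hS hne).prodMk
      ((smooth_re (smooth_div (smooth_entry 0 0) hS hne)).prodMk (smooth_dir 2))
  · intro n hn
    refine ⟨kleinToClass_mem hn.1 (thirdSide_ne hn), ?_⟩
    have h1 := one_add_thirdSide_ne hn.1
    have h2 := thirdSide_ne hn
    simp only [kleinToClass, mem_ofPred_eq, Matrix.cons_val]
    refine div_ne_zero (by exact_mod_cast h2) ?_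
    exact_mod_cast h1
  · rintro y ⟨hy, h2⟩
    obtain ⟨hn, -, -, hD⟩ := classToKlein_mem hy h2
    refine ⟨hn, fun h => hD ?_⟩
    rw [mem_singleton_iff.1 h]
    simp [thirdSide, doublePt]
    norm_num
  · exact fun n hn => classToKlein_kleinToClass hn.1
  · exact fun y hy => kleinToClass_classToKlein hy.1 hy.2

/-! ### The disc of the Klein bottle around the third double point -/

theorem normSq_div_real (a : ℂ) (r : ℝ) : Complex.normSq (a / r) = Complex.normSq a / r ^ 2 := by
  rw [map_div₀, Complex.normSq_ofReal, sq]

/-- A diffeomorphism of the plane onto the disc with center `-1` and radius `1 / 2`. -/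
def doubleDisc (y : ℂ) : ℂ := -1 + y / (2 * √(1 + Complex.normSq y) : ℝ)

theorem normSq_contract (y : ℂ) : 4 * Complex.normSq (y / (2 * √(1 + Complex.normSq y) : ℝ)) =
    Complex.normSq y / (1 + Complex.normSq y) := by
  rw [normSq_div_real, mul_pow, Real.sq_sqrt (one_add_normSq_pos y).le]
  have := (one_add_normSq_pos y).ne'
  field_simp
  norm_num
  ring

theorem doubleDisc_embedding : IsOpenSmoothEmbedding doubleDisc univ univ ∧
    doubleDisc '' univ = univ ∩ {z | 4 * Complex.normSq (z + 1) < 1} := by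
  refine IsOpenSmoothEmbedding.of_inverse
    (g := fun z => 2 * (z + 1) / (√(1 - 4 * Complex.normSq (z + 1)) : ℝ)) ?_ ?_ ?_ ?_ ?_ ?_ ?_
  · have : Continuous fun z : ℂ => 4 * Complex.normSq (z + 1) := by fun_prop
    exact isOpen_Iio.preimage this
  · have hid : ContDiffOn ℝ ∞ (fun y : ℂ => y) univ := contDiffOn_id
    have hs : ContDiffOn ℝ ∞ (fun y : ℂ => √(1 + Complex.normSq y)) univ :=
      (contDiffOn_const.add (smooth_normSq hid)).sqrt fun y _ => (one_add_normSq_pos y).ne'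
    refine contDiffOn_const.add (smooth_div hid (smooth_ofReal (contDiffOn_const.mul hs)) ?_)
    intro y _
    have := (Real.sqrt_pos.2 (one_add_normSq_pos y)).ne'
    exact_mod_cast mul_ne_zero two_ne_zero this
  · have hη : ContDiffOn ℝ ∞ (fun z : ℂ => z + 1) (univ ∩ {z | 4 * Complex.normSq (z + 1) < 1}) :=
      contDiffOn_id.add contDiffOn_const
    have hpos : ∀ z ∈ univ ∩ {z : ℂ | 4 * Complex.normSq (z + 1) < 1},
        0 < 1 - 4 * Complex.normSq (z + 1) := fun z hz => sub_pos.2 hz.2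
    refine smooth_div (contDiffOn_const.mul hη) (smooth_ofReal ((contDiffOn_const.sub
      (contDiffOn_const.mul (smooth_normSq hη))).sqrt fun z hz => (hpos z hz).ne')) ?_
    intro z hz
    exact_mod_cast (Real.sqrt_pos.2 (hpos z hz)).ne'
  · intro y _
    refine ⟨trivial, ?_⟩
    simp only [mem_ofPred_eq, doubleDisc, neg_add_cancel_comm, normSq_contract]
    rw [div_lt_one (one_add_normSq_pos y)]
    linarith
  · exact fun _ _ => trivial
  · intro y _
    have h := one_add_normSq_pos y
    have hs := (Real.sqrt_pos.2 h).ne'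
    simp only [doubleDisc, neg_add_cancel_comm, normSq_contract]
    have e : 1 - Complex.normSq y / (1 + Complex.normSq y) = (1 + Complex.normSq y)⁻¹ := by
      field_simp
      ring
    rw [e, Real.sqrt_inv]
    have hs' : (√(1 + Complex.normSq y) : ℂ) ≠ 0 := by exact_mod_cast hs
    push_cast
    field_simp
  · rintro z ⟨-, hz⟩
    simp only [mem_ofPred_eq] at hz
    have h : 0 < 1 - 4 * Complex.normSq (z + 1) := by linarith
    have h' := h.ne'
    have hs := (Real.sqrt_pos.2 h).ne'
    have e : 1 + Complex.normSq (2 * (z + 1) / (√(1 - 4 * Complex.normSq (z + 1)) : ℝ)) =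
        (1 - 4 * Complex.normSq (z + 1))⁻¹ := by
      rw [normSq_div_real, Real.sq_sqrt h.le, map_mul, Complex.normSq_ofNat]
      refine eq_inv_of_mul_eq_one_left ?_
      rw [add_mul, div_mul_cancel₀ _ h']
      ring
    simp only [doubleDisc]
    rw [e, Real.sqrt_inv]
    have hs' : (√(1 - 4 * Complex.normSq (z + 1)) : ℂ) ≠ 0 := by exact_mod_cast hs
    push_cast
    field_simp
    ring

/-- The radius 1/2 keeps the disc around z = -1 away from z = 0, the double point already blown up.
-/
theorem ne_zero_of_normSq_add_one {z : ℂ} (h : 4 * Complex.normSq (z + 1) < 1) : z ≠ 0 := by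
  rintro rfl
  norm_num at h

theorem planeChart_mem_diff {z : ℂ} (hz : z ≠ 0) : planeChart z ∈ realProjectivePlane \ {pole} := by
  refine ⟨planeChart_mem z, fun h => hz ?_⟩
  rw [mem_singleton_iff, ← planeChart_zero] at h
  exact planeChart_embedding.injOn trivial trivial h

/-- The chart of the Klein bottle by the ratio `z` of two sides. -/
def ratioChart (z : ℂ) : ℂ × ℝ × ℂ := flip (toKlein (planeChart z))

theorem ratioChart_eq (z : ℂ) : ratioChart z = (z / (1 + Complex.normSq z : ℝ),
    1 - (1 + Complex.normSq z)⁻¹, z ^ 2 / (Complex.normSq z : ℝ)) := by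
  rw [ratioChart, toKlein_planeChart, flip]

theorem ratioChart_mem {z : ℂ} (hz : z ≠ 0) : ratioChart z ∈ kleinBottle := by
  refine flip_mem ?_
  have := mem_image_of_mem toKlein (planeChart_mem_diff hz)
  rw [toKlein_embedding.2] at this
  exact this.1

theorem ratioChart_div (z : ℂ) :
    (ratioChart z).1 / (1 - (ratioChart z).2.1 : ℝ) = z := by
  have h : (1 + Complex.normSq z : ℂ) ≠ 0 := by exact_mod_cast (one_add_normSq_pos z).ne'
  rw [ratioChart_eq]
  simp only [sub_sub_cancel]
  push_cast
  field_simp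

theorem div_conj_eq (z : ℂ) : z / conj z = z ^ 2 / (Complex.normSq z : ℝ) := by
  by_cases hz : z = 0
  · simp [hz]
  have hz' : conj z ≠ 0 := by simpa using hz
  rw [← Complex.mul_conj]
  field_simp

theorem ratioChart_of_klein {n : ℂ × ℝ × ℂ} (hn : n ∈ kleinBottle) (h1 : n.2.1 ≠ 1)
    (h0 : n.1 ≠ 0) : ratioChart (n.1 / (1 - n.2.1 : ℝ)) = n := by
  have hq := (klein_height hn h1).ne'
  have hq' : (1 - n.2.1 : ℂ) ≠ 0 := by exact_mod_cast hq
  have hN : 1 + Complex.normSq (n.1 / (1 - n.2.1 : ℝ)) = (1 - n.2.1)⁻¹ := by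
    rw [normSq_div_real, klein_normSq hn]
    field_simp
    ring
  rw [ratioChart_eq, hN, ← div_conj_eq]
  refine Prod.ext ?_ (Prod.ext ?_ ?_)
  · simp only
    push_cast
    field_simp
  · simp
  · have h0' : conj n.1 ≠ 0 := by simpa using h0
    simp only [map_div₀, Complex.conj_ofReal]
    push_cast
    rw [div_div_div_cancel_right₀ hq', div_eq_iff h0', hn.2.2]

/-- The inequality 4|z + 1|² < 1 is multiplied by (1 - p)², which gives an open condition on all of
the ambient space and excludes p = 1 by itself. -/
theorem ratioChart_embedding : IsOpenSmoothEmbedding ratioChart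
    (univ ∩ {z : ℂ | 4 * Complex.normSq (z + 1) < 1}) kleinBottle := by
  have hne : ∀ n ∈ kleinBottle ∩
      {n : ℂ × ℝ × ℂ | 4 * Complex.normSq (n.1 + (1 - n.2.1 : ℝ)) < (1 - n.2.1) ^ 2},
      n.2.1 ≠ 1 ∧ 4 * Complex.normSq (n.1 / (1 - n.2.1 : ℝ) + 1) < 1 := by
    rintro n ⟨hn, hO⟩
    have h1 : n.2.1 ≠ 1 := by
      intro h1
      simp only [mem_ofPred_eq, h1] at hO
      have := Complex.normSq_nonneg (n.1 + (1 - 1 : ℝ))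
      norm_num at hO this
      linarith
    refine ⟨h1, ?_⟩
    have hq : 1 - n.2.1 ≠ 0 := (klein_height hn h1).ne'
    have hq' : ((1 - n.2.1 : ℝ) : ℂ) ≠ 0 := by exact_mod_cast hq
    have e : n.1 / (1 - n.2.1 : ℝ) + 1 = (n.1 + (1 - n.2.1 : ℝ)) / (1 - n.2.1 : ℝ) := by
      field_simp
    rw [e, normSq_div_real, ← mul_div_assoc, div_lt_one (pow_pos (klein_height hn h1) 2)]
    exact hO
  refine (IsOpenSmoothEmbedding.of_inverse (g := fun n : ℂ × ℝ × ℂ => n.1 / (1 - n.2.1 : ℝ))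
    (O := {n : ℂ × ℝ × ℂ | 4 * Complex.normSq (n.1 + (1 - n.2.1 : ℝ)) < (1 - n.2.1) ^ 2})
    ?_ ?_ ?_ ?_ ?_ (fun z _ => ratioChart_div z) ?_).1
  · exact isOpen_lt (by fun_prop) (by fun_prop)
  · refine smooth_flip.comp (smooth_toKlein.comp
      (planeChart_embedding.smooth.mono (subset_univ _)) ?_) (mapsTo_univ _ _)
    exact fun z hz => planeChart_mem_diff (ne_zero_of_normSq_add_one hz.2)
  · refine smooth_div contDiff_fst.contDiffOn (smooth_ofReal (contDiffOn_const.sub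
      (contDiff_fst.comp contDiff_snd).contDiffOn)) fun n hn => ?_
    exact_mod_cast (klein_height hn.1 (hne n hn).1).ne'
  · rintro z ⟨-, hz⟩
    refine ⟨ratioChart_mem (ne_zero_of_normSq_add_one hz), ?_⟩
    have h := one_add_normSq_pos z
    have h' : (1 + Complex.normSq z : ℂ) ≠ 0 := by exact_mod_cast h.ne'
    simp only [mem_ofPred_eq, ratioChart_eq, sub_sub_cancel]
    have e : z / (1 + Complex.normSq z : ℝ) + ((1 + Complex.normSq z)⁻¹ : ℝ) =
        (z + 1) / (1 + Complex.normSq z : ℝ) := by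
      push_cast
      field_simp
    rw [e, normSq_div_real, inv_pow, ← mul_div_assoc, ← one_div,
      div_lt_div_iff_of_pos_right (pow_pos h 2)]
    exact hz
  · exact fun n hn => ⟨trivial, (hne n hn).2⟩
  · intro n hn
    obtain ⟨h1, hz⟩ := hne n hn
    refine ratioChart_of_klein hn.1 h1 fun h0 => ne_zero_of_normSq_add_one hz ?_
    simp [h0]

/-- The disc of the Klein bottle around `doublePt`. -/
def kleinDisc : ℂ → ℂ × ℝ × ℂ := ratioChart ∘ doubleDisc

theorem kleinDisc_embedding : IsOpenSmoothEmbedding kleinDisc univ kleinBottle :=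
  ratioChart_embedding.comp doubleDisc_embedding.1 doubleDisc_embedding.2

theorem kleinDisc_zero : kleinDisc 0 = doublePt := by
  simp only [kleinDisc, Function.comp, doubleDisc, zero_div, add_zero, ratioChart_eq, doublePt]
  norm_num

/-! ### The band around the exceptional circle of the third double point -/

/-- The shape parameter `z` in the neighborhood of the exceptional circle over `[1, -1, 0]`. -/
def bandRatio (n : ℂ × ℝ × ℂ) : ℂ := -1 + n.1 / (2 * √(1 - n.2.1) : ℝ)

/-- The neighborhood of the exceptional circle over the double point `[1, -1, 0]`. -/
def bandToClass (n : ℂ × ℝ × ℂ) : ClassSpace :=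
  (projMatrix (affVec (bandRatio n)),
    ![conj n.2.2, n.2.2 * conj (bandRatio n) / bandRatio n, bandRatio n / conj (bandRatio n)])

/-- The inverse of `bandToClass`. -/
def classToBand (y : ClassSpace) : ℂ × ℝ × ℂ :=
  (2 * (y.1 0 1 / y.1 1 1 + 1) * (√(1 - 4 * Complex.normSq (y.1 0 1 / y.1 1 1 + 1)) : ℝ),
    4 * Complex.normSq (y.1 0 1 / y.1 1 1 + 1), conj (y.2 0))

theorem bandRatio_add_one (n : ℂ × ℝ × ℂ) :
    bandRatio n + 1 = n.1 / (2 * √(1 - n.2.1) : ℝ) := by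
  rw [bandRatio, neg_add_cancel_comm]

theorem normSq_bandRatio {n : ℂ × ℝ × ℂ} (hn : n ∈ kleinBottle) (h1 : n.2.1 ≠ 1) :
    4 * Complex.normSq (bandRatio n + 1) = n.2.1 := by
  have hq := klein_height hn h1
  have := hq.ne'
  rw [bandRatio_add_one, normSq_div_real, mul_pow, Real.sq_sqrt hq.le, klein_normSq hn]
  field_simp
  norm_num
  ring

theorem bandRatio_ne {n : ℂ × ℝ × ℂ} (hn : n ∈ kleinBottle) (h1 : n.2.1 ≠ 1) :
    bandRatio n ≠ 0 := by
  refine ne_zero_of_normSq_add_one ?_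
  rw [normSq_bandRatio hn h1]
  linarith [klein_height hn h1]

/-- The number 1 + z is a positive multiple of ω, so u is a squared direction for it. The ratio of
the third side to the second is -(1 + z), hence u_0 = ū; this remains a free choice when 1 + z = 0.
-/
theorem directions_band {n : ℂ × ℝ × ℂ} (hn : n ∈ kleinBottle) (h1 : n.2.1 ≠ 1) :
    Directions (affVec (bandRatio n)) (bandToClass n).2 := by
  have hz := bandRatio_ne hn h1
  have hz' : conj (bandRatio n) ≠ 0 := by simpa using hz
  have hu := hn.2.1
  have hη : n.2.2 * conj (bandRatio n + 1) = bandRatio n + 1 := by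
    rw [bandRatio_add_one, map_div₀, Complex.conj_ofReal, ← mul_div_assoc, hn.2.2]
  have hη' := congrArg conj hη
  rw [map_mul, Complex.conj_conj] at hη'
  simp only [bandToClass]
  generalize bandRatio n = z at *
  generalize n.2.2 = u at *
  rw [map_add, map_one] at hη hη'
  refine ⟨fun i => ?_, ?_, ?_, ?_, ?_⟩
  · fin_cases i
    · simpa [mul_comm] using hu
    · simp only [Fin.mk_one, Matrix.cons_val, map_div₀, map_mul, Complex.conj_conj]
      field_simp
      exact hu
    · simp only [Fin.reduceFinMk, Matrix.cons_val, map_div₀, Complex.conj_conj]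
      field_simp
  · simp only [Matrix.cons_val]
    field_simp
    linear_combination hu
  · simp only [affVec, Matrix.cons_val, map_sub, map_neg, map_one]
    linear_combination -hη'
  · simp only [affVec, Matrix.cons_val, map_sub, map_neg, map_one]
    field_simp
    linear_combination -hη
  · simp only [affVec, Matrix.cons_val, map_one]
    field_simp

/-- With p = 4|1 + z|², the factor √(1 - p) is what puts ω = 2(1 + z)√(1 - p) on the sphere |ω|² =
p(1 - p). -/
theorem classToBand_spec {y : ClassSpace} (hy : y ∈ classVariety)
    (hO : 4 * Complex.normSq (y.1 0 1 + y.1 1 1) < Complex.normSq (y.1 1 1)) :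
    y.1 1 1 ≠ 0 ∧ 4 * Complex.normSq (y.1 0 1 / y.1 1 1 + 1) < 1 ∧
      classToBand y ∈ kleinBottle ∧ bandRatio (classToBand y) = y.1 0 1 / y.1 1 1 := by
  have h1 : y.1 1 1 ≠ 0 := by
    intro h
    rw [h, map_zero] at hO
    linarith [Complex.normSq_nonneg (y.1 0 1 + 0)]
  have hlt : 4 * Complex.normSq (y.1 0 1 / y.1 1 1 + 1) < 1 := by
    have e : y.1 0 1 / y.1 1 1 + 1 = (y.1 0 1 + y.1 1 1) / y.1 1 1 := by field_simp
    rw [e, map_div₀, ← mul_div_assoc, div_lt_one (Complex.normSq_pos.2 h1)]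
    exact hO
  obtain ⟨-, hd⟩ := exists_affVec hy h1
  have h0 := hd.zero
  have hu0 := hd.unit 0
  simp only [affVec, Matrix.cons_val, map_sub, map_neg, map_one] at h0
  refine ⟨h1, hlt, ?_⟩
  simp only [classToBand, bandRatio]
  generalize y.1 0 1 / y.1 1 1 = z at *
  have hq : 0 < 1 - 4 * Complex.normSq (z + 1) := by linarith
  have hs := Real.sq_sqrt hq.le
  have hs0 := (Real.sqrt_pos.2 hq).ne'
  generalize √(1 - 4 * Complex.normSq (z + 1)) = s at *
  have hs0' : (s : ℂ) ≠ 0 := by exact_mod_cast hs0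
  refine ⟨⟨?_, ?_, ?_⟩, ?_⟩
  · simp only
    rw [Complex.mul_conj, map_mul, map_mul, Complex.normSq_ofReal, Complex.normSq_ofNat, ← hs]
    push_cast
    ring
  · simp only [Complex.conj_conj]
    rw [mul_comm, hu0]
  · have h0' := congrArg conj h0
    simp only [map_mul, map_sub, map_neg, map_one, Complex.conj_conj] at h0'
    simp only [map_mul, map_add, map_one, map_ofNat, Complex.conj_ofReal]
    linear_combination (-2 * s : ℂ) * h0'
  · push_cast
    field_simp
    ring

theorem smooth_bandToClass : ContDiffOn ℝ ∞ bandToClass (kleinBottle ∩ {n | n.2.1 ≠ 1}) := by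
  have hq : ContDiffOn ℝ ∞ (fun n : ℂ × ℝ × ℂ => √(1 - n.2.1)) (kleinBottle ∩ {n | n.2.1 ≠ 1}) :=
    ContDiffOn.sqrt (contDiffOn_const.sub (contDiff_fst.comp contDiff_snd).contDiffOn)
      fun n hn => (klein_height hn.1 hn.2).ne'
  have hu : ContDiffOn ℝ ∞ (fun n : ℂ × ℝ × ℂ => n.2.2) (kleinBottle ∩ {n | n.2.1 ≠ 1}) :=
    (contDiff_snd.comp contDiff_snd).contDiffOn
  have hz : ContDiffOn ℝ ∞ bandRatio (kleinBottle ∩ {n | n.2.1 ≠ 1}) := by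
    refine contDiffOn_const.add (smooth_div contDiff_fst.contDiffOn
      (smooth_ofReal (contDiffOn_const.mul hq)) fun n hn => ?_)
    exact_mod_cast mul_ne_zero two_ne_zero (Real.sqrt_pos.2 (klein_height hn.1 hn.2)).ne'
  have hz0 : ∀ n ∈ kleinBottle ∩ {n : ℂ × ℝ × ℂ | n.2.1 ≠ 1}, bandRatio n ≠ 0 :=
    fun n hn => bandRatio_ne hn.1 hn.2
  have hv := smooth_vec3 hz (contDiffOn_const (c := (1 : ℂ)))
    ((contDiffOn_const (c := (-1 : ℂ))).sub hz)
  have hvi : ∀ i, ContDiffOn ℝ ∞ (fun n => affVec (bandRatio n) i)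
      (kleinBottle ∩ {n | n.2.1 ≠ 1}) := contDiffOn_pi.1 hv
  refine ContDiffOn.prodMk (contDiffOn_pi.2 fun i => contDiffOn_pi.2 fun j => ?_)
    (smooth_vec3 (smooth_conj hu) (smooth_div (hu.mul (smooth_conj hz)) hz hz0)
      (smooth_div hz (smooth_conj hz) fun n hn => by simpa using hz0 n hn))
  simp only [projMatrix_apply]
  refine smooth_div ((hvi i).mul (smooth_conj (hvi j))) ?_ fun n _ => nsq_ne_zero (affVec_ne _)
  simp only [nsq]
  exact ContDiffOn.sum fun k _ => (hvi k).mul (smooth_conj (hvi k))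

theorem bandToClass_embedding :
    IsOpenSmoothEmbedding bandToClass (kleinBottle ∩ {n | n.2.1 ≠ 1}) classVariety ∧
      bandToClass '' (kleinBottle ∩ {n | n.2.1 ≠ 1}) = classVariety ∩
        {y | 4 * Complex.normSq (y.1 0 1 + y.1 1 1) < Complex.normSq (y.1 1 1)} := by
  refine IsOpenSmoothEmbedding.of_inverse (g := classToBand) ?_ smooth_bandToClass ?_ ?_ ?_ ?_ ?_
  · exact isOpen_lt (by fun_prop) (by fun_prop)
  · have h1 : ∀ y ∈ classVariety ∩ {y : ClassSpace |
        4 * Complex.normSq (y.1 0 1 + y.1 1 1) < Complex.normSq (y.1 1 1)}, y.1 1 1 ≠ 0 :=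
      fun y hy => (classToBand_spec hy.1 hy.2).1
    have hη := ContDiffOn.add (smooth_div (smooth_entry 0 1) (smooth_entry 1 1) h1)
      (contDiffOn_const (c := (1 : ℂ)))
    have hN := (contDiffOn_const (c := (4 : ℝ))).mul (smooth_normSq hη)
    refine ContDiffOn.prodMk ((contDiffOn_const.mul hη).mul (smooth_ofReal
      (ContDiffOn.sqrt (contDiffOn_const.sub hN) fun y hy => ?_))) (hN.prodMk
        (smooth_conj (smooth_dir 0)))
    exact (sub_pos.2 (classToBand_spec hy.1 hy.2).2.1).ne'
  · rintro n ⟨hn, h1⟩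
    refine ⟨mk_mem_classVariety (affVec_mem _) (affVec_ne _) (directions_band hn h1), ?_⟩
    have hnq := nsq_ne_zero (affVec_ne (bandRatio n))
    have hb := normSq_bandRatio hn h1
    obtain ⟨e0, e1, -⟩ := projMatrix_affVec (bandRatio n)
    simp only [mem_ofPred_eq, bandToClass]
    rw [e0, e1, ← add_div, map_div₀, map_div₀, ← mul_div_assoc, hb, map_one]
    rw [div_lt_div_iff_of_pos_right (Complex.normSq_pos.2 hnq)]
    linarith [klein_height hn h1]
  · rintro y ⟨hy, hO⟩
    obtain ⟨-, hlt, hk, -⟩ := classToBand_spec hy hO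
    exact ⟨hk, hlt.ne⟩
  · rintro n ⟨hn, h1⟩
    have hq := klein_height hn h1
    have hs0 : (√(1 - n.2.1) : ℂ) ≠ 0 := by exact_mod_cast (Real.sqrt_pos.2 hq).ne'
    simp only [classToBand, bandToClass, projMatrix_affVec_div, normSq_bandRatio hn h1,
      Matrix.cons_val, Complex.conj_conj]
    refine Prod.ext ?_ rfl
    simp only
    rw [bandRatio_add_one]
    push_cast
    field_simp
  · rintro y ⟨hy, hO⟩
    obtain ⟨h1, hlt, -, hz⟩ := classToBand_spec hy hO
    obtain ⟨hM, hd⟩ := exists_affVec hy h1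
    have hz0 := ne_zero_of_normSq_add_one hlt
    have hz0' : conj (y.1 0 1 / y.1 1 1) ≠ 0 := by simpa using hz0
    have h2 := hd.two
    simp only [affVec, Matrix.cons_val, map_one, mul_one] at h2
    have hu2 : y.2 2 = (y.1 0 1 / y.1 1 1) / conj (y.1 0 1 / y.1 1 1) := by
      rw [eq_div_iff hz0', h2]
    simp only [bandToClass, hz]
    refine Prod.ext hM.symm (funext fun i => ?_)
    fin_cases i
    · simp [classToBand]
    · have hp := hd.prod
      have hu0 := hd.unit 0
      simp only [classToBand, Fin.mk_one, Matrix.cons_val]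
      rw [div_eq_iff hz0]
      linear_combination y.2 1 * h2 + conj (y.1 0 1 / y.1 1 1) *
        (y.2 1 * y.2 2 * hu0 - conj (y.2 0) * hp)
    · exact hu2.symm

/-- If M_22 = 0, the rank-one relations kill the last row, and the column sums give M_01 = -M_11.
This M_11 is nonzero because the trace is 1. -/
theorem band_of_side_eq_zero {y : ClassSpace} (hy : y ∈ classVariety) (h2 : y.1 2 2 = 0) :
    4 * Complex.normSq (y.1 0 1 + y.1 1 1) < Complex.normSq (y.1 1 1) := by
  obtain ⟨hconj, hrank, htr, hcol, -⟩ := hy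
  have hz : ∀ i, y.1 2 i = 0 := by
    intro i
    have := hrank i i 2
    rw [h2, mul_zero, ← hconj 2 i, mul_comm, Complex.mul_conj] at this
    exact Complex.normSq_eq_zero.1 (by exact_mod_cast this)
  have e0 := hcol 0
  have e1 := hcol 1
  rw [Fin.sum_univ_three, hz, add_zero] at e0 e1
  rw [Fin.sum_univ_three, h2, add_zero] at htr
  rw [e1, map_zero, mul_zero]
  refine Complex.normSq_pos.2 fun h1 => ?_
  rw [h1, add_zero] at e1 htr
  rw [← hconj 0 1, e1, map_zero, add_zero, htr] at e0
  exact one_ne_zero e0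

/-- Classes with nonzero third side form the Klein bottle without `doublePt`, and the others lie in
the band. On the overlap both maps describe the class of the same ratio z. -/
theorem isConnectedSum_classVariety :
    IsConnectedSum classVariety kleinBottle realProjectivePlane := by
  refine isConnectedSum_of_blowup (k := kleinDisc) (j := kleinToClass)
    (b := bandToClass ∘ toKlein) kleinDisc_embedding ?_
    (bandToClass_embedding.1.comp toKlein_embedding.1 toKlein_embedding.2) ?_ ?_ ?_
  · rw [kleinDisc_zero]
    exact kleinToClass_embedding.1
  · rw [kleinDisc_zero, image_comp, toKlein_embedding.2, bandToClass_embedding.2,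
      kleinToClass_embedding.2]
    intro y hy
    by_cases h : y.1 2 2 = 0
    · exact Or.inr ⟨hy, band_of_side_eq_zero hy h⟩
    · exact Or.inl ⟨hy, h⟩
  · intro w hw
    have hw' : (conj w)⁻¹ ≠ 0 := by simpa using hw
    have hm := mem_image_of_mem toKlein (planeChart_mem_diff hw')
    rw [toKlein_embedding.2] at hm
    have hd := directions_band hm.1 hm.2
    -- The inversion in the gluing cancels the flip in `ratioChart`. Then ω/√(1 - p) = w/√(1 +
    -- |w|²), exactly the contraction in `doubleDisc`, so the two ratios agree.
    have hband : toKlein (planeChart (conj w)⁻¹) = ratioChart w := by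
      rw [ratioChart, toKlein_planeChart_inv hw, flip_flip]
    have hratio : bandRatio (toKlein (planeChart (conj w)⁻¹)) = doubleDisc w := by
      have h := one_add_normSq_pos w
      have hs := Real.sq_sqrt h.le
      have hs0 : (√(1 + Complex.normSq w) : ℂ) ≠ 0 := by
        exact_mod_cast (Real.sqrt_pos.2 h).ne'
      rw [hband, bandRatio, doubleDisc, ratioChart_eq, sub_sub_cancel, Real.sqrt_inv]
      congr 1
      rw [← hs, Real.sqrt_sq (Real.sqrt_nonneg _)]
      push_cast
      field_simp
    have hz0 := bandRatio_ne hm.1 hm.2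
    rw [hratio] at hd hz0
    have hk : kleinDisc w ∈ kleinBottle \ {doublePt} := by
      refine ⟨ratioChart_mem hz0, fun h => hw ?_⟩
      rw [mem_singleton_iff, ← kleinDisc_zero] at h
      exact kleinDisc_embedding.injOn trivial trivial h
    have hk1 : (kleinDisc w).2.1 ≠ 1 := by
      have := inv_pos.2 (one_add_normSq_pos (doubleDisc w))
      simp only [kleinDisc, Function.comp, ratioChart_eq]
      linarith
    obtain ⟨h1z, heq⟩ := kleinToClass_eq_affVec hk.1 (thirdSide_ne hk) hk1
    have hdiv : (kleinDisc w).1 / (1 - (kleinDisc w).2.1 : ℝ) = doubleDisc w := ratioChart_div _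
    rw [hdiv] at h1z heq
    rw [heq]
    refine Prod.ext ?_ ?_
    · simp only [Function.comp, bandToClass, hratio]
    · simp only [Function.comp]
      rw [eq_affDir hd h1z]
      congr 1
      simp only [bandToClass, hratio, Matrix.cons_val, div_conj_eq, kleinDisc, Function.comp,
        ratioChart_eq]
  -- On the line at infinity p = 0 and ω = 0, so z = -1 and the third side vanishes, which the image
  -- of `kleinToClass` excludes.
  · intro x hx y hy hxy h0
    rw [kleinDisc_zero] at hx
    have hm := mem_image_of_mem toKlein hy
    rw [toKlein_embedding.2] at hm
    have h2 := mem_image_of_mem kleinToClass hx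
    rw [kleinToClass_embedding.2, hxy] at h2
    apply affVec_one_add_ne h2.2
    have hω : (toKlein y).1 = 0 := by
      have := klein_normSq hm.1
      rw [toKlein_snd, h0, zero_mul] at this
      exact Complex.normSq_eq_zero.1 this
    rw [bandRatio, hω]
    simp

theorem isDyckSurface_classes : IsDyckSurface (classEmb '' classes) := by
  rw [classEmb_image]
  exact ⟨ℂ × ℝ × ℂ, inferInstance, inferInstance, inferInstance, kleinBottle,
    isConnectedSum_kleinBottle, isConnectedSum_classVariety⟩

end TriangleSpace

end

theorem theorem5p2 :
    -- `P(X) ≅ P¹(ℂ)`, and `φ` is a bijection of `𝔇` onto the real blowup of `P(X)` at `[H]`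
    Nonempty (TriangleSpace.X ≃ₗ[ℂ] (Fin 2 → ℂ)) ∧
    Set.BijOn TriangleSpace.phi TriangleSpace.classes TriangleSpace.blowup ∧
    -- `𝔇` is a smooth real algebraic surface, and `φ` is an isomorphism of varieties
    TriangleSpace.IsSmoothVariety (TriangleSpace.classEmb '' TriangleSpace.classes) 2 ∧
    (∃ f g, TriangleSpace.IsRegularIso f g (TriangleSpace.classEmb '' TriangleSpace.classes)
        (TriangleSpace.blowupEmb '' TriangleSpace.blowup) ∧
      ∀ d ∈ TriangleSpace.classes,
        f (TriangleSpace.classEmb d) = TriangleSpace.blowupEmb (TriangleSpace.phi d)) ∧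
    -- it is Dyck's surface
    TriangleSpace.IsDyckSurface (TriangleSpace.classEmb '' TriangleSpace.classes) ∧
    -- the commutative diagram
    TriangleSpace.triangles = TriangleSpace.iteratedBlowup ∧
    (∀ T : TriangleSpace.triangles, TriangleSpace.tau T ∈ TriangleSpace.blowup ∧
      TriangleSpace.phi (TriangleSpace.classOf T) = TriangleSpace.tau T) :=
  ⟨TriangleSpace.X_equiv, TriangleSpace.bijOn_phi, TriangleSpace.isSmoothVariety_classes,
    TriangleSpace.exists_regularIso, TriangleSpace.isDyckSurface_classes,
    TriangleSpace.triangles_eq_iteratedBlowup,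
    fun T => ⟨TriangleSpace.tau_mem_blowup T, TriangleSpace.phi_classOf T⟩⟩
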